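/- **Conventions.** Sequences are finite sequences $\alpha=(\alpha_1,\dots,\alpha_k)$ of positive integers, of length $l(\alpha)=k$ and degree $D(\alpha)=\sum\alpha_i$; juxtaposition is concatenation, powers are repeated concatenation, and the sequence $(0)$ is identified with the empty word. Put $\alpha<\beta$ if the first nonzero term of $(\alpha_1,-\alpha_2,\alpha_3,\dots,0,0,\dots)-(\beta_1,-\beta_2,\beta_3,\dots,0,0,\dots)$ is negative; then $\alpha$ is called a preceding of $\beta$. A sequence is lexical if it is greater than each right sequence $(\alpha_i,\dots,\alpha_k)$, $2\le i\le k$. $L_n$ is the set of lexical sequences of degree $n-1$ (so $L_1=\{(0)\}$). $\alpha$ is adjacent to $\beta$ in $L_n$ if $\alpha,\beta\in L_n$, $\alpha<\beta$ and no $\gamma\in L_n$ satisfies $\alpha<\gamma<\beta$. Let $\alpha^{+}=(\alpha_1,\dots,\alpha_k+1)$; put $\alpha_e=\alpha^+$, $\alpha_o=\alpha(1)$ if $l(\alpha)$ is even and $\alpha_e=\alpha(1)$, $\alpha_o=\alpha^+$ if $l(\alpha)$ is odd. The harmonics of $\alpha$ are $h_0(\alpha)=\alpha$, $h_{j}(\alpha)=(h_{j-1}(\alpha))_o\,h_{j-1}(\alpha)$,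 with $h_1((0))=(1)$; $g$ is fundamental if it is not $h_j(\tau)$ for any $j\ge1$ and any sequence $\tau$. The star product is $\alpha\star\beta=\alpha_o\alpha_e^{\beta_1-1}\cdots\alpha_o\alpha_e^{\beta_k-1}\alpha$, with $(0)\star\beta=\beta$. $\alpha\wedge\beta$ is the longest common left factor: $\alpha\wedge\alpha=\alpha$, and $\alpha\wedge\beta=(\alpha_1,\dots,\alpha_{i-1},\min(\alpha_i,\beta_i))$ if $i$ is the first place where $\alpha_i\ne\beta_i$. An elementary operation on the $i$-th cell of $\alpha$ replaces $\alpha_i$ by the two entries $\alpha_i-1,1$ if $\alpha_i>1$, and replaces $\alpha_{i-1},\alpha_i$ by the single entry $\alpha_{i-1}+1$ if $\alpha_i=1$ and $i\ge2$. For fundamental $g\in L_m$, a sequence $\widehat g$ is called a companion of $g$ if one of the following holds: (i) there are an odd $r>1$ and $\tau\in L_{m_1}$ with $m=m_1r$, $g=\tau\star(2,1^{r-3})$ (for $r=3$ read $(2)$) and $\widehat g=\tau\star(1^{r-1})$; (ii) $g$ is not least in $L_m$, $\widehat g$ is adjacent to $g$ in $L_m$, and there are $\tau\in L_{m_1}$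 with $m_1\nmid m$ and a (possibly empty) sequence $\zeta$ with $g=\tau_o\zeta$, $\widehat g=\tau_e\zeta$. **Theorem.** Let $\alpha'\in L_n$ be not minimal in $L_n$. 1. If $n=md$ with $d\ge2$ and $\alpha'=g\star\lambda$ for some fundamental $g\in L_m$, where $\lambda$ is the least element of $L_d$, then $g$ has a companion $\widehat g$, and for every companion $\widehat g$ of $g$ the sequence $g_e^{\,d-1}\widehat g$ is adjacent to $\alpha'$ in $L_n$. 2. Otherwise (if there are no such $m,d,g$), some elementary operation on an odd-numbered cell of $\alpha'$ gives a lexical preceding $\alpha\in L_n$ of $\alpha'$. If $\alpha$ is obtained in this way from the tail of the longest left sequence of odd length which gives a lexical preceding in $L_n$, then $\alpha$ is adjacent to $\alpha'$ in $L_n$; moreover $\alpha\wedge\alpha'\in L_m$ for some $m$ with $n=md+r$, $0<r<m$. -/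

import Mathlib

namespace AlphaSeq

/-- A finite sequence of positive integers.  The empty list plays the role of the sequence `(0)`
(the only element of `L_1`), which is also called the empty word. -/
def IsSeq (α : List ℕ) : Prop := ∀ a ∈ α, 0 < a

/-- The entries of `Al(α) = (α₁, -α₂, α₃, -α₄, …, 0, 0, …)`, indexed from `0`. -/
def al (α : List ℕ) (i : ℕ) : ℤ := (-1) ^ i * (α.getD i 0 : ℤ)

/-- The order on sequences: the first nonzero term of `Al(α) - Al(β)` is negative. -/
def Lt (α β : List ℕ) : Prop := ∃ i, (∀ j < i, al α j = al β j) ∧ al α i < al β i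

/-- `α` is greater than each of its proper right sequences `(α_i, …, α_k)`, `2 ≤ i ≤ k`. -/
def IsLexical (α : List ℕ) : Prop := ∀ i, 1 ≤ i → i < α.length → Lt (α.drop i) α

/-- `L_n`: the lexical sequences of degree `n - 1`; `L 1 = {[]}`. -/
def L (n : ℕ) : Set (List ℕ) := {α | IsSeq α ∧ IsLexical α ∧ 1 + α.sum = n}

/-- `α` is the least element of `S`. -/
def IsLeastIn (S : Set (List ℕ)) (α : List ℕ) : Prop := α ∈ S ∧ ∀ β ∈ S, β ≠ α → Lt α β

/-- `α` is adjacent to `β` in `S`: both lie in `S`, `α < β`, and nothing in `S` lies between. -/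
def IsAdjacentTo (S : Set (List ℕ)) (α β : List ℕ) : Prop :=
  α ∈ S ∧ β ∈ S ∧ Lt α β ∧ ¬ ∃ γ ∈ S, Lt α γ ∧ Lt γ β

/-- Add `1` to the last entry. -/
def incLast (α : List ℕ) : List ℕ := α.dropLast ++ [α.getLastD 0 + 1]

/-- `α_e`, of even length. -/
def evenExt (α : List ℕ) : List ℕ := if Even α.length then incLast α else α ++ [1]

/-- `α_o`, of odd length. -/
def oddExt (α : List ℕ) : List ℕ := if Even α.length then α ++ [1] else incLast α

/-- The `q`-th power of a sequence for the product given by concatenation. -/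
def pow (α : List ℕ) (q : ℕ) : List ℕ := (List.replicate q α).flatten

/-- The harmonics `h_0(α) = α`, `h_{j+1}(α) = (h_j(α))_o h_j(α)`; in particular `h_1(0) = (1)`. -/
def harmonic : ℕ → List ℕ → List ℕ
  | 0, α => α
  | j + 1, α => oddExt (harmonic j α) ++ harmonic j α

/-- Not a harmonic of another sequence. -/
def IsFundamental (g : List ℕ) : Prop := ¬ ∃ τ j, IsSeq τ ∧ 1 ≤ j ∧ harmonic j τ = g

/-- The star product `α_o (α_e)^{β₁-1} ⋯ α_o (α_e)^{β_k-1} α`, where the empty word is a left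
identity. -/
def star (α β : List ℕ) : List ℕ :=
  if α = [] then β else (β.flatMap fun b => oddExt α ++ pow (evenExt α) (b - 1)) ++ α

/-- The longest common left factor `α ∧ β`. -/
def wedge : List ℕ → List ℕ → List ℕ
  | a :: α, b :: β => if a = b then a :: wedge α β else [min a b]
  | _, _ => []

/-- `ElemOpAt i α β`: `β` is obtained from `α` by one elementary operation on the cell number `i`
(counted from `1`): a cell of value `a > 1` is split into two cells `a - 1, 1`, and a cell of
value `1` is merged with its left neighbour of value `b` into one cell of value `b + 1`. -/
inductive ElemOpAt : ℕ → List ℕ → List ℕ → Prop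
  | splitCell (γ ρ : List ℕ) (a : ℕ) (ha : 1 < a) :
      ElemOpAt (γ.length + 1) (γ ++ a :: ρ) (γ ++ (a - 1) :: 1 :: ρ)
  | conjCell (γ ρ : List ℕ) (b : ℕ) :
      ElemOpAt (γ.length + 2) (γ ++ b :: 1 :: ρ) (γ ++ (b + 1) :: ρ)

/-- `β` is obtained from `α` by one elementary operation on the tail of the left sequence of length
`i`, where `i` is odd and `β` is a lexical preceding of `α` in `L n`. -/
def IsOddPreceding (n i : ℕ) (α β : List ℕ) : Prop :=
  Odd i ∧ ElemOpAt i α β ∧ β ∈ L n ∧ Lt β α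

/-- `β` is obtained from `α` by one elementary operation on the tail of the longest left sequence
of odd length which gives a lexical preceding in `L n`. -/
def IsLongestOddPreceding (n : ℕ) (α β : List ℕ) : Prop :=
  ∃ i, IsOddPreceding n i α β ∧ ∀ j β', IsOddPreceding n j α β' → j ≤ i

/-- The companion `ĝ` of a sequence `g ∈ L m`.  Either `g = τ ⋆ (2, 1^{r-3})` and
`ĝ = τ ⋆ (1^{r-1})` for an odd `r > 1` and some `τ ∈ L m₁` with `m = m₁ r`; or `g` is not least in
`L m`, `g = τ_o ζ` and `ĝ = τ_e ζ` for some `τ ∈ L m₁` with `m₁ ∤ m` and some `ζ`, and `ĝ` is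
adjacent to `g` in `L m`. -/
def IsCompanion (m : ℕ) (g gh : List ℕ) : Prop :=
  (∃ m₁ r τ, τ ∈ L m₁ ∧ m = m₁ * r ∧ Odd r ∧ 1 < r ∧
      g = star τ (2 :: List.replicate (r - 3) 1) ∧ gh = star τ (List.replicate (r - 1) 1)) ∨
  (¬ IsLeastIn (L m) g ∧ IsAdjacentTo (L m) gh g ∧
    ∃ m₁ τ ζ, τ ∈ L m₁ ∧ ¬ m₁ ∣ m ∧ IsSeq ζ ∧ g = oddExt τ ++ ζ ∧ gh = evenExt τ ++ ζ)

/-- `n = m d` with `d ≥ 2`, and `α = g ⋆ lam` where `g ∈ L m` is fundamental and `lam` is the least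
element of `L d`. -/
def IsStarOfLeast (n m d : ℕ) (g lam α : List ℕ) : Prop :=
  n = m * d ∧ 2 ≤ d ∧ g ∈ L m ∧ IsFundamental g ∧ IsLeastIn (L d) lam ∧ α = star g lam

end AlphaSeq

/-! Binary words, ordered by the value of a balanced ternary expansion: the end of a word ranks
strictly between the letters `false` and `true`. -/

namespace KneadingWord

/-! Encode a sequence as the word 1^{α₁} 0^{α₂} 1^{α₃} … (`enc`; 1 is `true`, 0 is `false`) and give
words balanced ternary values. The alternating order becomes the order of values, complementation
(written z̄) becomes negation, and a sequence is lexical iff every right factor of its word is at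
most the whole word in absolute value. For nonempty τ, τ_o ζ and τ_e ζ become τ 1 ζ̄ and τ 0 ζ; an
elementary operation on an odd-numbered cell turns u 1 x into u 0 x̄; the star product becomes a
substitution; a sequence is fundamental iff its word is not of the form w 1 w̄.

Let u 0 z < u 1 x be consecutive lexical words of length n - 1, and put m = |u| + 1.

If m ∤ n, then x = z̄ (`eq_bar_of_gap`), so the predecessor arises by an elementary operation. The
proof uses the map `step u`, which deletes the first letter, takes the absolute value, and sends the
empty word to u. A word of length k whose right factors are bounded by u is, up to sign, a point
reaching the empty word at time k. Here z is the greatest word of its length with all right factors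
strictly below u, and no point above z reaches the empty word at time |z| (`not_hit_of_max`). If x̄
< z, then u 1 z̄ is lexical and fills the gap. If x̄ > z, cutting x̄ at its too large factors and
adding hitting times (`Hit.add`) produces the forbidden hit. `Hit.add` rests on the intermediate
value property and a dichotomy at the first return time k₀: either the iterate of order k₀ + 1
covers the points above the threshold, or it maps them into themselves and k₀ + 1 divides k + 1 for
every hitting time k.

If m ∣ n, the greater word is u ⋆ λ with λ least (`LexCovBy.eq_append_sub`), and u is fundamental
because a 0 follows it in a lexical word (`ne_of_wLex`). Conversely, the predecessor of g ⋆ λ is (g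
0)^{d-1} h, where h is the greatest word of the length of g with all right factors strictly below g
(`Mate`). A companion encodes exactly such an h: in one case by an explicit computation, in the
other by the analysis for m ∤ n applied to g itself. The main point is that g 0 h is lexical
(`Mate.neg_le`), which uses that g is the only point above h hitting at time |g| (`Isolated`). -/

/-- The value of a letter. -/
def sgn (b : Bool) : ℚ := if b then 1 else -1

/-- The value of a word; words are compared by their values. -/
def val : List Bool → ℚ
  | [] => 0
  | b :: w => (sgn b + val w) / 3

/-- Exchange the two letters. -/
def bar (w : List Bool) : List Bool := w.map (!·)

/-- The nonnegative one among `w` and `bar w`. -/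
def pos (w : List Bool) : List Bool := if val w < 0 then bar w else w

@[simp] lemma sgn_true : sgn true = 1 := rfl
@[simp] lemma sgn_false : sgn false = -1 := rfl
@[simp] lemma val_nil : val [] = 0 := rfl
lemma val_cons (b : Bool) (w : List Bool) : val (b :: w) = (sgn b + val w) / 3 := rfl
@[simp] lemma val_true (w : List Bool) : val (true :: w) = (1 + val w) / 3 := rfl
@[simp] lemma val_false (w : List Bool) : val (false :: w) = (-1 + val w) / 3 := rfl
@[simp] lemma bar_nil : bar [] = [] := rfl
@[simp] lemma bar_cons (b : Bool) (w : List Bool) : bar (b :: w) = (!b) :: bar w := rfl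
@[simp] lemma bar_append (v w : List Bool) : bar (v ++ w) = bar v ++ bar w := by simp [bar]
@[simp] lemma bar_bar (w : List Bool) : bar (bar w) = w := by
  induction w with
  | nil => rfl
  | cons b w ih => simp [ih]
@[simp] lemma length_bar (w : List Bool) : (bar w).length = w.length := by simp [bar]

lemma sgn_not (b : Bool) : sgn (!b) = -sgn b := by cases b <;> simp

@[simp] lemma val_bar (w : List Bool) : val (bar w) = -val w := by
  induction w with
  | nil => simp
  | cons b w ih => simp only [bar_cons, val_cons, ih, sgn_not]; ring

lemma abs_val_le (w : List Bool) : |val w| ≤ (1 - (1 / 3) ^ w.length) / 2 := by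
  induction w with
  | nil => simp
  | cons b w ih =>
    rw [abs_le] at *
    rw [List.length_cons, pow_succ]
    cases b <;> simp only [val_true, val_false] <;> constructor <;>
      linarith [pow_pos (by norm_num : (0:ℚ) < 1/3) w.length,
        pow_le_one₀ (n := w.length) (by norm_num : (0:ℚ) ≤ 1/3) (by norm_num)]

lemma val_lt_half (w : List Bool) : val w < 1 / 2 := by
  have := (abs_le.1 (abs_val_le w)).2
  linarith [pow_pos (by norm_num : (0:ℚ) < 1/3) w.length]

lemma neg_half_lt_val (w : List Bool) : -(1 / 2) < val w := by
  have := val_lt_half (bar w)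
  rw [val_bar] at this; linarith

lemma val_true_pos (w : List Bool) : 0 < val (true :: w) := by
  simp only [val_true]; linarith [neg_half_lt_val w]

lemma val_false_neg (w : List Bool) : val (false :: w) < 0 := by
  simp only [val_false]; linarith [val_lt_half w]

lemma val_append (v w : List Bool) : val (v ++ w) = val v + val w * (1 / 3) ^ v.length := by
  induction v with
  | nil => simp
  | cons b v ih => simp only [List.cons_append, val_cons, ih, List.length_cons, pow_succ]; ring

lemma val_append_lt {v x y : List Bool} : val (v ++ x) < val (v ++ y) ↔ val x < val y := by
  rw [val_append, val_append, add_lt_add_iff_left, mul_lt_mul_iff_left₀ (by positivity)]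

lemma val_append_le {v x y : List Bool} : val (v ++ x) ≤ val (v ++ y) ↔ val x ≤ val y := by
  rw [← not_lt, ← not_lt, val_append_lt]

lemma lt_val_append {v x : List Bool} : val v < val (v ++ x) ↔ 0 < val x := by
  simpa using val_append_lt (v := v) (x := []) (y := x)

lemma val_append_lt_self {v x : List Bool} : val (v ++ x) < val v ↔ val x < 0 := by
  simpa using val_append_lt (v := v) (x := x) (y := [])

lemma le_val_append {v x : List Bool} : val v ≤ val (v ++ x) ↔ 0 ≤ val x := by
  simpa using val_append_le (v := v) (x := []) (y := x)

lemma val_append_le_self {v x : List Bool} : val (v ++ x) ≤ val v ↔ val x ≤ 0 := by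
  simpa using val_append_le (v := v) (x := x) (y := [])

lemma val_lt_append_true (v x : List Bool) : val v < val (v ++ true :: x) := by
  rw [val_append]
  have := mul_pos (val_true_pos x) (by positivity : (0:ℚ) < (1/3)^v.length)
  linarith

lemma val_append_false_lt (v x : List Bool) : val (v ++ false :: x) < val v := by
  rw [val_append]
  have := mul_neg_of_neg_of_pos (val_false_neg x) (by positivity : (0:ℚ) < (1/3)^v.length)
  linarith

lemma val_append_false_lt_true (v x y : List Bool) :
    val (v ++ false :: x) < val (v ++ true :: y) :=
  (val_append_false_lt v x).trans (val_lt_append_true v y)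

lemma val_inj {x y : List Bool} (h : val x = val y) : x = y := by
  induction x generalizing y with
  | nil =>
    rcases y with _ | ⟨_ | _, y⟩
    · rfl
    · linarith [val_false_neg y, val_nil]
    · linarith [val_true_pos y, val_nil]
  | cons b x ih =>
    rcases y with _ | ⟨c, y⟩
    · cases b
      · linarith [val_false_neg x, val_nil]
      · linarith [val_true_pos x, val_nil]
    · have hb := neg_half_lt_val x
      have hb' := val_lt_half x
      have hc := neg_half_lt_val y
      have hc' := val_lt_half y
      cases b <;> cases c <;> simp only [val_true, val_false] at h
      · rw [ih (by linarith)]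
      · linarith
      · linarith
      · rw [ih (by linarith)]

lemma val_pos_iff_head {w : List Bool} : 0 < val w ↔ ∃ t, w = true :: t := by
  rcases w with _ | ⟨_ | _, w⟩
  · simp
  · simpa only [reduceCtorEq, List.cons.injEq, false_and, exists_false, iff_false, not_lt,
      Bool.false_eq_true] using (val_false_neg w).le
  · exact iff_of_true (val_true_pos w) ⟨w, rfl⟩

lemma val_nonneg_iff {w : List Bool} : 0 ≤ val w ↔ w = [] ∨ ∃ t, w = true :: t := by
  rcases w with _ | ⟨_ | _, w⟩
  · simp
  · simpa only [reduceCtorEq, List.cons.injEq, false_and, exists_false, or_self, iff_false, not_le,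
      Bool.false_eq_true] using val_false_neg w
  · exact iff_of_true (val_true_pos w).le (Or.inr ⟨w, rfl⟩)

lemma val_pos (w : List Bool) : val (pos w) = |val w| := by
  unfold pos
  split_ifs with h
  · rw [val_bar, abs_of_neg h]
  · rw [abs_of_nonneg (not_lt.1 h)]

lemma val_pos_nonneg (w : List Bool) : 0 ≤ val (pos w) := by rw [val_pos]; exact abs_nonneg _

lemma pos_eq_or (w : List Bool) : pos w = w ∨ pos w = bar w := by
  unfold pos; split_ifs <;> simp

@[simp] lemma length_pos (w : List Bool) : (pos w).length = w.length := by
  rcases pos_eq_or w with h | h <;> rw [h]; simp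

lemma pos_of_nonneg {w : List Bool} (h : 0 ≤ val w) : pos w = w := by
  unfold pos; rw [if_neg (not_lt.2 h)]

@[simp] lemma pos_bar (w : List Bool) : pos (bar w) = pos w :=
  val_inj (by rw [val_pos, val_pos, val_bar, abs_neg])

lemma eq_pos_or_bar (w : List Bool) : w = pos w ∨ w = bar (pos w) := by
  rcases pos_eq_or w with h | h <;> rw [h] <;> simp

/-- By `val_append` and `|val r| < 1/2`, the words with left factor `a` fill the ball of radius
`(1/3)^|a| / 2` about `val a`, and nothing else lies in it. -/
lemma exists_append_of_close (a y : List Bool) (h : |val y - val a| * 2 < (1 / 3) ^ a.length) :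
    ∃ r, y = a ++ r := by
  induction a generalizing y with
  | nil => exact ⟨y, rfl⟩
  | cons b a ih =>
    rw [List.length_cons, pow_succ, ← lt_div_iff₀ (by norm_num), abs_lt] at h
    have ha := abs_le.1 (abs_val_le a)
    have hp : (1 / 3 : ℚ) ^ a.length ≤ 1 := pow_le_one₀ (by norm_num) (by norm_num)
    rcases y with _ | ⟨c, y⟩
    · exfalso
      cases b <;> simp only [val_true, val_false, val_nil] at h <;> linarith
    · have hy := val_lt_half y
      have hy' := neg_half_lt_val y
      cases b <;> cases c <;> simp only [val_true, val_false] at h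
      · obtain ⟨r, hr⟩ := ih y (by rw [← lt_div_iff₀ (by norm_num), abs_lt]; constructor <;> linarith)
        exact ⟨r, by rw [hr]; rfl⟩
      · exfalso; linarith
      · exfalso; linarith
      · obtain ⟨r, hr⟩ := ih y (by rw [← lt_div_iff₀ (by norm_num), abs_lt]; constructor <;> linarith)
        exact ⟨r, by rw [hr]; rfl⟩

lemma exists_append_of_between {a r s y : List Bool} (h₁ : val (a ++ r) ≤ val y)
    (h₂ : val y ≤ val (a ++ s)) : ∃ t, y = a ++ t := by
  apply exists_append_of_close
  rw [val_append] at h₁ h₂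
  have hp : (0 : ℚ) < (1 / 3) ^ a.length := by positivity
  have hr := mul_lt_mul_of_pos_right (neg_half_lt_val r) hp
  have hs := mul_lt_mul_of_pos_right (val_lt_half s) hp
  rw [← lt_div_iff₀ (by norm_num), abs_lt]
  constructor <;> linarith

/-- The first difference of two words. -/
lemma exists_split {x y : List Bool} (h : val x < val y) : ∃ c,
    (∃ x' y', x = c ++ false :: x' ∧ y = c ++ true :: y') ∨ (∃ y', x = c ∧ y = c ++ true :: y') ∨
      (∃ x', x = c ++ false :: x' ∧ y = c) := by
  induction x generalizing y with
  | nil =>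
    rcases y with _ | ⟨_ | _, y⟩
    · simp at h
    · exact absurd h (not_lt.2 (val_false_neg y).le)
    · exact ⟨[], Or.inr (Or.inl ⟨y, rfl, rfl⟩)⟩
  | cons b x ih =>
    rcases y with _ | ⟨c, y⟩
    · cases b
      · exact ⟨[], Or.inr (Or.inr ⟨x, rfl, rfl⟩)⟩
      · exact absurd h (not_lt.2 (val_true_pos x).le)
    · by_cases hbc : b = c
      · subst hbc
        have h' : val x < val y := by
          have := (val_append_lt (v := [b]) (x := x) (y := y)).1 h
          exact this
        obtain ⟨d, hd⟩ := ih h'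
        refine ⟨b :: d, ?_⟩
        rcases hd with ⟨x', y', rfl, rfl⟩ | ⟨y', rfl, rfl⟩ | ⟨x', rfl, rfl⟩
        · exact Or.inl ⟨x', y', rfl, rfl⟩
        · exact Or.inr (Or.inl ⟨y', rfl, rfl⟩)
        · exact Or.inr (Or.inr ⟨x', rfl, rfl⟩)
      · cases b <;> cases c <;> simp at hbc
        · exact ⟨[], Or.inl ⟨x, y, rfl, rfl⟩⟩
        · exact absurd h (not_lt.2 ((val_false_neg y).trans (val_true_pos x)).le)

lemma exists_split_of_length {x y : List Bool} (h : val x < val y) (hl : x.length = y.length) :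
    ∃ c x' y', x = c ++ false :: x' ∧ y = c ++ true :: y' := by
  obtain ⟨c, h | ⟨y', rfl, rfl⟩ | ⟨x', rfl, rfl⟩⟩ := exists_split h
  · obtain ⟨x', y', h⟩ := h; exact ⟨c, x', y', h⟩
  · simp at hl
  · simp at hl

/-- Every right factor of `x` has absolute value at most that of `u`. -/
def Adm (u x : List Bool) : Prop := ∀ t, t <:+ x → |val t| ≤ val u

/-- The lexical words. -/
def WLex (u : List Bool) : Prop := Adm u u

lemma Adm.bar {u x : List Bool} (h : Adm u x) : Adm u (bar x) := by
  intro t ht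
  obtain ⟨s, hs⟩ := ht
  have : KneadingWord.bar s ++ KneadingWord.bar t = x := by rw [← bar_append, hs, bar_bar]
  have := h _ ⟨_, this⟩
  rwa [val_bar, abs_neg] at this

lemma Adm.pos {u x : List Bool} (h : Adm u x) : Adm u (pos x) := by
  rcases pos_eq_or x with e | e <;> rw [e]
  exacts [h, h.bar]

lemma Adm.suffix {u x t : List Bool} (h : Adm u x) (ht : t <:+ x) : Adm u t :=
  fun s hs => h s (hs.trans ht)

lemma Adm.right {u v x : List Bool} (h : Adm u (v ++ x)) : Adm u x := h.suffix ⟨v, rfl⟩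

lemma Adm.le {u x : List Bool} (h : Adm u x) : val x ≤ val u :=
  (le_abs_self _).trans (h x List.suffix_rfl)

lemma WLex.nonneg {u : List Bool} (h : WLex u) : 0 ≤ val u :=
  (abs_nonneg _).trans (h u List.suffix_rfl)

lemma suffix_append_cases {t v x : List Bool} (h : t <:+ v ++ x) :
    t <:+ x ∨ ∃ w, w ≠ [] ∧ w <:+ v ∧ t = w ++ x := by
  obtain ⟨s, hs⟩ := h
  rcases List.append_eq_append_iff.1 hs with ⟨a, rfl, rfl⟩ | ⟨a, rfl, rfl⟩
  · by_cases ha : a = []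
    · subst ha; exact Or.inl (by simp)
    · exact Or.inr ⟨a, ha, ⟨s, rfl⟩, rfl⟩
  · exact Or.inl ⟨a, rfl⟩

lemma suffix_append_cons_cases {t v x : List Bool} {b : Bool} (h : t <:+ v ++ b :: x) :
    t <:+ x ∨ ∃ w, w <:+ v ∧ t = w ++ b :: x := by
  rcases suffix_append_cases h with h | ⟨w, -, hw, rfl⟩
  · rcases List.suffix_cons_iff.1 h with rfl | h
    · exact Or.inr ⟨[], List.nil_suffix, rfl⟩
    · exact Or.inl h
  · exact Or.inr ⟨w, hw, rfl⟩

lemma adm_append {u v x : List Bool} (hx : Adm u x)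
    (h : ∀ w, w ≠ [] → w <:+ v → |val (w ++ x)| ≤ val u) : Adm u (v ++ x) := by
  intro t ht
  rcases suffix_append_cases ht with h1 | ⟨w, hw0, hw, rfl⟩
  exacts [hx _ h1, h w hw0 hw]

lemma adm_append_cons {u v x : List Bool} {b : Bool} (hx : Adm u x)
    (h : ∀ w, w <:+ v → |val (w ++ b :: x)| ≤ val u) : Adm u (v ++ b :: x) := by
  intro t ht
  rcases suffix_append_cons_cases ht with h1 | ⟨w, hw, rfl⟩
  exacts [hx _ h1, h w hw]

lemma suffix_append_right {v w x : List Bool} (h : w <:+ v) : w ++ x <:+ v ++ x := by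
  obtain ⟨s, rfl⟩ := h
  exact ⟨s, by simp⟩

end KneadingWord

/-! ### The unimodal map with turning value `u`, its first returns, and the semigroup of hitting
times -/

namespace KneadingWord

/-- The unimodal map on nonnegative words whose turning value is `u`. -/
def step (u : List Bool) : List Bool → List Bool
  | [] => u
  | _ :: t => pos t

@[simp] lemma step_nil (u : List Bool) : step u [] = u := rfl
@[simp] lemma step_cons (u : List Bool) (b : Bool) (t : List Bool) : step u (b :: t) = pos t := rfl

/-- The points of the dynamical system with turning value `u`. -/
def Pt (u x : List Bool) : Prop := Adm u x ∧ 0 ≤ val x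

/-- Some point above `ζ` reaches the turning point after `k` steps. -/
def Hit (u : List Bool) (ζ : ℚ) (k : ℕ) : Prop :=
  ∃ x, Pt u x ∧ ζ < val x ∧ (step u)^[k] x = []

variable {u x : List Bool} {ζ : ℚ} {k l : ℕ}

lemma WLex.pt (hu : WLex u) : Pt u u := ⟨hu, hu.nonneg⟩

lemma Pt.le (h : Pt u x) : val x ≤ val u := h.1.le

lemma pt_step (hu : WLex u) (hx : Pt u x) : Pt u (step u x) := by
  rcases x with _ | ⟨b, t⟩
  · exact hu.pt
  · exact ⟨(hx.1.right (v := [b])).pos, val_pos_nonneg t⟩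

lemma pt_iterate (hu : WLex u) (hx : Pt u x) (k : ℕ) : Pt u ((step u)^[k] x) := by
  induction k with
  | zero => exact hx
  | succ k ih => rw [Function.iterate_succ_apply']; exact pt_step hu ih

lemma Pt.cons_true {y : List Bool} (hx : Pt u x) (hy : Adm u y)
    (h : val (true :: y) ≤ val x) : Pt u (true :: y) := by
  refine ⟨fun t ht => ?_, (val_true_pos y).le⟩
  rcases List.suffix_cons_iff.1 ht with rfl | ht
  · rw [abs_of_pos (val_true_pos y)]
    exact h.trans hx.le
  · exact hy t ht

/-- On `true :: t` the map is `|val t|`: it falls and then rises, and the empty word goes to the top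
`u`. The value `y` is taken at `true :: y` on the rising branch or at `true :: bar y` on the falling
one; the preimage is admissible because it does not exceed `x₂` (`Pt.cons_true`). -/
lemma exists_step_eq_of_le {x₁ x₂ y : List Bool} (h₁ : Pt u x₁) (h₂ : Pt u x₂) (hy : Pt u y)
    (hle : val x₁ ≤ val x₂) (h : val y ∈ Set.uIcc (val (step u x₁)) (val (step u x₂))) :
    ∃ x, Pt u x ∧ val x₁ ≤ val x ∧ val x ≤ val x₂ ∧ step u x = y := by
  have hpy : pos y = y := pos_of_nonneg hy.2
  rw [Set.mem_uIcc] at h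
  rcases val_nonneg_iff.1 h₂.2 with rfl | ⟨t₂, rfl⟩
  · have h1 : x₁ = [] := val_inj (le_antisymm hle h₁.2)
    subst h1
    simp only [step_nil, or_self] at h
    exact ⟨[], h₁, le_rfl, le_rfl, val_inj (le_antisymm h.1 h.2)⟩
  rcases val_nonneg_iff.1 h₁.2 with rfl | ⟨t₁, rfl⟩
  · simp only [step_nil, step_cons, val_pos] at h
    have hyu := hy.le
    have ht : |val t₂| ≤ val y := by
      rcases h with h | h
      · exact (h₂.1 t₂ (List.suffix_cons _ _)).trans h.1
      · exact h.1
    have hle : val (true :: bar y) ≤ val (true :: t₂) := by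
      simp only [val_true, val_bar]; linarith [(abs_le.1 ht).1]
    exact ⟨true :: bar y, h₂.cons_true hy.1.bar hle, (val_true_pos _).le, hle, by simp [hpy]⟩
  · simp only [step_cons, val_pos] at h
    have hle' : val t₁ ≤ val t₂ := by simp only [val_true] at hle; linarith
    have hy0 := hy.2
    by_cases hc : val y ≤ val t₂
    · have h1 : val t₁ ≤ val y := by
        by_contra hcon
        rw [not_le] at hcon
        rw [abs_of_pos (by linarith), abs_of_pos (by linarith)] at h
        rcases h with h | h <;> linarith
      have hle : val (true :: y) ≤ val (true :: t₂) := by simp only [val_true]; linarith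
      exact ⟨true :: y, h₂.cons_true hy.1 hle, by simp only [val_true]; linarith, hle, by simp [hpy]⟩
    · rw [not_le] at hc
      have h1 : -val y ≤ val t₂ := by
        by_contra hcon
        rw [not_le] at hcon
        rw [abs_of_neg (by linarith), abs_of_neg (by linarith)] at h
        rcases h with h | h <;> linarith
      have h2 : val t₁ ≤ -val y := by
        by_contra hcon
        rw [not_le] at hcon
        rcases eq_or_lt_of_le h1 with e | e
        · linarith
        have a1 : |val t₁| < val y := abs_lt.2 ⟨hcon, by linarith⟩
        have a2 : |val t₂| < val y := abs_lt.2 ⟨e, hc⟩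
        rcases h with h | h <;> linarith
      have hle : val (true :: bar y) ≤ val (true :: t₂) := by
        simp only [val_true, val_bar]; linarith
      exact ⟨true :: bar y, h₂.cons_true hy.1.bar hle, by simp only [val_true, val_bar]; linarith,
        hle, by simp [hpy]⟩

lemma exists_step_eq {x₁ x₂ y : List Bool} (h₁ : Pt u x₁) (h₂ : Pt u x₂) (hy : Pt u y)
    (h : val y ∈ Set.uIcc (val (step u x₁)) (val (step u x₂))) :
    ∃ x, Pt u x ∧ val x ∈ Set.uIcc (val x₁) (val x₂) ∧ step u x = y := by
  rcases le_total (val x₁) (val x₂) with hle | hle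
  · obtain ⟨x, hx, a, b, c⟩ := exists_step_eq_of_le h₁ h₂ hy hle h
    exact ⟨x, hx, Set.mem_uIcc.2 (Or.inl ⟨a, b⟩), c⟩
  · obtain ⟨x, hx, a, b, c⟩ := exists_step_eq_of_le h₂ h₁ hy hle (Set.uIcc_comm (val _) _ ▸ h)
    exact ⟨x, hx, Set.mem_uIcc.2 (Or.inr ⟨a, b⟩), c⟩

/-- The intermediate value property of the iterates of `step u`. -/
lemma exists_iterate_eq (hu : WLex u) (k : ℕ) {x₁ x₂ y : List Bool} (h₁ : Pt u x₁) (h₂ : Pt u x₂)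
    (hy : Pt u y) (h : val y ∈ Set.uIcc (val ((step u)^[k] x₁)) (val ((step u)^[k] x₂))) :
    ∃ x, Pt u x ∧ val x ∈ Set.uIcc (val x₁) (val x₂) ∧ (step u)^[k] x = y := by
  induction k generalizing x₁ x₂ with
  | zero => exact ⟨y, hy, h, rfl⟩
  | succ k ih =>
    simp only [Function.iterate_succ_apply] at h
    obtain ⟨z, hz, hz', rfl⟩ := ih (pt_step hu h₁) (pt_step hu h₂) h
    obtain ⟨x, hx, hx', rfl⟩ := exists_step_eq h₁ h₂ hz hz'
    exact ⟨x, hx, hx', rfl⟩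

lemma iterate_eq_drop (hx : 0 ≤ val x) (hk : k ≤ x.length) :
    (step u)^[k] x = pos (x.drop k) := by
  induction k with
  | zero => simp [pos_of_nonneg hx]
  | succ k ih =>
    rw [Function.iterate_succ_apply', ih (by omega), List.drop_eq_getElem_cons (by omega)]
    rcases pos_eq_or (x[k] :: x.drop (k + 1)) with h | h <;> rw [h] <;>
      simp only [step_cons, bar_cons, pos_bar]

lemma iterate_append {a t : List Bool} (h : 0 ≤ val (a ++ t)) :
    (step u)^[a.length] (a ++ t) = pos t := by
  rw [iterate_eq_drop h (by simp)]; simp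

lemma iterate_length (hx : 0 ≤ val x) : (step u)^[x.length] x = [] := by
  rw [iterate_eq_drop hx le_rfl, List.drop_length]; exact pos_of_nonneg le_rfl

lemma iterate_add_mul (hu : WLex u) (h : (step u)^[k] x = []) (j : ℕ) :
    (step u)^[k + j * (u.length + 1)] x = [] := by
  induction j with
  | zero => simpa using h
  | succ j ih =>
    rw [show k + (j + 1) * (u.length + 1) = u.length + (1 + (k + j * (u.length + 1))) by ring,
      Function.iterate_add_apply, Function.iterate_add_apply, ih]
    exact iterate_length hu.nonneg

/-- An orbit first meets the empty word after `x.length` steps; from there it goes to `u` and comes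
back every `u.length + 1` steps. -/
lemma exists_of_iterate_eq_nil (hu : WLex u) (hx : 0 ≤ val x) (h : (step u)^[k] x = []) :
    ∃ j, x.length + j * (u.length + 1) = k := by
  induction k using Nat.strong_induction_on generalizing x with
  | _ k ih =>
    rcases lt_trichotomy k x.length with hk | hk | hk
    · rw [iterate_eq_drop hx hk.le] at h
      have := congrArg List.length h
      simp at this; omega
    · exact ⟨0, by omega⟩
    · obtain ⟨i, rfl⟩ := Nat.exists_eq_add_of_lt hk
      rw [show x.length + i + 1 = i + (1 + x.length) by ring, Function.iterate_add_apply,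
        Function.iterate_add_apply, iterate_length hx] at h
      obtain ⟨j, hj⟩ := ih i (by omega) hu.nonneg h
      exact ⟨j + 1, by rw [← hj]; ring⟩

lemma length_le_of_iterate_eq_nil (hu : WLex u) (hx : 0 ≤ val x) (h : (step u)^[k] x = []) :
    x.length ≤ k := by
  obtain ⟨j, hj⟩ := exists_of_iterate_eq_nil hu hx h
  omega

lemma Pt.hit (hx : Pt u x) (h : ζ < val x) : Hit u ζ x.length := ⟨x, hx, h, iterate_length hx.2⟩

lemma Hit.add_mul (hu : WLex u) (h : Hit u ζ k) (j : ℕ) : Hit u ζ (k + j * (u.length + 1)) := by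
  obtain ⟨x, hx, h1, h2⟩ := h
  exact ⟨x, hx, h1, iterate_add_mul hu h2 j⟩

lemma hit_of_dvd (hu : WLex u) (h : ζ < val u) (hk : u.length + 1 ∣ k + 1) : Hit u ζ k := by
  obtain ⟨j, hj⟩ := hk
  rcases j with _ | j
  · simp at hj
  · have := (hu.pt.hit h).add_mul hu j
    rwa [show u.length + j * (u.length + 1) = k by
      have : (u.length + 1) * (j + 1) = u.length + j * (u.length + 1) + 1 := by ring
      omega] at this

/-- The first return of the points above `ζ` to the turning point. -/
structure Return (u : List Bool) (ζ : ℚ) (k : ℕ) (w : List Bool) : Prop where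
  lex : WLex u
  nonneg : 0 ≤ ζ
  lt_top : ζ < val u
  pt : Pt u w
  lt : ζ < val w
  zero : (step u)^[k] w = []
  min : ∀ i < k, ¬ Hit u ζ i

lemma exists_return (hu : WLex u) (h0 : 0 ≤ ζ) (h : ζ < val u) : ∃ k w, Return u ζ k w := by
  classical
  have he : ∃ k, Hit u ζ k := ⟨_, hu.pt.hit h⟩
  obtain ⟨w, hw, h1, h2⟩ := Nat.find_spec he
  exact ⟨_, w, hu, h0, h, hw, h1, h2, fun i hi => Nat.find_min he hi⟩

/-- The points above `ζ` do not return to points above `ζ`. -/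
def Wide (u : List Bool) (ζ : ℚ) (k : ℕ) : Prop :=
  ∃ x, Pt u x ∧ ζ < val x ∧ val ((step u)^[k + 1] x) ≤ ζ

namespace Return

variable {k₀ a : ℕ} {w y : List Bool}

lemma le_of_hit (r : Return u ζ k₀ w) (h : Hit u ζ k) : k₀ ≤ k :=
  not_lt.1 fun hk => r.min k hk h

lemma length (r : Return u ζ k₀ w) : w.length = k₀ :=
  le_antisymm (length_le_of_iterate_eq_nil r.lex r.pt.2 r.zero) (r.le_of_hit (r.pt.hit r.lt))

lemma le_length (r : Return u ζ k₀ w) : k₀ ≤ u.length := r.le_of_hit (r.lex.pt.hit r.lt_top)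

lemma iterate_top (r : Return u ζ k₀ w) : (step u)^[k₀ + 1] w = u := by
  rw [Function.iterate_succ_apply', r.zero, step_nil]

/-- A wide return sends some point above `ζ` to a value at most `ζ`, and sends `w` to the top `u`;
the intermediate value property fills the range between. -/
lemma cover_one (r : Return u ζ k₀ w) (hA : Wide u ζ k₀) (hy : Pt u y) (h : ζ < val y) :
    ∃ x, Pt u x ∧ ζ < val x ∧ (step u)^[k₀ + 1] x = y := by
  obtain ⟨x₀, h1, h2, h3⟩ := hA
  obtain ⟨x, hx, hx', e⟩ := exists_iterate_eq r.lex (k₀ + 1) h1 r.pt hy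
    (Set.mem_uIcc.2 (Or.inl ⟨h3.trans h.le, by rw [r.iterate_top]; exact hy.le⟩))
  refine ⟨x, hx, ?_, e⟩
  rcases Set.mem_uIcc.1 hx' with h | h
  exacts [h2.trans_le h.1, r.lt.trans_le h.1]

lemma cover (r : Return u ζ k₀ w) (hA : Wide u ζ k₀) (j : ℕ) (hy : Pt u y) (h : ζ < val y) :
    ∃ x, Pt u x ∧ ζ < val x ∧ (step u)^[j * (k₀ + 1)] x = y := by
  induction j with
  | zero => exact ⟨y, hy, h, by simp⟩
  | succ j ih =>
    obtain ⟨z, hz, h1, h2⟩ := ih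
    obtain ⟨x, hx, h3, h4⟩ := r.cover_one hA hz h1
    exact ⟨x, hx, h3, by rw [add_mul, one_mul, Function.iterate_add_apply, h4, h2]⟩

/-- Pull `w` back through whole periods. The remaining `a % (k₀ + 1)` steps from `w` cannot end
above `ζ`, since that point would hit before time `k₀`. -/
lemma exists_low (r : Return u ζ k₀ w) (hA : Wide u ζ k₀) (ha : ¬ k₀ + 1 ∣ a) :
    ∃ x, Pt u x ∧ ζ < val x ∧ val ((step u)^[a] x) ≤ ζ := by
  obtain ⟨x, hx, h1, h2⟩ := r.cover hA (a / (k₀ + 1)) r.pt r.lt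
  refine ⟨x, hx, h1, ?_⟩
  have hi : 0 < a % (k₀ + 1) := Nat.pos_of_ne_zero fun h => ha (Nat.dvd_of_mod_eq_zero h)
  have hi' : a % (k₀ + 1) < k₀ + 1 := Nat.mod_lt _ (Nat.succ_pos _)
  have hdm := Nat.mod_add_div a (k₀ + 1)
  have e : (step u)^[a] x = (step u)^[a % (k₀ + 1)] w := by
    rw [← h2, ← Function.iterate_add_apply]
    congr 1
    rw [mul_comm (a / _)]; simp only [hdm]
  by_contra hcon
  rw [not_le, e] at hcon
  refine r.min (k₀ - a % (k₀ + 1)) (by omega) ⟨_, pt_iterate r.lex r.pt _, hcon, ?_⟩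
  rw [← Function.iterate_add_apply, Nat.sub_add_cancel (by omega), r.zero]

lemma narrow_iterate (r : Return u ζ k₀ w) (hB : ¬ Wide u ζ k₀) (j : ℕ) (hx : Pt u x)
    (h : ζ < val x) : ζ < val ((step u)^[j * (k₀ + 1)] x) := by
  induction j with
  | zero => simpa using h
  | succ j ih =>
    by_contra hcon
    rw [show (j + 1) * (k₀ + 1) = (k₀ + 1) + j * (k₀ + 1) by ring, Function.iterate_add_apply,
      not_lt] at hcon
    exact hB ⟨_, pt_iterate r.lex hx _, ih, hcon⟩

/-- In the narrow case whole periods keep a point above `ζ`; after removing them, a nonzero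
remainder would give a hit before time `k₀`. -/
lemma dvd_of_hit (r : Return u ζ k₀ w) (hB : ¬ Wide u ζ k₀) (h : Hit u ζ k) : k₀ + 1 ∣ k + 1 := by
  obtain ⟨x, hx, h1, h2⟩ := h
  by_contra hd
  have hi : 0 < (k + 1) % (k₀ + 1) := Nat.pos_of_ne_zero fun h => hd (Nat.dvd_of_mod_eq_zero h)
  have hi' : (k + 1) % (k₀ + 1) < k₀ + 1 := Nat.mod_lt _ (Nat.succ_pos _)
  have hdm := Nat.mod_add_div (k + 1) (k₀ + 1)
  refine r.min ((k + 1) % (k₀ + 1) - 1) (by omega) ⟨_, pt_iterate r.lex hx _,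
    r.narrow_iterate hB ((k + 1) / (k₀ + 1)) hx h1, ?_⟩
  rw [← Function.iterate_add_apply, mul_comm ((k + 1) / _), ← h2]
  congr 1
  have : (k + 1) % (k₀ + 1) - 1 + (k₀ + 1) * ((k + 1) / (k₀ + 1)) = k := by omega
  rw [this]

end Return

lemma Pt.prefix {c x' y' : List Bool} (h₁ : Pt u (c ++ false :: x')) (h₂ : Adm u (c ++ true :: y')) :
    Pt u c := by
  refine ⟨fun t ht => abs_le.2 ⟨?_, ?_⟩, h₁.2.trans (val_append_false_lt _ _).le⟩
  · exact (abs_le.1 (h₁.1 _ (suffix_append_right ht))).1.trans (val_append_false_lt _ _).le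
  · exact (val_lt_append_true _ _).le.trans (abs_le.1 (h₂ _ (suffix_append_right ht))).2

namespace Return

variable {k₀ N : ℕ} {w y : List Bool}

/-- Beyond the first return word `w` the words continue `w` with negative remainder. -/
lemma exists_of_lt (r : Return u ζ k₀ w) (hB : ¬ Wide u ζ k₀) (hx : Pt u x) (h : val w < val x) :
    ∃ t, x = w ++ true :: t ∧ val t < 0 := by
  have hlen := r.length
  obtain ⟨c, ⟨x', y', hw, rfl⟩ | ⟨y', rfl, rfl⟩ | ⟨x', hw, rfl⟩⟩ := exists_split h
  · exfalso
    have hc : Pt u c := Pt.prefix (hw ▸ r.pt) hx.1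
    have hlt : ζ < val c := r.lt.trans (by rw [hw]; exact val_append_false_lt _ _)
    refine r.min c.length ?_ (hc.hit hlt)
    rw [← hlen, hw]; simp
  · refine ⟨y', rfl, ?_⟩
    by_contra hcon
    rw [not_lt] at hcon
    -- With a nonnegative remainder `w 1` would be a point, and it reaches the empty word, of value
    -- `0 ≤ ζ`, after `k₀ + 1` steps; the return would be wide.
    have hp : Pt u (w ++ [true]) := by
      refine ⟨adm_append_cons (fun t ht => ?_) fun v hv => abs_le.2 ⟨?_, ?_⟩, ?_⟩
      · rw [List.suffix_nil.1 ht]; simpa using r.lex.nonneg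
      · exact (abs_le.1 (r.pt.1 v hv)).1.trans (val_lt_append_true _ _).le
      · refine le_trans ?_ (abs_le.1 (hx.1 _ (suffix_append_right hv))).2
        rw [val_append_le]; simp only [val_true, val_nil]; linarith
      · exact r.pt.2.trans (val_lt_append_true _ _).le
    apply hB
    refine ⟨_, hp, r.lt.trans (val_lt_append_true _ _), ?_⟩
    rw [← hlen, show w.length + 1 = (w ++ [true]).length by simp, iterate_length hp.2]
    exact r.nonneg
  · exfalso
    refine r.min x.length ?_ (hx.hit (r.lt.trans h))
    rw [← hlen, hw]; simp

lemma lt_top_of_lt (r : Return u ζ k₀ w) (hp : k₀ < u.length) : val w < val u := by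
  refine lt_of_le_of_ne r.pt.le fun h => ?_
  have := r.length
  rw [val_inj h] at this
  omega

lemma iterate_eq_bar {t : List Bool} (r : Return u ζ k₀ w) (ht : val t < 0) :
    (step u)^[k₀ + 1] (w ++ true :: t) = bar t := by
  have h := r.pt.2.trans (val_lt_append_true w t).le
  rw [← r.length, show w ++ true :: t = (w ++ [true]) ++ t by simp,
    show w.length + 1 = (w ++ [true]).length by simp, iterate_append (by simpa using h)]
  simp [pos, ht]

/-- Above `w` the iterate is `w 1 t ↦ bar t`, which is decreasing, so its least value there is at
`u`. If that value exceeded `w`, the orbit of `u` would stay above `w` at all multiples of `k₀ + 1`.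
But the last such point before time `|u|` reaches the empty word within `k₀` steps, hence has length
at most `k₀`, whereas words above `w` are longer. -/
lemma iterate_le (r : Return u ζ k₀ w) (hB : ¬ Wide u ζ k₀) (hp : k₀ < u.length) :
    val ((step u)^[k₀ + 1] u) ≤ val w := by
  by_contra hcon
  rw [not_le] at hcon
  obtain ⟨s, hs, hs0⟩ := r.exists_of_lt hB r.lex.pt (r.lt_top_of_lt hp)
  have h1 : (step u)^[k₀ + 1] u = bar s := by
    conv_lhs => arg 3; rw [hs]
    exact r.iterate_eq_bar hs0
  have h2 : ∀ x, Pt u x → val w < val x → val w < val ((step u)^[k₀ + 1] x) := by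
    intro x hx hwx
    obtain ⟨t, rfl, ht0⟩ := r.exists_of_lt hB hx hwx
    rw [r.iterate_eq_bar ht0]
    refine hcon.trans_le ?_
    rw [h1, val_bar, val_bar, neg_le_neg_iff]
    have := hx.le
    rw [hs, val_append_le] at this
    simp only [val_true] at this; linarith
  have h3 : ∀ j, val w < val ((step u)^[j * (k₀ + 1)] u) := by
    intro j
    induction j with
    | zero => simpa using r.lt_top_of_lt hp
    | succ j ih =>
      rw [show (j + 1) * (k₀ + 1) = (k₀ + 1) + j * (k₀ + 1) by ring, Function.iterate_add_apply]
      exact h2 _ (pt_iterate r.lex r.lex.pt _) ih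
  obtain ⟨c, hc⟩ := r.dvd_of_hit hB (r.lex.pt.hit r.lt_top)
  rcases c with _ | c
  · simp at hc
  have hP := pt_iterate r.lex r.lex.pt (c * (k₀ + 1))
  obtain ⟨t, ht, -⟩ := r.exists_of_lt hB hP (h3 c)
  have hlen := length_le_of_iterate_eq_nil (k := k₀) r.lex hP.2 (by
    rw [← Function.iterate_add_apply, show k₀ + c * (k₀ + 1) = u.length by
      have : (k₀ + 1) * (c + 1) = k₀ + c * (k₀ + 1) + 1 := by ring
      omega]
    exact iterate_length r.lex.nonneg)
  rw [ht] at hlen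
  have := r.length
  simp at hlen; omega

/-- The iterate takes `w` to `u` and `u` to a value at most `w`, so the points from `w` to `u` cover
themselves and `w` can be pulled back any number of times. The last clause serves to find a point
other than `u` in `Isolated.wide`. -/
lemma exists_zero (r : Return u ζ k₀ w) (hB : ¬ Wide u ζ k₀) (hp : k₀ < u.length) (j : ℕ) :
    ∃ x, Pt u x ∧ val w ≤ val x ∧ (step u)^[j * (k₀ + 1)] x = w ∧
      (val ((step u)^[k₀ + 1] u) < val w → val x < val u) := by
  have hlt := r.lt_top_of_lt hp
  induction j with
  | zero => exact ⟨w, r.pt, le_rfl, by simp, fun _ => hlt⟩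
  | succ j ih =>
    obtain ⟨y, hy, h1, h2, h3⟩ := ih
    obtain ⟨x, hx, hx', e⟩ := exists_iterate_eq r.lex (k₀ + 1) r.pt r.lex.pt hy
      (Set.mem_uIcc.2 (Or.inr ⟨(r.iterate_le hB hp).trans h1, by rw [r.iterate_top]; exact hy.le⟩))
    refine ⟨x, hx, ?_, ?_, fun h => ?_⟩
    · rcases Set.mem_uIcc.1 hx' with h | h
      exacts [h.1, hlt.le.trans h.1]
    · rw [add_mul, one_mul, Function.iterate_add_apply, e, h2]
    · refine lt_of_le_of_ne hx.le fun hxu => ?_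
      rw [val_inj hxu] at e
      rw [← e] at h1
      linarith

lemma hit_of_dvd (r : Return u ζ k₀ w) (hB : ¬ Wide u ζ k₀) (hp : k₀ < u.length)
    (h : k₀ + 1 ∣ k + 1) : Hit u ζ k := by
  obtain ⟨c, hc⟩ := h
  rcases c with _ | c
  · simp at hc
  obtain ⟨x, hx, h1, h2, -⟩ := r.exists_zero hB hp c
  refine ⟨x, hx, r.lt.trans_le h1, ?_⟩
  rw [show k = k₀ + c * (k₀ + 1) by
      have : (k₀ + 1) * (c + 1) = k₀ + c * (k₀ + 1) + 1 := by ring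
      omega, Function.iterate_add_apply, h2, r.zero]

/-- After `k + 1` steps one point above `ζ` has dropped to at most `ζ` and another one is at `u`; in
between, some point lands on a given point hitting at time `l`. -/
lemma hit_add_of_not_dvd (r : Return u ζ k₀ w) (hA : Wide u ζ k₀) (h : ¬ k₀ + 1 ∣ k + 1)
    (hk : Hit u ζ k) (hl : Hit u ζ l) : Hit u ζ (k + l + 1) := by
  obtain ⟨t, ht, ht1, ht2⟩ := r.exists_low hA h
  obtain ⟨y, hy, hy1, hy2⟩ := hk
  obtain ⟨z, hz, hz1, hz2⟩ := hl
  obtain ⟨x, hx, hx', e⟩ := exists_iterate_eq r.lex (k + 1) ht hy hz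
    (Set.mem_uIcc.2 (Or.inl ⟨ht2.trans hz1.le, by
      rw [Function.iterate_succ_apply', hy2, step_nil]; exact hz.le⟩))
  refine ⟨x, hx, ?_, ?_⟩
  · rcases Set.mem_uIcc.1 hx' with h | h
    exacts [ht1.trans_le h.1, hy1.trans_le h.1]
  · rw [show k + l + 1 = l + (k + 1) by ring, Function.iterate_add_apply, e, hz2]

end Return

/-- The times at which points above `ζ` pass the turning point form an additive semigroup. -/
lemma Hit.add (hu : WLex u) (h0 : 0 ≤ ζ) (hζ : ζ < val u) (hk : Hit u ζ k) (hl : Hit u ζ l) :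
    Hit u ζ (k + l + 1) := by
  -- In the divisible case the orbit of `u` itself hits. Excluding it guarantees `k₀ < u.length` in
  -- the narrow case below.
  by_cases hm : u.length + 1 ∣ (k + l + 1) + 1
  · exact KneadingWord.hit_of_dvd hu hζ hm
  obtain ⟨k₀, w, r⟩ := exists_return hu h0 hζ
  by_cases hA : Wide u ζ k₀
  · by_cases h1 : k₀ + 1 ∣ k + 1
    · by_cases h2 : k₀ + 1 ∣ l + 1
      · have hd : k₀ + 1 ∣ (k + l + 1) + 1 := by
          rw [show k + l + 1 + 1 = (k + 1) + (l + 1) by ring]; exact dvd_add h1 h2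
        obtain ⟨c, hc⟩ := hd
        rcases c with _ | c
        · simp at hc
        obtain ⟨x, hx, h3, h4⟩ := r.cover hA c r.pt r.lt
        refine ⟨x, hx, h3, ?_⟩
        rw [show k + l + 1 = k₀ + c * (k₀ + 1) by
          have : (k₀ + 1) * (c + 1) = k₀ + c * (k₀ + 1) + 1 := by ring
          omega, Function.iterate_add_apply, h4, r.zero]
      · rw [add_comm k l]
        exact r.hit_add_of_not_dvd hA h2 hl hk
    · exact r.hit_add_of_not_dvd hA h1 hk hl
  · have hd : k₀ + 1 ∣ (k + l + 1) + 1 := by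
      rw [show k + l + 1 + 1 = (k + 1) + (l + 1) by ring]
      exact dvd_add (r.dvd_of_hit hA hk) (r.dvd_of_hit hA hl)
    refine r.hit_of_dvd hA (lt_of_le_of_ne r.le_length fun h => hm ?_) hd
    rwa [h] at hd

end KneadingWord

/-! ### Hits obtained by cutting words at their large factors -/

namespace KneadingWord

variable {u x z : List Bool} {ζ : ℚ} {k l : ℕ}

lemma length_le_of_between {a t r s : List Bool} (h₁ : val (a ++ r) ≤ val t)
    (h₂ : val t ≤ val (a ++ s)) : a.length ≤ t.length := by
  obtain ⟨q, rfl⟩ := exists_append_of_between h₁ h₂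
  simp

/-- A word strictly shorter than `u` cannot lie between `u` and a continuation of `u`. -/
lemma abs_lt_of_length_lt {t : List Bool} (hlt : t.length < u.length) (h : |val t| ≤ val u)
    (r : List Bool) : |val t| < val (u ++ r) := by
  by_contra hcon
  rw [not_lt, ← val_pos] at hcon
  rw [← val_pos] at h
  have := length_le_of_between (s := []) hcon (by simpa using h)
  simp at this; omega

lemma abs_val_append_le {v r : List Bool} (hu : 0 ≤ val u) (hv : v ≠ []) {b : List Bool}
    (hb : b = u ∨ b = bar u) (h : |val (v ++ b ++ r)| ≤ val u) : |val (v ++ b)| ≤ val u := by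
  have hvl := List.length_pos_of_ne_nil hv
  have hbl : b.length = u.length := by rcases hb with rfl | rfl <;> simp
  have h' := abs_le.1 h
  refine abs_le.2 ⟨?_, ?_⟩
  · by_contra hcon
    rw [not_le] at hcon
    have := length_le_of_between (a := v ++ b) (t := bar u) (r := []) (s := r)
      (by simpa using hcon.le) (by simpa using h'.1)
    simp at this; omega
  · by_contra hcon
    rw [not_le] at hcon
    have := length_le_of_between (a := v ++ b) (t := u) (r := r) (s := []) h'.2
      (by simpa using hcon.le)
    simp at this; omega

lemma pos_eq_append_of_lt {t : List Bool} {r : List Bool} (h : val u < |val t|)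
    (h' : |val t| ≤ val (u ++ true :: r)) : ∃ f, pos t = u ++ true :: f := by
  rw [← val_pos] at h h'
  obtain ⟨q, hq⟩ := exists_append_of_between (a := u) (r := []) (by simpa using h.le) h'
  have h1 : 0 < val q := by
    rw [hq] at h
    exact lt_val_append.1 h
  obtain ⟨f, rfl⟩ := val_pos_iff_head.1 h1
  exact ⟨f, hq⟩

/-- A word all of whose large right factors `u 1 f` have a large `bar f` yields a hit. -/
lemma hit_of_large_factors (hu : WLex u) (hz : Pt u z) (hzu : val z < val u) (y : List Bool)
    (hl : y.length ≤ z.length) (hy : val z < val y)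
    (H : ∀ t, t <:+ y → |val t| ≤ val u ∨ ∃ f, pos t = u ++ true :: f ∧ val z < -val f) :
    Hit u (val z) y.length := by
  induction hn : y.length using Nat.strong_induction_on generalizing y with
  | _ n ih =>
    subst hn
    -- Otherwise write `y = e t` with `t = ± (u 1 f)` the longest bad factor. The words `e (± u)`
    -- and `bar f` both yield hits, the second by induction, and the two times combine under
    -- `Hit.add` to `|y|`.
    by_cases hall : Adm u y
    · exact Pt.hit ⟨hall, hz.2.trans hy.le⟩ hy
    -- the longest bad factor
    obtain ⟨e, t, het, htbad, he⟩ : ∃ e t, y = e ++ t ∧ ¬ |val t| ≤ val u ∧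
        ∀ v, v ≠ [] → v <:+ e → |val (v ++ t)| ≤ val u := by
      clear ih hl hy H
      induction y with
      | nil =>
        exfalso; apply hall
        intro t ht; rw [List.suffix_nil.1 ht]; simpa using hu.nonneg
      | cons b y ihy =>
        by_cases hb : |val (b :: y)| ≤ val u
        · have hny : ¬ Adm u y := by
            intro h; apply hall
            intro t ht
            rcases List.suffix_cons_iff.1 ht with rfl | ht
            exacts [hb, h t ht]
          obtain ⟨e, t, rfl, h1, h2⟩ := ihy hny
          refine ⟨b :: e, t, rfl, h1, fun v hv hve => ?_⟩
          rcases List.suffix_cons_iff.1 hve with rfl | hve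
          exacts [hb, h2 v hv hve]
        · exact ⟨[], b :: y, rfl, hb, fun v hv hve => absurd (List.suffix_nil.1 hve) hv⟩
    obtain ⟨f, hf, hfz⟩ := (H t ⟨e, het.symm⟩).resolve_left htbad
    have htl : t.length = u.length + 1 + f.length := by
      have := congrArg List.length hf
      simp at this; omega
    -- the factor `bar f`
    have hit₂ : Hit u (val z) f.length := by
      have := ih (bar f).length (by simp [het, htl]; omega) (bar f) (by
          have := congrArg List.length het
          simp at this; simp; omega) (by simpa using hfz) ?_ rfl
      · simpa using this
      · intro s hs
        have h1 : bar s <:+ f := by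
          obtain ⟨q, hq⟩ := hs
          exact ⟨bar q, by rw [← bar_append, hq, bar_bar]⟩
        have h2 : bar s <:+ pos t := by
          rw [hf, show u ++ true :: f = (u ++ [true]) ++ f by simp]
          exact h1.trans (List.suffix_append _ _)
        have h3 : ∃ s', s' <:+ y ∧ (s' = s ∨ s' = bar s) := by
          rcases pos_eq_or t with e1 | e1
          · rw [e1] at h2
            exact ⟨_, h2.trans ⟨e, het.symm⟩, Or.inr rfl⟩
          · rw [e1] at h2
            obtain ⟨q, hq⟩ := h2
            refine ⟨s, List.IsSuffix.trans ⟨bar q, ?_⟩ ⟨e, het.symm⟩, Or.inl rfl⟩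
            have := congrArg bar hq
            simpa using this
        obtain ⟨s', hs', h4⟩ := h3
        have := H s' hs'
        rcases h4 with rfl | rfl
        · exact this
        · simpa using this
    -- the truncation
    obtain ⟨b, r, hb, hbr, hlt⟩ : ∃ b r, (b = u ∨ b = bar u) ∧ t = b ++ r ∧
        (val (e ++ b) < val y → b = u ∧ ∃ r', r = true :: r') := by
      rcases eq_pos_or_bar t with h | h
      · exact ⟨u, true :: f, Or.inl rfl, by rw [h, hf], fun _ => ⟨rfl, f, rfl⟩⟩
      · refine ⟨bar u, false :: bar f, Or.inr rfl, by rw [h, hf]; simp, fun hcon => ?_⟩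
        exfalso
        rw [het, h, hf] at hcon
        simp only [bar_append, bar_cons, Bool.not_true] at hcon
        rw [val_append_lt] at hcon
        exact lt_asymm hcon (val_append_false_lt _ _)
    have hbl : b.length = u.length := by rcases hb with rfl | rfl <;> simp
    have hadm : Adm u (e ++ b) := by
      apply adm_append
      · rcases hb with rfl | rfl
        exacts [hu, hu.bar]
      · intro w hw hwe
        refine abs_val_append_le (r := r) hu.nonneg hw hb ?_
        rw [List.append_assoc, ← hbr]; exact he w hw hwe
    -- Otherwise `b = u`, and `z`, squeezed between `e u` and `y`, has the left factor `e u`. It is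
    -- longer than `e u`, and the next letter 1 would give it a right factor `u 1 …` greater than
    -- `u`.
    have hgt : val z < val (e ++ b) := by
      by_contra hcon
      rw [not_lt] at hcon
      obtain ⟨rfl, r', rfl⟩ := hlt (hcon.trans_lt hy)
      obtain ⟨q, hq⟩ := exists_append_of_between (a := e ++ b) (r := []) (y := z) (s := true :: r')
        (by simpa using hcon) (by rw [List.append_assoc, ← hbr, ← het]; exact hy.le)
      have hq0 : 0 ≤ val q := by
        rw [hq] at hcon
        exact le_val_append.1 hcon
      rcases val_nonneg_iff.1 hq0 with rfl | ⟨q, rfl⟩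
      · have := congrArg List.length hq
        have h2 := congrArg List.length het
        simp at this h2; omega
      · have := (le_abs_self _).trans (hz.1 (b ++ true :: q) ⟨e, by rw [hq]; simp⟩)
        exact absurd this (not_le.2 (val_lt_append_true _ _))
    have hit₁ : Hit u (val z) (e ++ b).length := Pt.hit ⟨hadm, hz.2.trans hgt.le⟩ hgt
    have := hit₁.add hu hz.2 hzu hit₂
    convert this using 1
    have h2 := congrArg List.length het
    simp at h2 ⊢; omega

end KneadingWord

/-! ### Strict words and the greatest strict word of a given length -/

namespace KneadingWord

variable {u x z f : List Bool} {n : ℕ}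

/-- Every right factor of `x` has absolute value less than that of `u`. -/
def Strict (u x : List Bool) : Prop := ∀ t, t <:+ x → |val t| < val u

lemma Strict.adm (h : Strict u x) : Adm u x := fun t ht => (h t ht).le

lemma Strict.bar (h : Strict u x) : Strict u (bar x) := by
  intro t ht
  obtain ⟨s, hs⟩ := ht
  have : KneadingWord.bar s ++ KneadingWord.bar t = x := by rw [← bar_append, hs, bar_bar]
  have := h _ ⟨_, this⟩
  rwa [val_bar, abs_neg] at this

lemma Strict.pos (h : Strict u x) : Strict u (pos x) := by
  rcases pos_eq_or x with e | e <;> rw [e]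
  exacts [h, h.bar]

lemma Strict.suffix {t : List Bool} (h : Strict u x) (ht : t <:+ x) : Strict u t :=
  fun s hs => h s (hs.trans ht)

lemma Strict.lt (h : Strict u x) : val x < val u := (le_abs_self _).trans_lt (h x List.suffix_rfl)

lemma strict_of_wLex (h : WLex (u ++ false :: z)) : Strict u z := fun t ht =>
  (h t (ht.trans ((List.suffix_cons _ _).trans (List.suffix_append _ _)))).trans_lt
    (val_append_false_lt _ _)

/-- A nonempty finite set of words of a given length has a greatest element. -/
lemma exists_max_val (p : List Bool → Prop) (h : ∃ x, x.length = n ∧ p x) :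
    ∃ x, x.length = n ∧ p x ∧ ∀ y, y.length = n → p y → val y ≤ val x := by
  have hfin : {x : List Bool | x.length = n ∧ p x}.Finite :=
    (List.finite_length_eq Bool n).subset fun x hx => hx.1
  obtain ⟨x, hx, hmax⟩ := Set.exists_max_image _ val hfin h
  exact ⟨x, hx.1, hx.2, fun y h1 h2 => hmax y ⟨h1, h2⟩⟩

lemma nonneg_of_max (hz : Strict u z) (hmax : ∀ y, y.length = z.length → Strict u y → val y ≤ val z) :
    0 ≤ val z := by
  have := hmax (bar z) (by simp) hz.bar
  rw [val_bar] at this; linarith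

/-- If `u 0 x ≤ x < u`, then `x = u 0 r` with `x ≤ r`; but `r` is shorter, and induction gives `r <
u 0 r = x`. -/
lemma Strict.lt_append (hx : Strict u x) : val x < val (u ++ false :: x) := by
  induction hn : x.length using Nat.strong_induction_on generalizing x with
  | _ n ih =>
    by_contra hcon
    rw [not_lt] at hcon
    obtain ⟨r, rfl⟩ := exists_append_of_between (s := []) hcon (by simpa using hx.lt.le)
    have hr : val r < 0 := val_append_lt_self.1 hx.lt
    rcases r with _ | ⟨_ | _, r⟩
    · simp at hr
    · rw [val_append_le] at hcon
      simp only [val_false] at hcon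
      have hr' : r <:+ u ++ false :: r := (List.suffix_cons _ _).trans (List.suffix_append _ _)
      have := ih r.length (by simp at hn; omega) (hx.suffix hr') rfl
      linarith
    · exact absurd hr (not_lt.2 (val_true_pos r).le)

/-- The lower bounds come from the lexical word `u 0 z`, which `u 0 x` dominates factor by factor;
the upper bounds hold since `w 0 x < w`. -/
lemma Strict.prepend (hu : WLex u) (hP : WLex (u ++ false :: z)) (hx : Strict u x)
    (h : val z ≤ val x) : Strict u (u ++ false :: x) := by
  have hlt := val_append_false_lt u z
  intro t ht
  rcases suffix_append_cons_cases ht with ht | ⟨w, hw, rfl⟩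
  · exact hx t ht
  have h1 := (abs_le.1 (hP _ (suffix_append_right hw))).1
  have h2 : val (w ++ false :: z) ≤ val (w ++ false :: x) := by
    rw [val_append_le]; simp only [val_false]; linarith
  exact abs_lt.2 ⟨by linarith, (val_append_false_lt _ _).trans_le (abs_le.1 (hu w hw)).2⟩

/-- Cut off a final factor `± u`. -/
lemma Pt.shorten {c g : List Bool} {b : Bool} (hu : WLex u) (hz : Pt u z)
    (hx : Pt u (c ++ b :: g)) (hlt : val z < val (c ++ b :: g)) (hl : (c ++ b :: g).length ≤ z.length)
    (hg : g = u ∨ g = bar u) : Pt u c ∧ val z < val c := by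
  have hκ := val_lt_half u
  have hbg := abs_le.1 (hx.1 (b :: g) (List.suffix_append _ _))
  -- The letter before `± u` is forced: `1 u` and `0 ū` exceed `u` in absolute value, because `val u
  -- < 1/2`.
  have hcases : (b = false ∧ g = u) ∨ (b = true ∧ g = bar u) := by
    cases b <;> rcases hg with rfl | rfl <;> simp at hbg ⊢ <;> exfalso <;> linarith
  rcases hcases with ⟨rfl, rfl⟩ | ⟨rfl, rfl⟩
  · have hc := hlt.trans (val_append_false_lt c g)
    refine ⟨⟨fun v hv => abs_le.2 ⟨?_, ?_⟩, hz.2.trans hc.le⟩, hc⟩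
    · exact (abs_le.1 (hx.1 _ (suffix_append_right hv))).1.trans (val_append_false_lt _ _).le
    · by_contra hcon
      rw [not_le] at hcon
      obtain ⟨r, hr⟩ := exists_append_of_between (a := v) (s := [])
        (abs_le.1 (hx.1 _ (suffix_append_right hv))).2 (by simpa using hcon.le)
      have hr0 : val r < 0 := by rw [hr] at hcon; exact val_append_lt_self.1 hcon
      rcases r with _ | ⟨_ | _, s⟩
      · simp at hr0
      · have h1 := (abs_le.1 (hx.1 _ (suffix_append_right hv))).2
        have h2 : val g ≤ val s := by
          conv_rhs at h1 => rw [hr]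
          rw [val_append_le] at h1
          simp only [val_false] at h1; linarith
        have hs : s <:+ g := by rw [hr]; exact (List.suffix_cons _ _).trans (List.suffix_append _ _)
        have h3 := val_inj (le_antisymm h2 (abs_le.1 (hu s hs)).2)
        have := congrArg List.length hr
        rw [← h3] at this; simp at this; omega
      · exact absurd hr0 (not_lt.2 (val_true_pos s).le)
  · have hc : val z < val c := by
      by_contra hcon
      rw [not_lt] at hcon
      obtain ⟨r, rfl⟩ := exists_append_of_between (a := c) (r := []) (by simpa using hcon) hlt.le
      have hr : 0 ≤ val r := le_val_append.1 hcon
      rcases val_nonneg_iff.1 hr with rfl | ⟨s, rfl⟩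
      · simp at hl
      · rw [val_append_lt] at hlt
        simp only [val_true, val_bar] at hlt
        have := (abs_le.1 (hz.1 s ((List.suffix_cons _ _).trans (List.suffix_append _ _)))).1
        linarith
    refine ⟨⟨fun v hv => abs_le.2 ⟨?_, ?_⟩, hz.2.trans hc.le⟩, hc⟩
    · by_contra hcon
      rw [not_le] at hcon
      obtain ⟨r, hr⟩ := exists_append_of_between (a := v) (r := []) (y := bar u)
        (by simpa using hcon.le)
        (by simpa using (abs_le.1 (hx.1 _ (suffix_append_right hv))).1)
      have hr0 : 0 < val r := by
        rw [← val_bar, hr] at hcon; exact lt_val_append.1 hcon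
      obtain ⟨s, rfl⟩ := val_pos_iff_head.1 hr0
      have h1 := (abs_le.1 (hx.1 _ (suffix_append_right hv))).1
      have h2 : val s ≤ val (bar u) := by
        rw [← val_bar u] at h1
        conv_lhs at h1 => rw [hr]
        rw [val_append_le] at h1
        simp only [val_true] at h1; linarith
      have hs : s <:+ bar u := by
        rw [hr]; exact (List.suffix_cons _ _).trans (List.suffix_append _ _)
      have h3 := val_inj (le_antisymm h2 (by rw [val_bar]; exact (abs_le.1 (hu.bar s hs)).1))
      have := congrArg List.length hr
      rw [← h3] at this; simp at this; omega
    · exact (val_lt_append_true _ _).le.trans (abs_le.1 (hx.1 _ (suffix_append_right hv))).2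

/-- Above the greatest strict word `z` of length `n` there is no passage of the turning point at
time `n`. -/
lemma not_hit_of_max {z₀ : List Bool} (hu : WLex u) (hP : WLex (u ++ false :: z₀)) (hz : Strict u z)
    (hmax : ∀ y, y.length = z.length → Strict u y → val y ≤ val z) (hle : val z₀ ≤ val z)
    (hm : ¬ u.length + 1 ∣ z.length + 1) : ¬ Hit u (val z) z.length := by
  rintro ⟨x, hx, hlt, hzero⟩
  have hz0 := nonneg_of_max hz hmax
  obtain ⟨j, hj⟩ := exists_of_iterate_eq_nil hu hx.2 hzero
  -- Cutting off `± u` with the preceding letter keeps a point above `z` and reaches a strict word,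
  -- unless the divisibility denied by `hm` occurs. Prepending `u 0` repeatedly then restores the
  -- length `|z|`, against maximality.
  obtain ⟨y, i, hy, hylt, hi⟩ : ∃ y i, Strict u y ∧ val z < val y ∧
      y.length + i * (u.length + 1) = z.length := by
    clear hzero
    induction hn : x.length using Nat.strong_induction_on generalizing x j with
    | _ n ih =>
      by_cases hs : Strict u x
      · exact ⟨x, j, hs, hlt, hj⟩
      obtain ⟨t, ht, htu⟩ : ∃ t, t <:+ x ∧ ¬ |val t| < val u := by
        unfold Strict at hs; push Not at hs ⊢; exact hs
      have htu' : |val t| = val u := le_antisymm (hx.1 t ht) (not_lt.1 htu)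
      have hg : t = u ∨ t = bar u := by
        rw [← val_pos] at htu'
        rw [← val_inj htu']; exact eq_pos_or_bar t
      have hgl : t.length = u.length := by rcases hg with rfl | rfl <;> simp
      obtain ⟨c, rfl⟩ := ht
      rcases List.eq_nil_or_concat c with rfl | ⟨c, b, rfl⟩
      · exfalso; apply hm
        simp only [List.nil_append] at hj
        exact ⟨j + 1, by rw [← hj, hgl]; ring⟩
      · simp only [List.append_assoc, List.singleton_append, List.concat_eq_append] at *
        obtain ⟨h1, h2⟩ := Pt.shorten hu ⟨hz.adm, hz0⟩ hx hlt (by omega) hg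
        refine ih c.length (by rw [← hn]; simp) c h1 h2 (j + 1) ?_ rfl
        rw [← hj, List.length_append, List.length_cons, hgl]; ring
  clear hzero hj hlt hx
  induction i generalizing y with
  | zero =>
    exact absurd hylt (not_lt.2 (hmax y (by simpa using hi) hy))
  | succ i ih =>
    refine ih (u ++ false :: y) (hy.prepend hu hP (hle.trans hylt.le)) (hylt.trans hy.lt_append) ?_
    rw [← hi, List.length_append, List.length_cons]; ring

/-- Immediately above `d 1 g` there is a point whose value after `d 1` is small. -/
lemma exists_small_above (hu : WLex u) (f g : List Bool) (hg : u.length ≤ g.length) (d : List Bool)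
    (h : Adm u (d ++ true :: g)) : ∃ x, Adm u x ∧ val (d ++ true :: g) < val x ∧
      d.length + 1 ≤ x.length ∧ |val (x.drop (d.length + 1))| < val (u ++ false :: f) := by
  induction hn : d.length using Nat.strong_induction_on generalizing d with
  | _ n ih =>
    subst hn
    have hlt : val (d ++ true :: g) < val u := lt_of_le_of_ne h.le fun e => by
      have := congrArg List.length (val_inj e)
      simp at this; omega
    have base : ∀ s, u = d ++ true :: s → ∃ x, Adm u x ∧ val (d ++ true :: g) < val x ∧
        d.length + 1 ≤ x.length ∧ |val (x.drop (d.length + 1))| < val (u ++ false :: f) := by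
      intro s hs
      have hs' : u = (d ++ [true]) ++ s := by simp [hs]
      refine ⟨u, hu, hlt, by rw [hs]; simp, ?_⟩
      have e : u.drop (d.length + 1) = s := by
        rw [hs', show d.length + 1 = (d ++ [true]).length by simp, List.drop_left]
      rw [e]
      exact abs_lt_of_length_lt (by rw [hs']; simp; omega) (hu s ⟨_, hs'.symm⟩) _
    -- If the first difference from `u` lies beyond `d 1`, the witness is `u` itself (`base`). If it
    -- lies inside `d = b 0 a`, recurse on `a 1 g` and prepend `b 0`.
    obtain ⟨b, hb⟩ := exists_split hlt
    have key : ∀ ψ, d ++ true :: g = b ++ false :: ψ → (∀ w, w <:+ b → val w ≤ val u) →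
        (∀ s, b = d ++ true :: s → ∃ s', u = d ++ true :: s') → ∃ x, Adm u x ∧
          val (d ++ true :: g) < val x ∧ d.length + 1 ≤ x.length ∧
            |val (x.drop (d.length + 1))| < val (u ++ false :: f) := by
      intro ψ hψ hw hbu
      rcases List.append_eq_append_iff.1 hψ with ⟨a, rfl, ha⟩ | ⟨a, rfl, ha⟩
      · rcases a with _ | ⟨a0, a⟩
        · simp at ha
        · simp only [List.cons_append, List.cons.injEq] at ha
          obtain ⟨rfl, -⟩ := ha
          obtain ⟨s', hs'⟩ := hbu a rfl
          exact base s' hs'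
      · rcases a with _ | ⟨a0, a⟩
        · simp at ha
        · simp only [List.cons_append, List.cons.injEq] at ha
          obtain ⟨rfl, rfl⟩ := ha
          have hadm : Adm u (a ++ true :: g) := by
            refine h.suffix ?_
            simp only [List.append_assoc, List.cons_append]
            exact (List.suffix_cons _ _).trans (List.suffix_append _ _)
          obtain ⟨x, hx, h1, h2, h3⟩ := ih a.length (by simp; omega) a hadm rfl
          refine ⟨b ++ false :: x, adm_append_cons hx fun w hwb => abs_le.2 ⟨?_, ?_⟩, ?_, ?_, ?_⟩
          · have h4 := (abs_le.1 (h (w ++ false :: (a ++ true :: g)) (by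
              simp only [List.append_assoc, List.cons_append]
              exact suffix_append_right hwb))).1
            refine h4.trans ?_
            rw [val_append_le]; simp only [val_false]; linarith
          · exact (val_append_false_lt _ _).le.trans (hw w hwb)
          · simp only [List.append_assoc, List.cons_append]
            rw [val_append_lt]; simp only [val_false]; linarith
          · simp; omega
          · have e : (b ++ false :: x).drop ((b ++ false :: a).length + 1) = x.drop (a.length + 1) := by
              rw [show (b ++ false :: a).length + 1 = (b ++ [false]).length + (a.length + 1) by
                simp; omega, ← List.drop_drop, show b ++ false :: x = (b ++ [false]) ++ x by simp,
                List.drop_left]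
            rw [e]; exact h3
    rcases hb with ⟨ψ, u', hψ, hu'⟩ | ⟨u', h1, h2⟩ | ⟨ψ, hψ, hu'⟩
    · refine key ψ hψ (fun w hw => ?_) fun s hs => ⟨s ++ true :: u', by rw [hu', hs]; simp⟩
      refine (val_lt_append_true w u').le.trans (abs_le.1 (hu _ ?_)).2
      rw [hu']; exact suffix_append_right hw
    · exfalso
      have := congrArg List.length h2
      have h3 := congrArg List.length h1
      simp at this h3; omega
    · exact key ψ hψ (fun w hw => (abs_le.1 (hu w (by rw [hu']; exact hw))).2)
        fun s hs => ⟨s, by rw [hu', hs]⟩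

end KneadingWord

/-! ### Consecutive lexical words whose common left factor `u` satisfies `|u| + 1 ∤ n + 1`, with `n`
their length -/

namespace KneadingWord

variable {u x z f : List Bool} {n : ℕ}

/-- The negative case of `le_of_pos_eq`. -/
lemma hit_of_twin {c : List Bool} (hu : WLex u) (hz : Strict u z) (hz0 : 0 ≤ val z)
    (hm : ¬ u.length + 1 ∣ z.length + 1)
    (hf : Strict u f) (hcon : val z < val f) (hzc : z = c ++ true :: bar (u ++ false :: f)) :
    Hit u (val z) z.length := by
  -- Let N = |c| + 1. The N-th iterate takes `z` to `h = u 0 f`, and both `h` and `f` reach the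
  -- empty word at time `|h|`. Without a hit at time `|z| = N + |h|`, the N-th images of all points
  -- above `z` are trapped strictly between `f` and `h`. A wide return contradicts this by reaching
  -- `u` or falling to at most `z`; a narrow one forces `k₀ + 1` to divide `|z| + 1`, and then there
  -- is a hit after all.
  by_contra H
  set h := u ++ false :: f with hh
  have hzu : val z < val u := hz.lt
  have hPz : Pt u z := ⟨hz.adm, hz0⟩
  have hfP : Pt u f := ⟨hf.adm, hz0.trans hcon.le⟩
  have hfh : val f < val h := hf.lt_append
  have hhu : val h < val u := val_append_false_lt _ _
  have hhP : Pt u h := by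
    refine ⟨?_, hfP.2.trans hfh.le⟩
    have : Adm u (bar h) := hz.adm.suffix (by
      rw [hzc]; exact (List.suffix_cons _ _).trans (List.suffix_append _ _))
    simpa using this.bar
  have hzlen : z.length = h.length + (c.length + 1) := by rw [hzc]; simp; omega
  have hhlen : h.length = u.length + 1 + f.length := by rw [hh]; simp; omega
  have hza : (step u)^[c.length + 1] z = h := by
    have e : z = (c ++ [true]) ++ bar h := by rw [hzc]; simp
    have := iterate_append (u := u) (a := c ++ [true]) (t := bar h) (by rw [← e]; exact hz0)
    rw [← e] at this
    simpa [pos_of_nonneg hhP.2] using this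
  -- a value below `h`
  obtain ⟨x₀, hx₀, hx₀z, hx₀h⟩ : ∃ x, Pt u x ∧ val z < val x ∧
      val ((step u)^[c.length + 1] x) < val h := by
    obtain ⟨x, h1, h2, h3, h4⟩ := exists_small_above hu f (bar h) (by simp [hhlen]; omega) c
      (by rw [← hzc]; exact hz.adm)
    rw [← hzc] at h2
    have hx0 : 0 ≤ val x := hz0.trans h2.le
    exact ⟨x, ⟨h1, hx0⟩, h2, by rw [iterate_eq_drop hx0 h3, val_pos]; exact h4⟩
  have hhz : (step u)^[h.length] h = [] := iterate_length hhP.2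
  have hfz : (step u)^[h.length] f = [] := by
    rw [hhlen, show u.length + 1 + f.length = f.length + 1 * (u.length + 1) by ring]
    exact iterate_add_mul hu (iterate_length hfP.2) 1
  have hup : ∀ x, Pt u x → val z < val x → val ((step u)^[c.length + 1] x) < val h := by
    intro x hx hxz
    by_contra hc
    rw [not_lt] at hc
    obtain ⟨y, hy, hy', e⟩ := exists_iterate_eq hu (c.length + 1) hx₀ hx hhP
      (Set.mem_uIcc.2 (Or.inl ⟨hx₀h.le, hc⟩))
    refine H ⟨y, hy, ?_, by rw [hzlen, Function.iterate_add_apply, e, hhz]⟩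
    rcases Set.mem_uIcc.1 hy' with h | h
    exacts [hx₀z.trans_le h.1, hxz.trans_le h.1]
  have hdown : ∀ x, Pt u x → val z < val x → val f < val ((step u)^[c.length + 1] x) := by
    intro x hx hxz
    by_contra hc
    rw [not_lt] at hc
    obtain ⟨y, hy, hy', e⟩ := exists_iterate_eq hu (c.length + 1) hx hPz hfP
      (Set.mem_uIcc.2 (Or.inl ⟨hc, by rw [hza]; exact hfh.le⟩))
    refine H ⟨y, hy, ?_, by rw [hzlen, Function.iterate_add_apply, e, hfz]⟩
    have hge : val z ≤ val y := by
      rcases Set.mem_uIcc.1 hy' with h | h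
      exacts [hxz.le.trans h.1, h.1]
    refine lt_of_le_of_ne hge fun e' => ?_
    rw [← val_inj e', hza] at e
    rw [e] at hfh
    exact lt_irrefl _ hfh
  obtain ⟨k₀, w, r⟩ := exists_return hu hz0 hzu
  by_cases hA : Wide u (val z) k₀
  · by_cases hd : k₀ + 1 ∣ c.length + 1
    · obtain ⟨j, hj⟩ := hd
      obtain ⟨x, hx, h1, h2⟩ := r.cover hA j hu.pt hzu
      have := hup x hx h1
      rw [hj, mul_comm, h2] at this
      exact lt_asymm this hhu
    · obtain ⟨x, hx, h1, h2⟩ := r.exists_low hA hd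
      have := hdown x hx h1
      linarith
  · obtain ⟨m', hm'⟩ := r.dvd_of_hit hA (hu.pt.hit hzu)
    have hm'0 : m' ≠ 0 := by rintro rfl; simp at hm'
    obtain ⟨m', rfl⟩ : ∃ q, m' = q + 1 := Nat.exists_eq_succ_of_ne_zero hm'0
    -- Otherwise follow `u` through `(j + 1) * m'` returns and then `c.length + 1` steps: the point
    -- reached lies above `f`, hence above `z`. The number of returns is chosen so that `k₀ - i`
    -- further steps make the total `|u| + j (|u| + 1)`, when the orbit of `u` is at the empty word;
    -- this is a hit before time `k₀`.
    have hd : k₀ + 1 ∣ c.length + 1 := by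
      by_contra hd
      set j := (c.length + 1) / (k₀ + 1) with hj
      have hi : 0 < (c.length + 1) % (k₀ + 1) :=
        Nat.pos_of_ne_zero fun h => hd (Nat.dvd_of_mod_eq_zero h)
      have hi' : (c.length + 1) % (k₀ + 1) < k₀ + 1 := Nat.mod_lt _ (Nat.succ_pos _)
      have hdm := Nat.mod_add_div (c.length + 1) (k₀ + 1)
      rw [← hj] at hdm
      set i := (c.length + 1) % (k₀ + 1) with hidef
      have h1 := r.narrow_iterate hA ((j + 1) * m') hu.pt hzu
      have h2 := pt_iterate hu hu.pt ((j + 1) * m' * (k₀ + 1))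
      have h3 := hdown _ h2 h1
      refine r.min (k₀ - i) (by omega) ⟨_, pt_iterate hu h2 (c.length + 1), hcon.trans h3, ?_⟩
      rw [← Function.iterate_add_apply, ← Function.iterate_add_apply]
      have e : k₀ - i + (c.length + 1 + (j + 1) * m' * (k₀ + 1)) =
          u.length + j * (u.length + 1) := by
        have e1 : (j + 1) * (u.length + 1) = (k₀ + 1) * (j + 1) + (j + 1) * m' * (k₀ + 1) := by
          rw [hm']; ring
        have e2 : (j + 1) * (u.length + 1) = j * (u.length + 1) + u.length + 1 := by ring
        have e3 : (k₀ + 1) * (j + 1) = (k₀ + 1) * j + k₀ + 1 := by ring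
        omega
      rw [show k₀ - i + (c.length + 1) + (j + 1) * m' * (k₀ + 1) =
        u.length + j * (u.length + 1) by omega]
      exact iterate_add_mul hu (iterate_length hu.nonneg) j
    have hdz : k₀ + 1 ∣ z.length + 1 := by
      rw [hzlen, hhlen, show u.length + 1 + f.length + (c.length + 1) + 1 =
        (u.length + 1) + (f.length + 1) + (c.length + 1) by ring]
      exact dvd_add (dvd_add (r.dvd_of_hit hA (hu.pt.hit hzu)) (r.dvd_of_hit hA (hfP.hit hcon))) hd
    refine H (r.hit_of_dvd hA (lt_of_le_of_ne r.le_length fun e => hm ?_) hdz)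
    rwa [e] at hdz

/-- The factors `u 0 f` of the greatest strict word `z` have `f ≤ z`. -/
lemma le_of_pos_eq {t : List Bool} (hu : WLex u) (hz : Strict u z) (hz0 : 0 ≤ val z)
    (hm : ¬ u.length + 1 ∣ z.length + 1) (H : ¬ Hit u (val z) z.length) (ht : t <:+ z)
    (hf : pos t = u ++ false :: f) : val f ≤ val z := by
  by_contra hcon
  rw [not_le] at hcon
  have hfS : Strict u f := by
    have := (hz.suffix ht).pos
    rw [hf] at this
    exact this.suffix ((List.suffix_cons _ _).trans (List.suffix_append _ _))
  have hfP : Pt u f := ⟨hfS.adm, hz0.trans hcon.le⟩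
  have hlen : 0 < u.length := by
    rcases u with _ | ⟨b, u⟩
    · simp at hm
    · simp
  obtain ⟨c, hc⟩ := ht
  -- If `z = c u 0 f`, the hits of `c u` and `f` add up to `|z|`. In the complemented case the
  -- letter before the factor must be 1, as `0 ū 1 f̄` exceeds `u` in absolute value; that is the
  -- twin case.
  rcases eq_pos_or_bar t with h | h
  · have hzc : z = c ++ u ++ false :: f := by rw [← hc, h, hf]; simp
    have hadm : Adm u (c ++ u) := by
      refine adm_append hu fun w hw hwc => abs_val_append_le (r := false :: f) hu.nonneg hw
        (Or.inl rfl) (hz.adm _ ?_)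
      rw [hzc]
      exact suffix_append_right (suffix_append_right hwc)
    have hlt : val z < val (c ++ u) := by rw [hzc]; exact val_append_false_lt _ _
    have h1 : Hit u (val z) (c ++ u).length := Pt.hit ⟨hadm, hz0.trans hlt.le⟩ hlt
    have h2 := h1.add hu hz0 hz.lt (hfP.hit hcon)
    refine H ?_
    convert h2 using 1
    rw [hzc]; simp; omega
  · have hzc : z = c ++ bar (u ++ false :: f) := by rw [← hc, h, hf]
    rcases List.eq_nil_or_concat c with rfl | ⟨c, b, rfl⟩
    · rw [hzc] at hz0
      have := hfS.lt_append
      rw [List.nil_append, val_bar] at hz0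
      linarith [hfP.2]
    · rw [List.concat_eq_append, List.append_assoc, List.singleton_append] at hzc
      cases b
      · have h1 := (abs_le.1 (hz.adm (false :: bar (u ++ false :: f)) (by
          rw [hzc]; exact List.suffix_append _ _))).1
        have hupos : 0 < val u := lt_of_le_of_ne hu.nonneg fun e => by
          have := val_inj (x := []) (y := u) (by simpa using e)
          rw [← this] at hlen; simp at hlen
        obtain ⟨u', hu'⟩ := val_pos_iff_head.1 hupos
        have hs : u' <:+ u := by rw [hu']; exact List.suffix_cons _ _
        have h3 := abs_lt_of_length_lt (by rw [hu']; simp) (hu u' hs) (false :: f)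
        have h4 : val u = (1 + val u') / 3 := by conv_lhs => rw [hu', val_true]
        rw [val_false, val_bar] at h1
        have := le_abs_self (val u')
        linarith
      · exact H (hit_of_twin hu hz hz0 hm hfS hcon hzc)

/-- Neighbouring lexical words of length `n` whose common left factor `u` satisfies
`|u| + 1 ∤ n + 1` differ by complementing everything after `u`. -/
theorem eq_bar_of_gap (hu : WLex u) (hz : WLex (u ++ false :: z)) (hx : WLex (u ++ true :: x))
    (hl : x.length = z.length) (hm : ¬ u.length + 1 ∣ z.length + 1)
    (gap : ∀ y, y.length = u.length + 1 + z.length → WLex y → val (u ++ false :: z) < val y →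
      ¬ val y < val (u ++ true :: x)) :
    x = bar z ∧ 0 ≤ val z ∧ Strict u z ∧ ¬ Hit u (val z) z.length := by
  obtain ⟨y, hyl, hy, hmax⟩ := exists_max_val (Strict u) ⟨z, rfl, strict_of_wLex hz⟩
  rw [← hyl] at hmax hm
  have hzy := hmax z hyl.symm (strict_of_wLex hz)
  have hy0 := nonneg_of_max hy hmax
  have H := not_hit_of_max hu hz hy hmax hzy hm
  -- A factor of `y` beyond `u 0 y` would be `± u 0 q` with `q > y`, excluded by `le_of_pos_eq`. So
  -- the greatest strict word `y` gives a lexical word, and the gap forces `y = z`.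
  have hyW : WLex (u ++ false :: y) := by
    intro t ht
    rcases suffix_append_cons_cases ht with ht | ⟨v, hv, rfl⟩
    · by_contra hcon
      rw [not_le] at hcon
      have h1 := hy.adm t ht
      rw [← val_pos] at hcon h1
      obtain ⟨q, hq⟩ := exists_append_of_between (s := []) hcon.le (by simpa using h1)
      rw [hq, val_append_lt] at hcon
      have hqn : val q ≤ 0 := by rw [hq] at h1; exact val_append_le_self.1 h1
      rcases q with _ | ⟨_ | _, q⟩
      · have e := hy t ht
        rw [← val_pos, hq] at e
        simp at e
      · have := le_of_pos_eq hu hy hy0 hm H ht hq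
        simp only [val_false] at hcon; linarith
      · exact absurd hqn (not_le.2 (val_true_pos q))
    · have h1 := (abs_le.1 (hz _ (suffix_append_right hv))).1
      have h2 : ∀ a, val (a ++ false :: z) ≤ val (a ++ false :: y) := fun a => by
        rw [val_append_le]; simp only [val_false]; linarith
      refine abs_le.2 ⟨by linarith [h2 u, h2 v], ?_⟩
      by_cases hvu : v = u
      · rw [hvu]
      have hvl : v.length < u.length := lt_of_le_of_ne hv.length_le fun h => hvu (hv.eq_of_length h)
      have := abs_lt_of_length_lt hvl (hu v hv) (false :: y)
      exact (val_append_false_lt _ _).le.trans ((le_abs_self _).trans this.le)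
  have hyz : y = z := by
    by_contra hne
    have hlt : val z < val y := lt_of_le_of_ne hzy fun e => hne (val_inj e).symm
    exact gap _ (by simp [hyl]; omega) hyW (by
      rw [val_append_lt]; simp only [val_false]; linarith) (val_append_false_lt_true _ _ _)
  subst hyz
  refine ⟨?_, hy0, hy, H⟩
  -- If `bar x < y`, the word `u 1 ȳ` is lexical and fills the gap. If `bar x > y`, the factors of
  -- `bar x` beyond `u` are `± u 1 f` with `f ≤ x < bar y`, so `hit_of_large_factors` contradicts
  -- `H`.
  rcases lt_trichotomy (val (bar x)) (val y) with h | h | h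
  · exfalso
    rw [val_bar] at h
    have hxy : val (bar y) < val x := by rw [val_bar]; linarith
    refine gap (u ++ true :: bar y) (by simp; omega) ?_ (val_append_false_lt_true _ _ _)
      (by rw [val_append_lt]; simp only [val_true]; linarith)
    intro t ht
    rcases suffix_append_cons_cases ht with ht | ⟨v, hv, rfl⟩
    · have := hy.adm.bar t ht
      exact this.trans (val_lt_append_true _ _).le
    · refine abs_le.2 ⟨?_, ?_⟩
      · have h1 := (abs_le.1 (hu v hv)).1
        linarith [val_lt_append_true u (bar y), val_lt_append_true v (bar y)]
      · have h1 := (le_abs_self _).trans (hx _ (suffix_append_right hv))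
        rw [val_append, val_append u] at h1 ⊢
        have hp : (1 / 3 : ℚ) ^ u.length ≤ (1 / 3) ^ v.length :=
          pow_le_pow_of_le_one (by norm_num) (by norm_num) hv.length_le
        simp only [val_true] at h1 ⊢
        nlinarith
  · rw [val_bar] at h
    exact val_inj (by rw [val_bar]; linarith)
  · exfalso
    refine H ?_
    rw [← hl, ← length_bar x]
    refine hit_of_large_factors hu ⟨hy.adm, hy0⟩ hy.lt (bar x) (by simp [hl]) h fun t ht => ?_
    by_cases hc : |val t| ≤ val u
    · exact Or.inl hc
    rw [not_le] at hc
    right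
    have h1 : |val t| ≤ val (u ++ true :: x) := by
      have : bar t <:+ x := by
        obtain ⟨s, hs⟩ := ht
        exact ⟨bar s, by rw [← bar_append, hs, bar_bar]⟩
      have := hx (bar t) (this.trans ((List.suffix_cons _ _).trans (List.suffix_append _ _)))
      rwa [val_bar, abs_neg] at this
    obtain ⟨f, hf⟩ := pos_eq_append_of_lt hc h1
    refine ⟨f, hf, ?_⟩
    rw [← val_pos, hf, val_append_le] at h1
    simp only [val_true, val_bar] at h1 h; linarith

end KneadingWord

/-! ### Turning values which are the only point hitting at their own time -/

namespace KneadingWord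

variable {u x y z : List Bool} {ζ : ℚ} {k l : ℕ}

/-- `u` is not of the form `w 1 w̄`, and it is the only point above `ζ` which reaches the turning
point after `|u|` steps. -/
structure Isolated (u : List Bool) (ζ : ℚ) : Prop where
  lex : WLex u
  nonneg : 0 ≤ ζ
  lt_top : ζ < val u
  ne : ∀ w, u ≠ w ++ true :: bar w
  eq : ∀ x, Pt u x → ζ < val x → (step u)^[u.length] x = [] → x = u

lemma eq_or_eq_of_mem_uIcc {v : List Bool} (hx : Pt u x) (hv : Pt u v)
    (h : val u ∈ Set.uIcc (val x) (val v)) : x = u ∨ v = u := by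
  rcases Set.mem_uIcc.1 h with h | h
  · exact Or.inr (val_inj (le_antisymm hv.le h.2))
  · exact Or.inl (val_inj (le_antisymm hx.le h.2))

lemma mem_of_mem_uIcc {a b c d : ℚ} (ha : d < a) (hb : d < b) (h : c ∈ Set.uIcc a b) : d < c := by
  rcases Set.mem_uIcc.1 h with h | h
  exacts [ha.trans_le h.1, hb.trans_le h.1]

/-- A narrow return would give either a second point hitting at time `|u|` (`exists_zero`) or `u = w
1 w̄`. If `k₀ + 1` divided `|u| + 1`, the intermediate value property between `x₀` and `w`, neither
of them `u`, would again give a second such point. -/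
lemma Isolated.wide (F : Isolated u ζ) {k₀ : ℕ} {w : List Bool} (r : Return u ζ k₀ w)
    (hk : k₀ < u.length) : Wide u ζ k₀ ∧ ¬ k₀ + 1 ∣ u.length + 1 := by
  have hA : Wide u ζ k₀ := by
    by_contra hB
    rcases (r.iterate_le hB hk).lt_or_eq with h | h
    · obtain ⟨j, hj⟩ := r.dvd_of_hit hB (F.lex.pt.hit F.lt_top)
      rcases j with _ | j
      · simp at hj
      obtain ⟨x, hx, h1, h2, h3⟩ := r.exists_zero hB hk j
      have : x = u := F.eq x hx (r.lt.trans_le h1) (by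
        rw [show u.length = k₀ + j * (k₀ + 1) by
          have : (k₀ + 1) * (j + 1) = k₀ + j * (k₀ + 1) + 1 := by ring
          omega, Function.iterate_add_apply, h2, r.zero])
      exact absurd (h3 h) (by rw [this]; exact lt_irrefl _)
    · obtain ⟨t, ht, ht0⟩ := r.exists_of_lt hB F.lex.pt (r.lt_top_of_lt hk)
      have e := r.iterate_eq_bar ht0
      rw [← ht, val_inj h] at e
      exact F.ne w (by rw [e, bar_bar, ← e]; exact ht)
  refine ⟨hA, fun ⟨c, hc⟩ => ?_⟩
  rcases c with _ | _ | c
  · simp at hc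
  · omega
  obtain ⟨y, hy, h1, h2⟩ := r.cover hA c r.pt r.lt
  obtain ⟨x₀, hx₀, h3, h4⟩ := hA
  obtain ⟨x, hx, hx', e⟩ := exists_iterate_eq F.lex (k₀ + 1) hx₀ r.pt hy
    (Set.mem_uIcc.2 (Or.inl ⟨h4.trans h1.le, by rw [r.iterate_top]; exact hy.le⟩))
  have hxu : x = u := F.eq x hx (mem_of_mem_uIcc h3 r.lt hx') (by
    rw [show u.length = k₀ + (c * (k₀ + 1) + (k₀ + 1)) by
      have : (k₀ + 1) * (c + 1 + 1) = k₀ + (c * (k₀ + 1) + (k₀ + 1)) + 1 := by ring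
      omega, Function.iterate_add_apply, Function.iterate_add_apply, e, h2, r.zero])
  rw [hxu] at hx' e
  rcases eq_or_eq_of_mem_uIcc hx₀ r.pt hx' with h | h
  · rw [h, e] at h4; linarith
  · have := r.length
    rw [h] at this; omega

lemma Isolated.not_hit_aux (F : Isolated u ζ) {k₀ : ℕ} {w : List Bool} (r : Return u ζ k₀ w)
    (hA : Wide u ζ k₀) (hd : ¬ k₀ + 1 ∣ k + 1) (hk : Hit u ζ k) (hl : Hit u ζ l)
    (hkl : k + l + 1 = u.length) : False := by
  obtain ⟨x₀, hx₀, h1, h2⟩ := r.exists_low hA hd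
  obtain ⟨v, hv, h3, h4⟩ := hk
  obtain ⟨y, hy, h5, h6⟩ := hl
  obtain ⟨x, hx, hx', e⟩ := exists_iterate_eq F.lex (k + 1) hx₀ hv hy
    (Set.mem_uIcc.2 (Or.inl ⟨h2.trans h5.le, by
      rw [Function.iterate_succ_apply', h4, step_nil]; exact hy.le⟩))
  have hxu : x = u := F.eq x hx (mem_of_mem_uIcc h1 h3 hx') (by
    rw [← hkl, show k + l + 1 = l + (k + 1) by ring, Function.iterate_add_apply, e, h6])
  rw [hxu] at hx' e
  rcases eq_or_eq_of_mem_uIcc hx₀ hv hx' with h | h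
  · rw [h, e] at h2; linarith
  · rw [h] at h4
    have := length_le_of_iterate_eq_nil F.lex F.lex.nonneg h4
    omega

/-- Two hits adding up to `|u|` would, by the argument of `Hit.add`, produce a point other than `u`
hitting at that time. -/
lemma Isolated.not_hit (F : Isolated u ζ) (hk : Hit u ζ k) (hl : Hit u ζ l) :
    k + l + 1 ≠ u.length := by
  intro hkl
  obtain ⟨k₀, w, r⟩ := exists_return F.lex F.nonneg F.lt_top
  obtain ⟨hA, hd⟩ := F.wide r (lt_of_le_of_lt (r.le_of_hit hk) (by omega))
  by_cases h1 : k₀ + 1 ∣ k + 1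
  · by_cases h2 : k₀ + 1 ∣ l + 1
    · exact hd (by rw [← hkl, show k + l + 1 + 1 = (k + 1) + (l + 1) by ring]; exact dvd_add h1 h2)
    · exact F.not_hit_aux r hA h2 hl hk (by omega)
  · exact F.not_hit_aux r hA h1 hk hl hkl

/-- If `y` were at most the `a`-th image of `u`, it would itself be the `a`-th image of a point
above `ζ`. That point hits at time `|u|`, so it is `u`. -/
lemma Isolated.iterate_lt (F : Isolated u ζ) (hy : Pt u y) (h : ζ < val y)
    (h0 : (step u)^[k] y = []) {a : ℕ} (ha : k + a = u.length) (ha0 : 0 < a)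
    (hne : y ≠ (step u)^[a] u) :
    val ((step u)^[a] u) < val y := by
  by_contra hcon
  rw [not_lt] at hcon
  obtain ⟨k₀, w, r⟩ := exists_return F.lex F.nonneg F.lt_top
  obtain ⟨hA, hd⟩ := F.wide r (lt_of_le_of_lt (r.le_of_hit ⟨y, hy, h, h0⟩) (by omega))
  have key : ∀ x, Pt u x → ζ < val x → (step u)^[a] x = y → False := fun x hx hx' e => by
    have := F.eq x hx hx' (by rw [← ha, Function.iterate_add_apply, e, h0])
    rw [this] at e
    exact hne e.symm
  by_cases h1 : k₀ + 1 ∣ a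
  · obtain ⟨j, hj⟩ := h1
    obtain ⟨x, hx, h2, h3⟩ := r.cover hA j hy h
    exact key x hx h2 (by rw [hj, mul_comm]; exact h3)
  · obtain ⟨x₀, hx₀, h2, h3⟩ := r.exists_low hA h1
    obtain ⟨x, hx, hx', e⟩ := exists_iterate_eq F.lex a hx₀ F.lex.pt hy
      (Set.mem_uIcc.2 (Or.inl ⟨h3.trans h.le, hcon⟩))
    exact key x hx (mem_of_mem_uIcc h2 F.lt_top hx') e

end KneadingWord

/-! ### The greatest strict word `h` below `g`, and the words `(g 0)^j h` -/

namespace KneadingWord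

variable {g h u x y z : List Bool} {k l : ℕ}

/-- `h` is the greatest word of the length of `g` whose right factors are all less than `g` in
absolute value, and it is obtained from `g` by complementing everything after a lexical word. -/
structure Mate (g h : List Bool) : Prop where
  lex : WLex g
  ne : ∀ w, g ≠ w ++ true :: bar w
  length : h.length = g.length
  strict : Strict g h
  max : ∀ y, y.length = g.length → Strict g y → val y ≤ val h
  split : ∃ σ z, WLex σ ∧ g = σ ++ true :: bar z ∧ h = σ ++ false :: z

lemma Mate.nonneg (M : Mate g h) : 0 ≤ val h :=
  nonneg_of_max M.strict fun y hy => M.max y (hy.trans M.length)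

/-- A point above `h` hitting at time `|g|` has length `|g|`. By maximality it is not strict, and a
factor attaining `val g` has full length, so the point is `g`. -/
lemma Mate.isolated (M : Mate g h) : Isolated g (val h) := by
  refine ⟨M.lex, M.nonneg, M.strict.lt, M.ne, fun x hx hlt h0 => ?_⟩
  obtain ⟨j, hj⟩ := exists_of_iterate_eq_nil M.lex hx.2 h0
  have hl : x.length = g.length := by
    rcases j with _ | j
    · simpa using hj
    · exfalso
      have : (j + 1) * (g.length + 1) = j * (g.length + 1) + g.length + 1 := by ring
      omega
  by_contra hne
  refine absurd (M.max x hl fun t ht => lt_of_le_of_ne (hx.1 t ht) fun e => ?_) (not_le.2 hlt)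
  have ht' : pos t = g := val_inj (by rw [val_pos, e])
  have htl : t = x := ht.eq_of_length (by rw [← length_pos, ht', hl])
  rw [htl, pos_of_nonneg hx.2] at ht'
  exact hne ht'

/-- The two words end in opposite letters. -/
lemma not_suffix_of_suffix {σ v : List Bool} (hv : v ≠ []) (h₁ : v <:+ σ ++ true :: bar z) :
    ¬ v <:+ σ ++ false :: z := by
  rintro ⟨a, h₂⟩
  obtain ⟨b, h₁⟩ := h₁
  rcases List.eq_nil_or_concat v with rfl | ⟨v, c, rfl⟩
  · exact hv rfl
  rcases List.eq_nil_or_concat z with rfl | ⟨z, d, rfl⟩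
  · have h₁ := congrArg List.getLast? h₁
    have h₂ := congrArg List.getLast? h₂
    simp [List.getLast?_append] at h₁ h₂
    rw [h₁] at h₂; simp at h₂
  · have h₁ := congrArg List.getLast? h₁
    have h₂ := congrArg List.getLast? h₂
    simp [List.getLast?_append, List.getLast?_cons] at h₁ h₂
    rw [h₂] at h₁; simp at h₁

/-- Suppose the bound fails at `v` and put `b = bar v`; then `g = b 1 s` and `h < s̄ 1 h̄`. If `s̄ >
h`, then `b > h` makes `b` and `s̄` hits adding up to `|g|`, against `Isolated.not_hit`, while `b ≤
h` contradicts the shape `h = σ 0 z`. If `s̄ ≤ h`, then `h = s̄ 1 q` with `q̄ > h`, and `b` is the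
image of `g` after `|s| + 1` steps. Unless `q̄ = b`, isolation gives `b < q̄ ≤ b 1 s`, which equal
lengths forbid; and `q̄ = b` fails since `g` and `h` end in opposite letters. -/
lemma Mate.neg_le (M : Mate g h) {v : List Bool} (hv : v <:+ g) :
    -val (g ++ false :: h) ≤ val (v ++ false :: h) := by
  by_contra hcon
  rw [not_le] at hcon
  have F := M.isolated
  have h0 := M.nonneg
  have hpos : 0 < val (g ++ false :: h) := h0.trans_lt M.strict.lt_append
  have hvg : v ≠ g := by
    rintro rfl; linarith
  have hvl : v.length < g.length := lt_of_le_of_ne hv.length_le fun h => hvg (hv.eq_of_length h)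
  have hb1 : val (bar v) < val (g ++ false :: h) := by
    have := abs_lt_of_length_lt hvl (M.lex v hv) (false :: h)
    rw [val_bar]
    exact (neg_le_abs _).trans_lt this
  have hb2 : val (g ++ false :: h) < val (bar v ++ true :: bar h) := by
    have : val (bar v ++ true :: bar h) = -val (v ++ false :: h) := by rw [← val_bar]; simp
    rw [this]; linarith
  obtain ⟨t, ht⟩ := exists_append_of_between (a := bar v) (r := []) (by simpa using hb1.le) hb2.le
  obtain ⟨s, hs⟩ : ∃ s, g = bar v ++ true :: s := by
    have hlen : (bar v).length < g.length := by simpa using hvl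
    rcases List.append_eq_append_iff.1 ht with ⟨a, ha, -⟩ | ⟨a, ha, ha'⟩
    · have := congrArg List.length ha
      simp at this; simp at hlen; omega
    · rcases a with _ | ⟨_ | _, a⟩
      · rw [ha] at hlen; simp at hlen
      · rw [ht, ha'] at hb1
        exact absurd (hb1.trans (val_append_false_lt _ _)) (lt_irrefl _)
      · exact ⟨a, ha⟩
  set b := bar v with hb
  have hbv : v = bar b := by rw [hb, bar_bar]
  have hglen : g.length = b.length + s.length + 1 := by rw [hs]; simp; omega
  have hs1 : val h < val (bar s ++ true :: bar h) := by
    have e : g ++ false :: h = b ++ true :: (s ++ false :: h) := by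
      conv_lhs => rw [hs]
      simp
    rw [e, val_append_lt] at hb2
    have : val (bar s ++ true :: bar h) = -val (s ++ false :: h) := by rw [← val_bar]; simp
    rw [this]
    simp only [val_true, val_bar] at hb2
    linarith
  have hbA : Adm g b := (M.lex.suffix hv).bar
  have hb0 : 0 ≤ val b := by
    have := M.lex.nonneg
    rcases b with _ | ⟨_ | _, b⟩
    · simp
    · rw [hs] at this
      exact absurd this (not_le.2 (val_false_neg _))
    · exact (val_true_pos _).le
  have hsA : Adm g (bar s) := (M.lex.suffix (by
    rw [hs]; exact (List.suffix_cons _ _).trans (List.suffix_append _ _))).bar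
  obtain ⟨σ, z, hσ, hgσ, hhσ⟩ := M.split
  rcases lt_or_ge (val h) (val (bar s)) with hc | hc
  · have hk : Hit g (val h) s.length := by
      have := Pt.hit (u := g) (x := bar s) ⟨hsA, h0.trans hc.le⟩ hc
      simpa using this
    rcases lt_or_ge (val h) (val b) with hd | hd
    · exact F.not_hit (Pt.hit ⟨hbA, hb0⟩ hd) hk (by omega)
    · obtain ⟨s₁, rfl⟩ : ∃ s₁, σ = b ++ true :: s₁ := by
        have h1 : val b < val σ := hd.trans_lt (by rw [hhσ]; exact val_append_false_lt _ _)
        have h2 : val σ ≤ val (b ++ true :: s) := by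
          rw [← hs, hgσ]; exact (val_lt_append_true _ _).le
        obtain ⟨t, rfl⟩ := exists_append_of_between (a := b) (r := []) (by simpa using h1.le) h2
        obtain ⟨s₁, rfl⟩ := val_pos_iff_head.1 (lt_val_append.1 h1)
        exact ⟨s₁, rfl⟩
      have es : s = s₁ ++ true :: bar z := by
        rw [hgσ, List.append_assoc] at hs
        simpa using (List.append_cancel_left hs).symm
      have hlt := abs_lt_of_length_lt (u := b ++ true :: s₁) (t := s₁)
        (by simp; omega)
        (hσ s₁ ((List.suffix_cons _ _).trans (List.suffix_append _ _))) (false :: z)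
      rw [← hhσ] at hlt
      have h2 : val (bar s) < val (bar s₁) := by rw [es]; simpa using val_append_false_lt (bar s₁) z
      rw [val_bar s₁] at h2
      linarith [neg_le_abs (val s₁)]
  · obtain ⟨t, ht⟩ := exists_append_of_between (a := bar s) (r := []) (by simpa using hc) hs1.le
    have hhl := M.length
    obtain ⟨q, hq⟩ : ∃ q, h = bar s ++ true :: q := by
      rcases t with _ | ⟨_ | _, t⟩
      · have := congrArg List.length ht
        simp at this; omega
      · rw [ht] at hc
        exact absurd hc (not_le.2 (val_append_false_lt _ _))
      · exact ⟨t, ht⟩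
    have hql : q.length = b.length := by
      have := congrArg List.length hq
      simp at this; omega
    have hqs : q <:+ h := by rw [hq]; exact (List.suffix_cons _ _).trans (List.suffix_append _ _)
    have hy : val h < val (bar q) := by
      conv at hs1 => lhs; rw [hq]
      rw [val_append_lt] at hs1
      simp only [val_true, val_bar] at hs1 ⊢; linarith
    have hyP : Pt g (bar q) := ⟨(M.strict.suffix hqs).adm.bar, h0.trans hy.le⟩
    have hit : (step g)^[s.length + 1] g = b := by
      rw [iterate_eq_drop M.lex.nonneg (by omega)]
      have : g.drop (s.length + 1) = v := by
        obtain ⟨c, hcv⟩ := hv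
        have hcl : c.length = s.length + 1 := by
          have := congrArg List.length hcv
          rw [hbv] at this
          simp at this; omega
        rw [← hcv, ← hcl, List.drop_left]
      rw [this, hbv, pos_bar, pos_of_nonneg hb0]
    have hne : bar q ≠ b := fun e => by
      have e' : q = v := by rw [hbv, ← e, bar_bar]
      have hv0 : v ≠ [] := by
        rintro rfl
        rw [e'] at hy
        simp at hy; linarith
      exact not_suffix_of_suffix hv0 (hgσ ▸ hv) (hhσ ▸ e' ▸ hqs)
    have hlt := F.iterate_lt (k := b.length) (a := s.length + 1) hyP hy (by
      have := iterate_length (u := g) hyP.2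
      simpa [hql] using this) (by omega) (by omega) (by rw [hit]; exact hne)
    rw [hit] at hlt
    have hle : val (bar q) ≤ val (b ++ true :: s) := by rw [← hs]; exact hyP.le
    obtain ⟨r, hr⟩ := exists_append_of_between (a := b) (r := []) (by simpa using hlt.le) hle
    have := congrArg List.length hr
    simp [hql] at this
    rw [this] at hr
    exact hne (by simpa using hr)

lemma Mate.wLex (M : Mate g h) : WLex (g ++ false :: h) := by
  intro t ht
  rcases suffix_append_cons_cases ht with ht | ⟨v, hv, rfl⟩
  · by_contra hcon
    rw [not_le, ← val_pos] at hcon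
    have h1 := M.strict t ht
    rw [← val_pos] at h1
    obtain ⟨q, hq⟩ := exists_append_of_between (s := []) hcon.le (by simpa using h1.le)
    have h2 := congrArg List.length hq
    have h3 := ht.length_le
    have h4 := M.length
    simp at h2
    rw [show q = [] from List.length_eq_zero_iff.1 (by omega)] at hq
    rw [hq] at h1; simp at h1
  · refine abs_le.2 ⟨M.neg_le hv, ?_⟩
    by_cases hvu : v = g
    · rw [hvu]
    have hvl : v.length < g.length := lt_of_le_of_ne hv.length_le fun h => hvu (hv.eq_of_length h)
    have := abs_lt_of_length_lt hvl (M.lex v hv) (false :: h)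
    exact (val_append_false_lt _ _).le.trans ((le_abs_self _).trans this.le)

/-- The word `(g 0)^j h`. -/
def tower (g h : List Bool) : ℕ → List Bool
  | 0 => h
  | j + 1 => g ++ false :: tower g h j

lemma val_append_cons_le {v : List Bool} {b : Bool} (hxy : val x ≤ val y) :
    val (v ++ b :: x) ≤ val (v ++ b :: y) := by
  rw [val_append_le, val_cons, val_cons]; linarith

lemma Mate.tower_mono (M : Mate g h) : Monotone fun j => val (tower g h j) := by
  apply monotone_nat_of_le_succ
  intro j
  induction j with
  | zero => exact M.strict.lt_append.le
  | succ j ih => exact val_append_cons_le ih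

lemma Mate.wLex_tower (M : Mate g h) (j : ℕ) : WLex (tower g h (j + 1)) := by
  have key : ∀ i, i ≤ j + 1 → Adm (tower g h (j + 1)) (tower g h i) := by
    intro i
    have h1 : val (g ++ false :: h) ≤ val (tower g h (j + 1)) := M.tower_mono (by omega : 1 ≤ j + 1)
    induction i with
    | zero =>
      intro _ t ht
      exact (M.wLex t (ht.trans ((List.suffix_cons _ _).trans (List.suffix_append _ _)))).trans h1
    | succ i ih =>
      intro hi
      refine adm_append_cons (ih (by omega)) fun v hv => abs_le.2 ⟨?_, ?_⟩
      · have := M.neg_le hv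
        have := val_append_cons_le (v := v) (b := false) (M.tower_mono (Nat.zero_le i))
        simp only [tower] at this h1 ⊢
        linarith
      · by_cases hvu : v = g
        · rw [hvu]
          exact M.tower_mono hi
        have hvl : v.length < g.length :=
          lt_of_le_of_ne hv.length_le fun h => hvu (hv.eq_of_length h)
        have := abs_lt_of_length_lt hvl (M.lex v hv) (false :: tower g h j)
        exact (val_append_false_lt _ _).le.trans ((le_abs_self _).trans this.le)
  exact key _ le_rfl

/-- A strict word above the tower lies between it and `g`, so it begins with `g`, necessarily
followed by 0; the rest is handled by induction. -/
lemma Mate.le_tower (M : Mate g h) (j : ℕ) (hl : y.length + 1 = (j + 1) * (g.length + 1))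
    (hy : Strict g y) : val y ≤ val (tower g h j) := by
  induction j generalizing y with
  | zero => exact M.max y (by omega) hy
  | succ j ih =>
    by_contra hcon
    rw [not_le] at hcon
    obtain ⟨r, rfl⟩ := exists_append_of_between (a := g) (s := []) hcon.le (by simpa using hy.lt.le)
    rcases r with _ | ⟨_ | _, r⟩
    · simpa using hy.lt
    · have hr := hy.suffix ((List.suffix_cons false r).trans (List.suffix_append g _))
      refine absurd (ih ?_ hr) (not_le.2 ?_)
      · simp at hl
        have : (j + 1 + 1) * (g.length + 1) = (j + 1) * (g.length + 1) + g.length + 1 := by ring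
        omega
      · rw [tower, val_append_lt] at hcon
        simp only [val_false] at hcon; linarith
    · exact absurd hy.lt (not_lt.2 (val_lt_append_true _ _).le)

lemma length_tower (hl : h.length = g.length) (j : ℕ) :
    (tower g h j).length + 1 = (j + 1) * (g.length + 1) := by
  induction j with
  | zero => simp [tower, hl]
  | succ j ih =>
    rw [tower, List.length_append, List.length_cons]
    have : (j + 1 + 1) * (g.length + 1) = (j + 1) * (g.length + 1) + g.length + 1 := by ring
    omega

end KneadingWord

/-! ### Substitution, the star product on words -/

namespace KneadingWord

variable {u x y z β γ c : List Bool} {b : Bool}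

/-- The block which follows the letter `b`. -/
def block (u : List Bool) (b : Bool) : List Bool := if b then bar u else u

/-- Insert after each letter `b` of a word the block belonging to `b`. -/
def sub (u : List Bool) : List Bool → List Bool
  | [] => []
  | b :: c => b :: (block u b ++ sub u c)

@[simp] lemma block_true (u : List Bool) : block u true = bar u := rfl
@[simp] lemma block_false (u : List Bool) : block u false = u := rfl
@[simp] lemma sub_nil (u : List Bool) : sub u [] = [] := rfl
@[simp] lemma sub_cons (u : List Bool) (b : Bool) (c : List Bool) :
    sub u (b :: c) = b :: (block u b ++ sub u c) := rfl

lemma bar_block (u : List Bool) (b : Bool) : bar (block u b) = block u (!b) := by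
  cases b <;> simp

@[simp] lemma length_block (u : List Bool) (b : Bool) : (block u b).length = u.length := by
  cases b <;> simp

lemma block_eq (u : List Bool) (b : Bool) : block u b = u ∨ block u b = bar u := by
  cases b <;> simp

@[simp] lemma bar_sub (u c : List Bool) : bar (sub u c) = sub u (bar c) := by
  induction c with
  | nil => rfl
  | cons b c ih => simp [ih, bar_block]

lemma sub_append (u c d : List Bool) : sub u (c ++ d) = sub u c ++ sub u d := by
  induction c with
  | nil => rfl
  | cons b c ih => simp [ih]

@[simp] lemma sub_nil_left (c : List Bool) : sub [] c = c := by
  induction c with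
  | nil => rfl
  | cons b c ih => cases b <;> simp [ih]

lemma length_sub (u c : List Bool) : (sub u c).length = (u.length + 1) * c.length := by
  induction c with
  | nil => rfl
  | cons b c ih => simp [ih]; ring

lemma length_append_sub (u c : List Bool) :
    (u ++ sub u c).length + 1 = (u.length + 1) * (c.length + 1) := by
  rw [List.length_append, length_sub]; ring

lemma val_sub_lt_of_lt (h : val β < val γ) : val (sub u β) < val (sub u γ) := by
  obtain ⟨d, ⟨x, y, rfl, rfl⟩ | ⟨y, rfl, rfl⟩ | ⟨x, rfl, rfl⟩⟩ := exists_split h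
  · rw [sub_append, sub_append]; exact val_append_false_lt_true _ _ _
  · rw [sub_append]; exact val_lt_append_true _ _
  · rw [sub_append]; exact val_append_false_lt _ _

lemma val_sub_le : val (sub u β) ≤ val (sub u γ) ↔ val β ≤ val γ := by
  refine ⟨fun h => ?_, fun h => ?_⟩
  · by_contra hc
    exact absurd (val_sub_lt_of_lt (not_le.1 hc)) (not_lt.2 h)
  · rcases h.lt_or_eq with h | h
    · exact (val_sub_lt_of_lt h).le
    · rw [val_inj h]

lemma val_sub_lt : val (sub u β) < val (sub u γ) ↔ val β < val γ := by
  rw [← not_le, ← not_le, val_sub_le]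

lemma suffix_sub {t v : List Bool} (h : t <:+ v ++ sub u β) (hv : v = u ∨ v = bar u) :
    ∃ w c v', c <:+ β ∧ (v' = u ∨ v' = bar u) ∧ w <:+ v' ∧ t = w ++ sub u c := by
  induction β generalizing v with
  | nil => exact ⟨t, [], v, List.suffix_rfl, hv, by simpa using h, by simp⟩
  | cons b β ih =>
    rw [sub_cons] at h
    rcases suffix_append_cons_cases h with h | ⟨w, hw, rfl⟩
    · obtain ⟨w, c, v', h1, h2⟩ := ih h (block_eq u b)
      exact ⟨w, c, v', h1.trans (List.suffix_cons _ _), h2⟩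
    · exact ⟨w, b :: β, v, List.suffix_rfl, hv, hw, rfl⟩

lemma suffix_bar {t v : List Bool} : bar t <:+ bar v ↔ t <:+ v := by
  have : ∀ t v : List Bool, t <:+ v → bar t <:+ bar v := by
    rintro t v ⟨s, rfl⟩; exact ⟨bar s, by simp⟩
  exact ⟨fun h => by simpa using this _ _ h, this t v⟩

/-- Otherwise `u = w 1 ζ` and `ζ` is at most a continuation of `ū`; but the shorter factor `ζ` of
`u` has absolute value below any continuation of `u`. -/
lemma append_true_bar_lt {w : List Bool} (hu : WLex u) (hw : |val w| ≤ val u)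
    (hl : w.length < u.length) (r : List Bool) : val (w ++ true :: (bar u ++ r)) < val u := by
  by_contra hcon
  rw [not_lt] at hcon
  have hwu : val w < val u := by
    refine lt_of_le_of_ne ((le_abs_self _).trans hw) fun h => ?_
    rw [val_inj h] at hl; exact lt_irrefl _ hl
  obtain ⟨t, rfl⟩ := exists_append_of_between (a := w) (r := []) (by simpa using hwu.le) hcon
  obtain ⟨ζ, rfl⟩ := val_pos_iff_head.1 (lt_val_append.1 hwu)
  rw [val_append_le] at hcon
  have h1 := abs_lt_of_length_lt (t := ζ) (by simp; omega)
    (hu ζ ((List.suffix_cons _ _).trans (List.suffix_append _ _))) (bar r)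
  have h2 : val (bar (w ++ true :: ζ) ++ r) = -val ((w ++ true :: ζ) ++ bar r) := by
    rw [← val_bar]; simp
  simp only [val_true] at hcon
  rw [h2] at hcon
  linarith [neg_le_abs (val ζ)]

lemma append_sub_le {w : List Bool} (hu : WLex u) (hw : |val w| ≤ val u)
    (hl : w.length < u.length) (h : |val c| ≤ val γ) :
    |val (w ++ sub u c)| ≤ val (u ++ sub u γ) := by
  have key : ∀ w c, |val w| ≤ val u → w.length < u.length → |val c| ≤ val γ →
      val (w ++ sub u c) ≤ val (u ++ sub u γ) := by
    intro w c hw hl h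
    have h0 := abs_lt_of_length_lt hl hw (sub u γ)
    rcases c with _ | ⟨_ | _, c⟩
    · simpa using (le_abs_self _).trans h0.le
    · exact (val_append_false_lt _ _).le.trans ((le_abs_self _).trans h0.le)
    · refine (append_true_bar_lt hu hw hl (sub u c)).le.trans ?_
      rw [le_val_append]
      obtain ⟨t, rfl⟩ := val_pos_iff_head.1 ((val_true_pos c).trans_le ((le_abs_self _).trans h))
      exact (val_true_pos _).le
  refine abs_le.2 ⟨?_, key w c hw hl h⟩
  have := key (bar w) (bar c) (by rwa [val_bar, abs_neg]) (by simpa) (by rwa [val_bar, abs_neg])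
  rw [← bar_sub, ← bar_append, val_bar] at this
  linarith

/-- A right factor is `w` followed by `sub u c`, with `w` a right factor of `± u`. For full `w` the
order is that of the substituted words; a shorter `w` cannot catch up with `u` (`append_sub_le`). -/
lemma adm_append_sub (hu : WLex u) (hβ : Adm γ β) :
    Adm (u ++ sub u γ) (u ++ sub u β) := by
  have key : ∀ w c, w <:+ u → |val c| ≤ val γ → |val (w ++ sub u c)| ≤ val (u ++ sub u γ) := by
    intro w c hw hc
    by_cases hwu : w = u
    · subst hwu
      refine abs_le.2 ⟨?_, by rw [val_append_le, val_sub_le]; exact (le_abs_self _).trans hc⟩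
      rcases val_nonneg_iff.1 hu.nonneg with rfl | ⟨t, rfl⟩
      · simpa using (abs_le.1 hc).1
      · exact (neg_neg_of_pos (val_true_pos _)).le.trans (val_true_pos _).le
    · exact append_sub_le hu (hu w hw)
        (lt_of_le_of_ne hw.length_le fun h => hwu (hw.eq_of_length h)) hc
  intro t ht
  obtain ⟨w, c, v, hc, rfl | rfl, hw, rfl⟩ := suffix_sub ht (Or.inl rfl)
  · exact key w c hw (hβ c hc)
  · have := key (bar w) (bar c) (by rwa [← suffix_bar, bar_bar])
      (by rw [val_bar, abs_neg]; exact hβ c hc)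
    rwa [← bar_sub, ← bar_append, val_bar, abs_neg] at this

lemma wLex_append_sub (hu : WLex u) (hβ : WLex β) : WLex (u ++ sub u β) := adm_append_sub hu hβ

/-- Bounds pass from `b c` to `c`: the letter `b` determines the sign of the block before `sub u c`,
so one inequality is read off from that block, and the other follows from the bound on `b c`. -/
lemma adm_of_append_sub (h : Adm (u ++ sub u γ) (u ++ sub u β)) (h0 : 0 ≤ val β) : Adm γ β := by
  have hle : val β ≤ val γ := by
    have := (le_abs_self _).trans (h _ List.suffix_rfl)
    rwa [val_append_le, val_sub_le] at this
  rintro c ⟨p, rfl⟩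
  induction p using List.reverseRecOn generalizing c with
  | nil =>
    simp only [List.nil_append] at hle h0 ⊢
    exact abs_le.2 ⟨by linarith, hle⟩
  | append_singleton p b ih =>
    rw [List.append_assoc, List.singleton_append] at *
    have h1 := abs_le.1 (ih (c := b :: c) h h0 hle)
    have h2 := h (block u b ++ sub u c) (by
      rw [sub_append, sub_cons, ← List.append_assoc]
      exact (List.suffix_cons _ _).trans (List.suffix_append _ _))
    have h3 := val_lt_half c
    have h4 := neg_half_lt_val c
    cases b
    · rw [block_false] at h2
      have h2 := (abs_le.1 h2).2
      rw [val_append_le, val_sub_le] at h2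
      simp only [val_false] at h1
      exact abs_le.2 ⟨by linarith, h2⟩
    · rw [block_true] at h2
      have h2 := (abs_le.1 h2).1
      rw [← val_bar, bar_append, val_append_le, bar_sub, val_sub_le, val_bar] at h2
      simp only [val_true] at h1
      exact abs_le.2 ⟨h2, by linarith⟩

/-- The value of the infinite word `ū 1 ū 1 …`. -/
def loop (u : List Bool) : ℚ :=
  (-val u + (1 / 3) ^ u.length / 3) / (1 - (1 / 3) ^ u.length / 3)

lemma loop_eq (u : List Bool) : loop u = -val u + (1 + loop u) / 3 * (1 / 3) ^ u.length := by
  have hp : (1 / 3 : ℚ) ^ u.length ≤ 1 := pow_le_one₀ (by norm_num) (by norm_num)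
  have : (1 - (1 / 3 : ℚ) ^ u.length / 3) ≠ 0 := by
    intro h; linarith
  have h := div_mul_cancel₀ (-val u + (1 / 3) ^ u.length / 3) this
  rw [← loop] at h
  linarith

lemma loop_lt_half (h : 0 < val u) : loop u < 1 / 2 := by
  have hp : (1 / 3 : ℚ) ^ u.length ≤ 1 := pow_le_one₀ (by norm_num) (by norm_num)
  rw [loop, div_lt_iff₀ (by linarith)]
  linarith

lemma neg_half_lt_loop (u : List Bool) : -(1 / 2) < loop u := by
  have hp : (1 / 3 : ℚ) ^ u.length ≤ 1 := pow_le_one₀ (by norm_num) (by norm_num)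
  have hp' : (0 : ℚ) < (1 / 3) ^ u.length := by positivity
  rw [loop, lt_div_iff₀ (by linarith)]
  linarith [(abs_le.1 (abs_val_le u)).2]

lemma val_sub_le_loop (u c : List Bool) : val (sub u c) ≤ (1 + loop u) / 3 := by
  have h0 := neg_half_lt_loop u
  induction c with
  | nil => simp; linarith
  | cons b c ih =>
    cases b
    · exact (val_false_neg _).le.trans (by linarith)
    · rw [sub_cons, val_true, block_true, val_append, val_bar, length_bar, loop_eq]
      have := mul_le_mul_of_nonneg_right ih (by positivity : (0:ℚ) ≤ (1/3) ^ u.length)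
      linarith

/-- The right-hand side is the value of the infinite word u 1 ū 1 ū 1 …. -/
lemma val_append_sub_le_loop (u c : List Bool) : val (u ++ sub u c) ≤ loop u + 2 * val u := by
  rw [val_append, loop_eq]
  have := mul_le_mul_of_nonneg_right (val_sub_le_loop u c)
    (by positivity : (0:ℚ) ≤ (1/3) ^ u.length)
  linarith

/-- After a letter 1 the rest is at most ū 1 ū 1 … by `h₁`, and at least ū 0 u 0 u … by the bound on
factors. Both begin with ū, hence so does the rest, and the same bounds pass on beyond the next
letter. After a letter 0, complement. -/
lemma exists_sub_of_block (hu : 0 < val u) (k : ℕ) (hl : x.length + 1 = (k + 1) * (u.length + 1))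
    (h : ∀ t, t <:+ x → |val t| ≤ loop u + 2 * val u)
    (h₁ : b = true → val x ≤ loop u) (h₂ : b = false → -loop u ≤ val x) :
    ∃ β, x = block u b ++ sub u β := by
  induction k generalizing x b with
  | zero =>
    refine ⟨[], ?_⟩
    have key : ∀ x : List Bool, x.length = u.length → |val x| ≤ loop u + 2 * val u →
        val x ≤ loop u → x = bar u := by
      intro x hl h h₁
      have e := loop_eq u
      have h0 := loop_lt_half hu
      have hp : (0 : ℚ) < (1 / 3) ^ u.length := by positivity
      obtain ⟨r, rfl⟩ := exists_append_of_close (bar u) x (by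
        rw [val_bar, length_bar, ← lt_div_iff₀ (by norm_num), abs_lt]
        have := mul_lt_mul_of_pos_right (by linarith : (1 + loop u) / 3 < 1 / 2) hp
        constructor <;> linarith [(abs_le.1 h).1])
      simp at hl
      simp [hl]
    cases b
    · have := key (bar x) (by simp; omega) (by rw [val_bar, abs_neg]; exact h x List.suffix_rfl)
        (by rw [val_bar]; linarith [h₂ rfl])
      rw [← bar_bar x, this]; simp
    · simpa using key x (by omega) (h x List.suffix_rfl) (h₁ rfl)
  | succ k ih =>
    have key : ∀ x : List Bool, x.length + 1 = (k + 1 + 1) * (u.length + 1) →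
        (∀ t, t <:+ x → |val t| ≤ loop u + 2 * val u) → val x ≤ loop u →
        ∃ β, x = bar u ++ sub u β := by
      intro x hl h h₁
      have e := loop_eq u
      have h0 := loop_lt_half hu
      have hp : (0 : ℚ) < (1 / 3) ^ u.length := by positivity
      have hx := (abs_le.1 (h x List.suffix_rfl)).1
      have hl' : (k + 1 + 1) * (u.length + 1) = (k + 1) * (u.length + 1) + u.length + 1 := by ring
      obtain ⟨r, rfl⟩ := exists_append_of_close (bar u) x (by
        rw [val_bar, length_bar, ← lt_div_iff₀ (by norm_num), abs_lt]
        have := mul_lt_mul_of_pos_right (by linarith : (1 + loop u) / 3 < 1 / 2) hp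
        constructor <;> linarith)
      rcases r with _ | ⟨c, r⟩
      · exact ⟨[], by simp⟩
      rw [val_append, length_bar, val_bar] at hx h₁
      have h₁' : val (c :: r) ≤ (1 + loop u) / 3 := by
        by_contra hc
        have := mul_lt_mul_of_pos_right (not_le.1 hc) hp
        linarith
      have hx' : -((1 + loop u) / 3) ≤ val (c :: r) := by
        by_contra hc
        have := mul_lt_mul_of_pos_right (not_le.1 hc) hp
        linarith
      obtain ⟨β, hβ⟩ := ih (x := r) (b := c) (by simp at hl; omega)
        (fun t ht => h t (ht.trans ((List.suffix_cons _ _).trans (List.suffix_append _ _))))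
        (by rintro rfl; simp only [val_true] at h₁'; linarith)
        (by rintro rfl; simp only [val_false] at hx'; linarith)
      exact ⟨c :: β, by rw [hβ]; rfl⟩
    cases b
    · obtain ⟨β, hβ⟩ := key (bar x) (by simpa using hl) (fun t ht => by
        have := h (bar t) (by rwa [← suffix_bar, bar_bar])
        rwa [val_bar, abs_neg] at this) (by rw [val_bar]; linarith [h₂ rfl])
      exact ⟨bar β, by rw [← bar_bar x, hβ]; simp⟩
    · exact key x hl h (h₁ rfl)

/-- Words of length `d (|u| + 1) - 1` between `u 1 …` and `u 1 ū 1 ū 1 …` all of whose right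
factors are bounded by the latter are obtained from `u` by substitution. -/
lemma exists_sub (hu : 0 ≤ val u) (hd : u.length + 1 ∣ (u ++ true :: x).length + 1)
    (h : ∀ t, t <:+ u ++ true :: x → |val t| ≤ loop u + 2 * val u) :
    ∃ β, u ++ true :: x = u ++ sub u (true :: β) := by
  rcases hu.lt_or_eq with hu | hu
  · obtain ⟨k, hk⟩ := hd
    have hlen : (u ++ true :: x).length = u.length + 1 + x.length := by simp; omega
    have hp : (0 : ℚ) < (1 / 3) ^ u.length := by positivity
    have e := loop_eq u
    have hx : val x ≤ loop u := by
      have := (le_abs_self _).trans (h _ List.suffix_rfl)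
      rw [val_append, val_true] at this
      by_contra hc
      have := mul_lt_mul_of_pos_right (not_le.1 hc) hp
      linarith
    obtain ⟨k, rfl⟩ : ∃ j, k = j + 1 + 1 := by
      rcases k with _ | _ | k
      · simp at hk
      · omega
      · exact ⟨k, rfl⟩
    obtain ⟨β, hβ⟩ := exists_sub_of_block (b := true) hu k (x := x) (by
        have : (u.length + 1) * (k + 1 + 1) = (k + 1) * (u.length + 1) + (u.length + 1) := by ring
        omega)
      (fun t ht => h t (ht.trans ((List.suffix_cons _ _).trans (List.suffix_append _ _))))
      (fun _ => hx) (by simp)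
    exact ⟨β, by rw [hβ]; rfl⟩
  · have : u = [] := val_inj (by rw [← hu]; rfl)
    subst this
    exact ⟨x, by simp⟩

/-- A lexical word followed by `0` in a lexical word is not of the form `w 1 w̄`. -/
lemma ne_of_wLex (h : WLex (u ++ false :: z)) (w : List Bool) : u ≠ w ++ true :: bar w := by
  rintro rfl
  have h1 := (abs_le.1 (h (bar w ++ false :: z) ⟨w ++ [true], by simp⟩)).1
  have h2 := (abs_le.1 (h z ((List.suffix_cons _ _).trans (List.suffix_append _ _)))).2
  have hq1 : (1 / 3 : ℚ) ^ w.length ≤ 1 := pow_le_one₀ (by norm_num) (by norm_num)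
  have hq0 : (0 : ℚ) < (1 / 3) ^ w.length := by positivity
  -- `h1` says that `z` is at least `w 1 z̄`; `h2` bounds the difference of their values by `q / 3 <
  -- 1` times itself, so it vanishes. The lengths then disagree.
  have e : z = w ++ true :: bar z := by
    apply val_inj
    simp only [List.append_assoc, List.cons_append, val_append, val_true, val_false, val_bar,
      length_bar] at *
    generalize (1 / 3 : ℚ) ^ w.length = q at *
    nlinarith
  have := congrArg List.length e
  simp at this; omega

end KneadingWord

/-! ### Least lexical words, and the classification of consecutive lexical words -/

namespace KneadingWord

variable {g h u v w x y z β γ c l : List Bool} {n d m r k : ℕ}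

/-- `l` is the least lexical word of length `n - 1`. -/
structure WLeast (n : ℕ) (l : List Bool) : Prop where
  lex : WLex l
  length : l.length + 1 = n
  le : ∀ y, WLex y → y.length + 1 = n → val l ≤ val y

/-- `x` and `y` are consecutive lexical words of the same length. -/
structure LexCovBy (x y : List Bool) : Prop where
  left : WLex x
  right : WLex y
  length : x.length = y.length
  lt : val x < val y
  gap : ∀ w, w.length = y.length → WLex w → val x < val w → ¬ val w < val y

lemma exists_min_val (p : List Bool → Prop) (h : ∃ x, x.length = n ∧ p x) :
    ∃ x, x.length = n ∧ p x ∧ ∀ y, y.length = n → p y → val x ≤ val y := by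
  obtain ⟨x, hx, hp⟩ := h
  obtain ⟨y, h1, h2, h3⟩ := exists_max_val (n := n) (fun y => p (bar y)) ⟨bar x, by simpa, by simpa⟩
  refine ⟨bar y, by simpa, h2, fun z hz hpz => ?_⟩
  have := h3 (bar z) (by simpa) (by simpa)
  rw [val_bar] at this ⊢
  linarith

lemma WLex.cons_true (h : WLex w) : WLex (true :: w) := by
  have hw := val_lt_half w
  have h1 : val w ≤ val (true :: w) := by simp only [val_true]; linarith
  intro t ht
  rcases List.suffix_cons_iff.1 ht with rfl | ht
  · rw [abs_of_pos (val_true_pos w)]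
  · exact (h t ht).trans h1

lemma wLex_nil : WLex [] := fun t ht => by simp [List.suffix_nil.1 ht]

lemma wLex_replicate (n : ℕ) : WLex (List.replicate n true) := by
  induction n with
  | zero => exact wLex_nil
  | succ n ih => exact ih.cons_true

lemma exists_wLeast (n : ℕ) : ∃ l, WLeast (n + 1) l := by
  obtain ⟨l, h1, h2, h3⟩ := exists_min_val (n := n) WLex ⟨_, by simp, wLex_replicate n⟩
  exact ⟨l, h2, by omega, fun y hy hl => h3 y (by omega) hy⟩

lemma WLeast.unique (h₁ : WLeast n x) (h₂ : WLeast n y) : x = y :=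
  val_inj (le_antisymm (h₁.le _ h₂.lex h₂.length) (h₂.le _ h₁.lex h₁.length))

lemma exists_lexCovBy (hy : WLex y) (h : ¬ WLeast (y.length + 1) y) : ∃ x, LexCovBy x y := by
  have : ∃ x, x.length = y.length ∧ (WLex x ∧ val x < val y) := by
    by_contra hc
    push Not at hc
    exact h ⟨hy, rfl, fun x hx hl => hc x (by omega) hx⟩
  obtain ⟨x, h1, ⟨h2, h3⟩, h4⟩ := exists_max_val _ this
  exact ⟨x, h2, hy, h1, h3, fun w hl hw hxw hwy => absurd (h4 w hl ⟨hw, hwy⟩) (not_le.2 hxw)⟩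

lemma wLex_of_split (h₁ : WLex (u ++ false :: z)) (h₂ : WLex (u ++ true :: x)) : WLex u := by
  intro v hv
  refine abs_le.2 ⟨?_, ?_⟩
  · have h1 := (abs_le.1 (h₁ _ (suffix_append_right hv))).1
    linarith [val_append_false_lt u z, val_append_false_lt v z]
  · by_contra hc
    rw [not_le] at hc
    have h2 := (val_lt_append_true v x).trans_le
      ((le_abs_self _).trans (h₂ _ (suffix_append_right hv)))
    have h3 := length_le_of_between (a := u) (r := []) (by simpa using hc.le) h2.le
    rw [hv.eq_of_length (le_antisymm hv.length_le h3)] at hc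
    exact lt_irrefl _ hc

/-- A smaller word would stay below u 1 ū 1 ū …, hence be a substitution instance of a lexical word
(`exists_sub`), which is at least `l`. -/
lemma append_sub_le_of_least (hu : WLex u) (hl : WLeast d l)
    (hy : WLex (u ++ true :: x)) (hlen : (u ++ true :: x).length + 1 = (u.length + 1) * d) :
    val (u ++ sub u l) ≤ val (u ++ true :: x) := by
  by_contra hc
  rw [not_le] at hc
  obtain ⟨β, hβ⟩ := exists_sub hu.nonneg ⟨d, hlen⟩
    fun t ht => (hy t ht).trans (hc.le.trans (val_append_sub_le_loop u l))
  rw [hβ] at hy hc hlen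
  have hβ' : WLex (true :: β) := adm_of_append_sub hy (val_true_pos β).le
  rw [length_append_sub] at hlen
  have := hl.le _ hβ' (Nat.eq_of_mul_eq_mul_left (Nat.succ_pos _) hlen)
  rw [val_append_lt, val_sub_lt] at hc
  linarith

lemma sub_sub (τ u c : List Bool) : sub τ (sub u c) = sub (τ ++ sub τ u) c := by
  have hb : ∀ b, block (τ ++ sub τ u) b = block τ b ++ sub τ (block u b) := by
    intro b; cases b <;> simp
  induction c with
  | nil => rfl
  | cons b c ih => rw [sub_cons, sub_cons, sub_cons, sub_append, ih, hb, List.append_assoc]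

lemma append_sub_assoc (τ u c : List Bool) :
    τ ++ sub τ (u ++ sub u c) = (τ ++ sub τ u) ++ sub (τ ++ sub τ u) c := by
  rw [sub_append, sub_sub, List.append_assoc]

lemma wLex_true : WLex [true] := wLex_nil.cons_true

lemma WLex.eq_cons (h : WLex y) (hl : 0 < y.length) : ∃ t, y = true :: t := by
  rcases val_nonneg_iff.1 h.nonneg with rfl | h
  · simp at hl
  · exact h

lemma WLex.eq_cons_cons (h : WLex y) (hl : 1 < y.length) : ∃ t, y = [true] ++ true :: t := by
  obtain ⟨t, rfl⟩ := h.eq_cons (by omega)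
  rcases t with _ | ⟨_ | _, t⟩
  · simp at hl
  · exact absurd rfl (ne_of_wLex (u := [true]) (z := t) h [])
  · exact ⟨t, rfl⟩

/-- The least lexical words of odd length. -/
lemma WLeast.eq_of_even {s : List Bool} (hl : WLeast (2 * d) l) (hs : WLeast d s) :
    l = [true] ++ sub [true] s := by
  have hsl := hs.length
  have hll := hl.length
  have hlen := length_append_sub [true] s
  have h1 := hl.le _ (wLex_append_sub wLex_true hs.lex) (by
    rw [hlen, hsl]; simp)
  refine val_inj (le_antisymm h1 ?_)
  by_cases h2 : 1 < l.length
  · obtain ⟨t, rfl⟩ := hl.lex.eq_cons_cons h2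
    exact append_sub_le_of_least wLex_true hs hl.lex (by rw [hll]; simp)
  · obtain ⟨t, rfl⟩ := hl.lex.eq_cons (by omega)
    rw [List.length_cons] at hll h2
    have ht : t = [] := List.length_eq_zero_iff.1 (by omega)
    have hs0 : s = [] := List.length_eq_zero_iff.1 (by omega)
    subst ht hs0
    exact le_rfl

/-- The word `1010…10` of length `2 k`. -/
def alt : ℕ → List Bool
  | 0 => []
  | k + 1 => true :: false :: alt k

lemma length_alt (k : ℕ) : (alt k).length = 2 * k := by
  induction k with
  | zero => rfl
  | succ k ih => simp [alt, ih]; ring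

lemma val_alt (k : ℕ) : val (alt k) = 1 / 4 - 1 / 4 * (1 / 3) ^ (2 * k) := by
  induction k with
  | zero => simp [alt]
  | succ k ih =>
    rw [alt, val_true, val_false, ih, mul_add, pow_add]; ring

/-- The word `1101…01` of length `2 k + 2`. -/
def odd (k : ℕ) : List Bool := [true] ++ true :: bar (alt k)

lemma length_odd (k : ℕ) : (odd k).length = 2 * k + 2 := by
  simp [odd, length_alt]

lemma val_odd (k : ℕ) : val (odd k) = 5 / 12 + 1 / 4 * (1 / 3) ^ (2 * k + 2) := by
  simp only [odd, List.singleton_append, val_true, val_bar, val_alt, pow_add]; ring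

/-- 5/12 and 1/4 are the values of 110101… and 1010…. If `|x| < 1/4`, then `11x` exceeds 4/9 - 1/36
= 5/12, while `10x` stays below 2/9 + 1/36 = 1/4. -/
lemma abs_val_lt_quarter (k : ℕ) (hl : x.length = 2 * k)
    (h : ∀ t, t <:+ x → |val t| ≤ 5 / 12) : |val x| < 1 / 4 := by
  induction k generalizing x with
  | zero => rw [List.length_eq_zero_iff.1 hl]; norm_num
  | succ k ih =>
    rcases x with _ | ⟨b, _ | ⟨c, x⟩⟩
    · simp at hl; 
    · simp at hl; omega
    · have h1 := abs_lt.1 (ih (x := x) (by simp at hl; omega) fun t ht =>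
        h t (ht.trans ((List.suffix_cons _ _).trans (List.suffix_cons _ _))))
      have h2 := abs_le.1 (h _ List.suffix_rfl)
      rw [abs_lt]
      cases b <;> cases c <;> simp only [val_true, val_false] at h2 ⊢ <;> constructor <;> linarith

lemma eq_of_close (hl : x.length = y.length) (h : |val y - val x| * 2 < (1 / 3) ^ x.length) :
    y = x := by
  obtain ⟨r, rfl⟩ := exists_append_of_close x y h
  simp at hl
  simp [hl]

lemma odd_le (hl : y.length = 2 * k + 2) (h : 5 / 12 < val y) : val (odd k) ≤ val y := by
  by_contra hc
  rw [not_le] at hc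
  rw [eq_of_close (x := odd k) (y := y) (by rw [length_odd, hl]) (by
    rw [abs_sub_comm, abs_of_pos (by linarith), length_odd, val_odd]
    linarith [(by positivity : (0:ℚ) < (1 / 3) ^ (2 * k + 2))])] at hc
  exact lt_irrefl _ hc

lemma WLex.odd_le (hy : WLex y) (hl : y.length = 2 * k + 2) : val (odd k) ≤ val y := by
  refine KneadingWord.odd_le hl ?_
  by_contra hc
  rw [not_lt] at hc
  have h1 := (le_abs_self _).trans_lt
    (abs_val_lt_quarter (k + 1) (by omega) fun t ht => (hy t ht).trans hc)
  obtain ⟨t, rfl⟩ := hy.eq_cons_cons (by omega)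
  simp only [List.singleton_append, val_true] at h1
  linarith [neg_half_lt_val t]

lemma suffix_alt {t : List Bool} (h : t <:+ alt k) : |val t| ≤ 1 / 3 := by
  induction k with
  | zero => rw [List.suffix_nil.1 h]; norm_num
  | succ k ih =>
    have h0 := val_alt k
    have h1 : (0 : ℚ) < (1 / 3) ^ (2 * k) := by positivity
    have h2 : (1 / 3 : ℚ) ^ (2 * k) ≤ 1 := pow_le_one₀ (by norm_num) (by norm_num)
    rcases List.suffix_cons_iff.1 h with rfl | h
    · simp only [val_true, val_false]; rw [abs_le]; constructor <;> linarith
    rcases List.suffix_cons_iff.1 h with rfl | h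
    · simp only [val_false]; rw [abs_le]; constructor <;> linarith
    · exact ih h

lemma wLex_odd (k : ℕ) : WLex (odd k) := by
  have h0 : (0 : ℚ) < (1 / 3) ^ (2 * k + 2) := by positivity
  have h2 := val_alt k
  have h3 : (0 : ℚ) < (1 / 3) ^ (2 * k) := by positivity
  have h4 : (1 / 3 : ℚ) ^ (2 * k) ≤ 1 := pow_le_one₀ (by norm_num) (by norm_num)
  have h5 := val_odd k
  intro t ht
  rcases List.suffix_cons_iff.1 (show t <:+ true :: true :: bar (alt k) from ht) with rfl | ht
  · exact (abs_of_pos (val_true_pos _)).le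
  rcases List.suffix_cons_iff.1 ht with rfl | ht
  · simp only [val_true, val_bar]; rw [abs_le]; constructor <;> linarith
  · have := suffix_alt (t := bar t) (by rwa [← suffix_bar, bar_bar])
    rw [val_bar, abs_neg] at this
    linarith

lemma wLeast_odd (k : ℕ) : WLeast (2 * k + 3) (odd k) :=
  ⟨wLex_odd k, by rw [length_odd], fun _ hy hl => hy.odd_le (by omega)⟩

/-- A strict word above `h` lies between `h` and `g`, so it is a substitution instance
(`exists_sub`). The substituted word has no factor beyond 5/12, so its value is below 1/4, and no
word of its length lies between `alt (k + 1)` and 1/4. -/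
lemma mate_odd {τ : List Bool} (hτ : WLex τ) (k : ℕ) (hg : g = τ ++ sub τ (odd k))
    (hh : h = τ ++ sub τ (alt (k + 1))) (hne : ∀ w, g ≠ w ++ true :: bar w) : Mate g h := by
  have hσ : WLex (τ ++ sub τ [true]) := wLex_append_sub hτ wLex_true
  have eg : g = (τ ++ sub τ [true]) ++ true :: bar (τ ++ sub τ (alt k)) := by
    rw [hg]; simp [odd]
  have eh : h = (τ ++ sub τ [true]) ++ false :: (τ ++ sub τ (alt k)) := by
    rw [hh]; simp [alt]
  have hglen : g.length + 1 = (τ.length + 1) * (2 * k + 2 + 1) := by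
    rw [hg, length_append_sub, length_odd]
  refine ⟨hg ▸ wLex_append_sub hτ (wLex_odd k), hne, ?_, fun t ht => ?_, fun y hyl hy => ?_,
    _, _, hσ, eg, eh⟩
  · rw [hg, hh]; simp [length_sub, length_odd, length_alt]; ring
  · have h1 : Adm [true] (alt (k + 1)) := fun t ht => by
      rw [val_true, val_nil]; simpa using suffix_alt ht
    refine (adm_append_sub hτ h1 t (hh ▸ ht)).trans_lt ?_
    rw [eg]; exact val_lt_append_true _ _
  · by_contra hc
    rw [not_le] at hc
    have hyg := hy.lt
    obtain ⟨r, hr⟩ := exists_append_of_between (y := y) (a := τ) (r := sub τ (alt (k + 1)))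
      (s := sub τ (odd k)) (by rw [← hh]; exact hc.le) (by rw [← hg]; exact hyg.le)
    obtain ⟨x, rfl⟩ : ∃ x, r = true :: x := by
      rw [← val_pos_iff_head, ← lt_val_append, ← hr]
      refine lt_of_le_of_lt ?_ hc
      rw [hh, le_val_append]; exact (val_true_pos _).le
    obtain ⟨β, hβ⟩ := exists_sub (u := τ) (x := x) hτ.nonneg
      ⟨2 * k + 2 + 1, by rw [← hr, hyl, hglen]⟩ fun t ht =>
        (hy t (hr ▸ ht)).le.trans (hg ▸ val_append_sub_le_loop τ (odd k))
    have hyβ : y = τ ++ sub τ (true :: β) := hr.trans hβ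
    have hβA : Adm (odd k) (true :: β) := by
      refine adm_of_append_sub (u := τ) ?_ (val_true_pos β).le
      rw [← hyβ, ← hg]; exact hy.adm
    rw [hyβ] at hyg hc
    rw [hg, val_append_lt, val_sub_lt] at hyg
    rw [hh, val_append_lt, val_sub_lt] at hc
    have hβl : (true :: β).length = 2 * k + 2 := by
      have h1 := length_append_sub τ (true :: β)
      rw [← hyβ, hyl, hglen] at h1
      have := Nat.eq_of_mul_eq_mul_left (Nat.succ_pos _) h1
      omega
    have h1 := (le_abs_self _).trans_lt (abs_val_lt_quarter (k + 1) (by omega) fun t ht => by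
      by_contra hcon
      rw [not_le, ← val_pos] at hcon
      have hle := hβA t ht
      rw [← val_pos] at hle
      obtain ⟨r, hr⟩ := exists_append_of_close (odd k) (pos t) (by
        rw [abs_sub_comm, abs_of_nonneg (by linarith), length_odd, val_odd]
        linarith [(by positivity : (0:ℚ) < (1 / 3) ^ (2 * k + 2))])
      have hlen := congrArg List.length hr
      rw [length_pos, List.length_append, length_odd] at hlen
      have htl := ht.length_le
      have hte := ht.eq_of_length (by omega)
      rw [List.length_eq_zero_iff.1 (show r.length = 0 by omega), hte,
        pos_of_nonneg (val_true_pos _).le, List.append_nil] at hr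
      rw [hr] at hyg
      exact lt_irrefl _ hyg)
    rw [eq_of_close (x := alt (k + 1)) (y := true :: β) (by rw [length_alt, hβl]; ring) (by
      rw [abs_of_pos (by linarith), length_alt, val_alt]
      linarith [(by positivity : (0:ℚ) < (1 / 3) ^ (2 * (k + 1)))])] at hc
    exact lt_irrefl _ hc

lemma LexCovBy.split (h : LexCovBy x y) :
    ∃ u z x', x = u ++ false :: z ∧ y = u ++ true :: x' ∧ WLex u ∧ x'.length = z.length := by
  obtain ⟨u, z, x', rfl, rfl⟩ := exists_split_of_length h.lt h.length
  have := h.length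
  simp at this
  exact ⟨u, z, x', rfl, rfl, wLex_of_split h.left h.right, this.symm⟩

lemma LexCovBy.eq_bar (h : LexCovBy (u ++ false :: z) (u ++ true :: x)) (hu : WLex u)
    (hm : ¬ u.length + 1 ∣ (u ++ true :: x).length + 1) :
    x = bar z ∧ 0 ≤ val z ∧ Strict u z ∧ ¬ Hit u (val z) z.length := by
  have hl := h.length
  simp at hl
  refine eq_bar_of_gap hu h.left h.right hl.symm (fun hd => hm ?_) fun y hy => h.gap y ?_
  · rw [show (u ++ true :: x).length + 1 = (u.length + 1) + (z.length + 1) by simp; omega]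
    exact dvd_add dvd_rfl hd
  · rw [hy]; simp; omega

/-- A strict word above `u 0 z` is `u 0 r` or `u 1 r`. Then `r`, respectively `r̄`, exceeds `z` and
satisfies `hit_of_large_factors`, giving the hit which `LexCovBy.eq_bar` excludes. -/
lemma mate_of_lexCovBy (h : LexCovBy (u ++ false :: z) (u ++ true :: bar z)) (hu : WLex u)
    (hm : ¬ u.length + 1 ∣ (u ++ true :: bar z).length + 1)
    (hne : ∀ w, u ++ true :: bar z ≠ w ++ true :: bar w) :
    Mate (u ++ true :: bar z) (u ++ false :: z) := by
  obtain ⟨-, h0, hz, H⟩ := h.eq_bar hu hm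
  refine ⟨h.right, hne, h.length, fun t ht => (h.left t ht).trans_lt h.lt, fun y hyl hy => ?_,
    u, z, hu, rfl, rfl⟩
  by_contra hc
  rw [not_le] at hc
  have key : ∀ x, x.length = z.length → val z < val x →
      (∀ t, t <:+ x → |val t| < val (u ++ true :: bar z)) → False := by
    intro x hxl hx hxs
    refine H (hxl ▸ hit_of_large_factors hu ⟨hz.adm, h0⟩ hz.lt x hxl.le hx fun t ht => ?_)
    by_cases ht' : |val t| ≤ val u
    · exact Or.inl ht'
    obtain ⟨f, hf⟩ := pos_eq_append_of_lt (not_le.1 ht') (hxs t ht).le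
    refine Or.inr ⟨f, hf, ?_⟩
    have := hxs t ht
    rw [← val_pos, hf, val_append_lt] at this
    simp only [val_true, val_bar] at this; linarith
  obtain ⟨r, rfl⟩ := exists_append_of_between hc.le hy.lt.le
  rcases r with _ | ⟨_ | _, r⟩
  · simp at hyl
  · have hs := hy.suffix ((List.suffix_cons false r).trans (List.suffix_append u _))
    rw [val_append_lt] at hc
    simp only [val_false] at hc
    exact key r (by simpa using hyl) (by linarith) hs
  · have hs := hy.suffix ((List.suffix_cons true r).trans (List.suffix_append u _))
    have := hy.lt
    rw [val_append_lt] at this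
    simp only [val_true, val_bar] at this
    exact key (bar r) (by simpa using hyl) (by rw [val_bar]; linarith) hs.bar

/-- If the length of the common left factor of two neighbouring lexical words is admissible, the
greater of them is obtained by substitution from a least word. -/
lemma LexCovBy.eq_append_sub (h : LexCovBy (u ++ false :: z) (u ++ true :: x)) (hu : WLex u)
    (hm : (u ++ true :: x).length + 1 = (u.length + 1) * d) (hl : WLeast d l) :
    2 ≤ d ∧ u ++ true :: x = u ++ sub u l := by
  have hd : 2 ≤ d := by
    by_contra hc
    have := Nat.mul_le_mul_left (u.length + 1) (show d ≤ 1 by omega)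
    rw [← hm] at this
    simp at this
  refine ⟨hd, ?_⟩
  have h1 := append_sub_le_of_least hu hl h.right hm
  have hll := hl.length
  obtain ⟨t, rfl⟩ := hl.lex.eq_cons (by omega)
  refine val_inj (le_antisymm (not_lt.1 (h.gap _ ?_ (wLex_append_sub hu hl.lex) ?_)) h1)
  · have := length_append_sub u (true :: t)
    rw [hll, ← hm] at this; omega
  · exact val_append_false_lt_true _ _ _

/-- A lexical word which is not of the form `w 1 w̄` is either obtained by substitution from a least
word of even length, or it differs from its predecessor by complementing. -/
lemma exists_companion (hg : WLex g) (hg0 : 0 < g.length) (hne : ∀ w, g ≠ w ++ true :: bar w) :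
    (∃ τ k, WLex τ ∧ g = τ ++ sub τ (odd k)) ∨
    (¬ WLeast (g.length + 1) g ∧ ∃ u z, WLex u ∧ 0 ≤ val z ∧ ¬ u.length + 1 ∣ g.length + 1 ∧
      g = u ++ true :: bar z ∧ LexCovBy (u ++ false :: z) g) := by
  classical
  -- Take the least `r`. An even `r = 2s` is impossible: the least word for `2s` is a substitution
  -- instance of that for `s` (`WLeast.eq_of_even`), so `s` would do, or `s = 1` and `g = τ 1 τ̄`.
  by_cases hex : ∃ r, 2 ≤ r ∧ ∃ τ l, WLex τ ∧ WLeast r l ∧ g = τ ++ sub τ l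
  · left
    obtain ⟨hr, τ, l, hτ, hl, e⟩ := Nat.find_spec hex
    set r := Nat.find hex with hrdef
    rcases Nat.even_or_odd' r with ⟨s, hs | hs⟩
    · exfalso
      obtain ⟨μ, hμ⟩ := exists_wLeast (s - 1)
      rw [show s - 1 + 1 = s by omega] at hμ
      rw [hs] at hl
      have el := hl.eq_of_even hμ
      by_cases hs1 : s = 1
      · have : μ = [] := List.length_eq_zero_iff.1 (by have := hμ.length; omega)
        rw [el, this] at e
        exact hne τ (by rw [e]; simp)
      · exact Nat.find_min hex (m := s) (by omega) ⟨by omega, τ ++ sub τ [true], μ,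
          wLex_append_sub hτ wLex_true, hμ, by rw [e, el, append_sub_assoc]⟩
    · obtain ⟨k, rfl⟩ : ∃ k, s = k + 1 := ⟨s - 1, by omega⟩
      refine ⟨τ, k, hτ, ?_⟩
      rw [e, hl.unique (y := odd k) (by
        have := wLeast_odd k
        rwa [show 2 * k + 3 = r by omega] at this)]
  · right
    have hnl : ¬ WLeast (g.length + 1) g := fun hl =>
      hex ⟨g.length + 1, by omega, [], g, wLex_nil, hl, by simp⟩
    refine ⟨hnl, ?_⟩
    obtain ⟨P, hP⟩ := exists_lexCovBy hg hnl
    obtain ⟨u, z, x, rfl, rfl, hu, -⟩ := hP.split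
    by_cases hm : u.length + 1 ∣ (u ++ true :: x).length + 1
    · exfalso
      obtain ⟨d, hd⟩ := hm
      rcases d with _ | d
      · simp at hd
      obtain ⟨l, hl⟩ := exists_wLeast d
      obtain ⟨h2, e⟩ := hP.eq_append_sub hu hd hl
      exact hex ⟨_, h2, u, l, hu, hl, e⟩
    · obtain ⟨rfl, h0, -⟩ := hP.eq_bar hu hm
      exact ⟨u, z, hu, h0, hm, rfl, hP⟩

/-- The predecessor of a word obtained by substitution from a least word. -/
lemma Mate.lexCovBy (M : Mate g h) (hd : 2 ≤ d) (hl : WLeast d l) :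
    LexCovBy (tower g h (d - 1)) (g ++ sub g l) := by
  obtain ⟨j, rfl⟩ : ∃ j, d = j + 2 := ⟨d - 2, by omega⟩
  have hll := hl.length
  have h1 := length_append_sub g l
  have h2 := length_tower (g := g) M.length (j + 1)
  have h3 : (g.length + 1) * (l.length + 1) = (j + 1 + 1) * (g.length + 1) := by
    rw [hll]; ring
  obtain ⟨t, rfl⟩ := hl.lex.eq_cons (by omega)
  refine ⟨M.wLex_tower j, wLex_append_sub M.lex hl.lex, ?_,
    val_append_false_lt_true _ _ _, fun w hw hwL hlt hgt => ?_⟩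
  · rw [show j + 2 - 1 = j + 1 from rfl]; omega
  -- A word in between begins with `g`. Followed by 0, its rest is strict and bounded by the tower;
  -- followed by 1, it is at least the substituted least word.
  obtain ⟨r, rfl⟩ := exists_append_of_between (y := w) (a := g) hlt.le hgt.le
  rcases r with _ | ⟨_ | _, r⟩
  · rw [sub_cons] at hw; simp at hw
  · have hr := strict_of_wLex hwL
    refine absurd (M.le_tower j (y := r) ?_ hr) (not_le.2 ?_)
    · have : (j + 1 + 1) * (g.length + 1) = (j + 1) * (g.length + 1) + g.length + 1 := by ring
      rw [List.length_append, List.length_cons] at hw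
      omega
    · rw [show j + 2 - 1 = j + 1 from rfl, tower, val_append_lt] at hlt
      simp only [val_false] at hlt; linarith
  · exact absurd (append_sub_le_of_least M.lex hl hwL (by rw [hw, h1, hll])) (not_le.2 hgt)

end KneadingWord

/-! ### Translation of sequences into words -/

open KneadingWord

namespace AlphaSeq

/-- The word `1^{α₁} 0^{α₂} 1^{α₃} …`. -/
def enc : List ℕ → List Bool
  | [] => []
  | a :: α => List.replicate a true ++ bar (enc α)

variable {α β γ ρ τ ζ : List ℕ} {a b n i : ℕ} {u v w x z : List Bool}

@[simp] lemma enc_nil : enc [] = [] := rfl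
@[simp] lemma enc_cons (a : ℕ) (α : List ℕ) :
    enc (a :: α) = List.replicate a true ++ bar (enc α) := rfl

@[simp] lemma length_enc (α : List ℕ) : (enc α).length = α.sum := by
  induction α with
  | nil => rfl
  | cons a α ih => simp [ih]

lemma IsSeq.of_cons (h : IsSeq (a :: α)) : 0 < a ∧ IsSeq α := by
  simpa [IsSeq] using h

lemma IsSeq.cons (ha : 0 < a) (h : IsSeq α) : IsSeq (a :: α) := by
  simpa [IsSeq] using ⟨ha, h⟩

lemma isSeq_nil : IsSeq [] := by simp [IsSeq]

lemma isSeq_append : IsSeq (α ++ β) ↔ IsSeq α ∧ IsSeq β := by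
  simp only [IsSeq, List.mem_append]
  exact ⟨fun h => ⟨fun a ha => h a (Or.inl ha), fun a ha => h a (Or.inr ha)⟩,
    fun h a ha => ha.elim (h.1 a) (h.2 a)⟩

lemma isSeq_drop (h : IsSeq α) (i : ℕ) : IsSeq (α.drop i) := fun a ha => h a (List.mem_of_mem_drop ha)

lemma val_replicate_append_pos (ha : 0 < a) (w : List Bool) :
    0 < val (List.replicate a true ++ w) := by
  obtain ⟨a, rfl⟩ : ∃ k, a = k + 1 := ⟨a - 1, by omega⟩
  exact val_true_pos _

lemma IsSeq.val_enc_nonneg (h : IsSeq α) : 0 ≤ val (enc α) := by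
  rcases α with _ | ⟨a, α⟩
  · simp
  · exact (val_replicate_append_pos h.of_cons.1 _).le

lemma val_enc_cons_lt (hα : IsSeq α) (h : a < b) :
    val (enc (a :: α)) < val (enc (b :: β)) := by
  obtain ⟨k, rfl⟩ : ∃ k, b = a + k := ⟨b - a, by omega⟩
  rw [enc_cons, enc_cons, List.replicate_add, List.append_assoc, val_append_lt, val_bar]
  have := hα.val_enc_nonneg
  linarith [val_replicate_append_pos (show 0 < k by omega) (bar (enc β))]

lemma al_succ (a : ℕ) (α : List ℕ) (i : ℕ) : al (a :: α) (i + 1) = -al α i := by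
  simp [al, pow_succ]

lemma al_zero (a : ℕ) (α : List ℕ) : al (a :: α) 0 = a := by simp [al]

lemma al_nil (i : ℕ) : al [] i = 0 := by simp [al]

lemma lt_cons_cons : Lt (a :: α) (b :: β) ↔ a < b ∨ a = b ∧ Lt β α := by
  constructor
  · rintro ⟨i, h1, h2⟩
    rcases i with _ | i
    · left; simpa [al_zero] using h2
    · right
      refine ⟨by simpa [al_zero] using h1 0 (by omega), i, fun j hj => ?_, ?_⟩
      · have := h1 (j + 1) (by omega)
        rw [al_succ, al_succ] at this
        linarith
      · rw [al_succ, al_succ] at h2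
        linarith
  · rintro (h | ⟨rfl, i, h1, h2⟩)
    · exact ⟨0, by simp, by simpa [al_zero] using h⟩
    · refine ⟨i + 1, fun j hj => ?_, ?_⟩
      · rcases j with _ | j
        · simp [al_zero]
        · rw [al_succ, al_succ, h1 j (by omega)]
      · rw [al_succ, al_succ]; linarith

/-- Deleting equal first entries reverses the alternating order, just as complementation negates
values. -/
lemma lt_iff (hα : IsSeq α) (hβ : IsSeq β) : Lt α β ↔ val (enc α) < val (enc β) := by
  induction hn : α.length + β.length using Nat.strong_induction_on generalizing α β with
  | _ n ih =>
  rcases α with _ | ⟨a, α⟩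
  · rcases β with _ | ⟨b, β⟩
    · simp [Lt]
    · refine iff_of_true ⟨0, by simp, ?_⟩ (by
        simpa using val_replicate_append_pos hβ.of_cons.1 (bar (enc β)))
      rw [al_nil, al_zero]; exact_mod_cast hβ.of_cons.1
  rcases β with _ | ⟨b, β⟩
  · refine iff_of_false ?_ (not_lt.2 hα.val_enc_nonneg)
    rintro ⟨i, h1, h2⟩
    have ha := hα.of_cons.1
    rcases i with _ | i
    · rw [al_nil, al_zero] at h2; omega
    · have := h1 0 (by omega)
      rw [al_nil, al_zero] at this; omega
  rw [lt_cons_cons]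
  obtain ⟨ha, hα⟩ := hα.of_cons
  obtain ⟨hb, hβs⟩ := hβ.of_cons
  rcases lt_trichotomy a b with h | rfl | h
  · exact iff_of_true (Or.inl h) (val_enc_cons_lt hα h)
  · rw [enc_cons, enc_cons, val_append_lt, val_bar, val_bar, neg_lt_neg_iff,
      ← ih _ (by simp at hn; omega) hβs hα rfl]
    simp
  · exact iff_of_false (by omega) (not_lt.2 (val_enc_cons_lt hβs h).le)

lemma enc_injective (hα : IsSeq α) (hβ : IsSeq β) (h : enc α = enc β) : α = β := by
  induction α generalizing β with
  | nil =>
    rcases β with _ | ⟨b, β⟩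
    · rfl
    · have := val_replicate_append_pos hβ.of_cons.1 (bar (enc β))
      rw [← enc_cons, ← h] at this
      simp at this
  | cons a α ih =>
    rcases β with _ | ⟨b, β⟩
    · have := val_replicate_append_pos hα.of_cons.1 (bar (enc α))
      rw [← enc_cons, h] at this
      simp at this
    · obtain ⟨ha, hα⟩ := hα.of_cons
      obtain ⟨hb, hβs⟩ := hβ.of_cons
      obtain rfl : a = b := by
        rcases lt_trichotomy a b with h' | h' | h'
        · exact absurd h (fun e => (val_enc_cons_lt hα h').ne (congrArg val e))
        · exact h'
        · exact absurd h (fun e => (val_enc_cons_lt hβs h').ne (congrArg val e.symm))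
      rw [enc_cons, enc_cons] at h
      rw [ih hα hβs (by rw [← bar_bar (enc α), List.append_cancel_left h, bar_bar])]

lemma exists_enc (h : 0 ≤ val w) : ∃ α, IsSeq α ∧ enc α = w := by
  induction hn : w.length generalizing w with
  | zero => exact ⟨[], isSeq_nil, by rw [List.length_eq_zero_iff.1 hn]; rfl⟩
  | succ n ih =>
    obtain ⟨w, rfl⟩ : ∃ t, w = true :: t := by
      rcases val_nonneg_iff.1 h with rfl | h
      · simp at hn
      · exact h
    obtain ⟨α, h1, h2⟩ := ih (w := pos w) (val_pos_nonneg w) (by simpa using hn)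
    rcases eq_pos_or_bar w with e | e
    · rcases α with _ | ⟨a, α⟩
      · exact ⟨[1], by simp [IsSeq], by rw [e, ← h2]; rfl⟩
      · exact ⟨(a + 1) :: α, h1.of_cons.2.cons (Nat.succ_pos _), by rw [e, ← h2]; rfl⟩
    · exact ⟨1 :: α, h1.cons one_pos, by rw [e, ← h2]; rfl⟩

lemma enc_append (γ ρ : List ℕ) :
    enc (γ ++ ρ) = enc γ ++ if Even γ.length then enc ρ else bar (enc ρ) := by
  induction γ with
  | nil => simp
  | cons a γ ih =>
    rw [List.cons_append, enc_cons, ih, enc_cons, List.length_cons]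
    by_cases h : Even γ.length
    · simp [h, Nat.even_add_one]
    · simp [h, Nat.even_add_one]

lemma suffix_replicate {v : List Bool} (h : v <:+ List.replicate a true) :
    ∃ c ≤ a, v = List.replicate c true := by
  have := List.eq_replicate_of_mem (a := true) (l := v) fun b hb =>
    List.eq_of_mem_replicate (h.subset hb)
  exact ⟨v.length, by simpa using h.length_le, this⟩

lemma val_replicate_mono (h : a ≤ b) : val (List.replicate a true ++ w) ≤
    val (List.replicate b true ++ w) := by
  obtain ⟨k, rfl⟩ := Nat.exists_eq_add_of_le' h
  induction k with
  | zero => simp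
  | succ k ih =>
    refine (ih (by omega)).trans ?_
    rw [show k + 1 + a = (k + a) + 1 by ring, List.replicate_succ, List.cons_append, val_true]
    linarith [val_lt_half (List.replicate (k + a) true ++ w)]

/-- Shortening the initial run of a right factor can only lower its absolute value, so only factors
starting with a full run matter. -/
lemma abs_val_le_of_drop (hα : IsSeq α) {M : ℚ} (hM : 0 ≤ M)
    (h : ∀ i, val (enc (α.drop i)) ≤ M) : ∀ t, t <:+ enc α → |val t| ≤ M := by
  induction α with
  | nil => intro t ht; simp [List.suffix_nil.1 ht, hM]
  | cons a α ih =>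
    intro t ht
    have ih := ih hα.of_cons.2 fun i => by simpa using h (i + 1)
    have hbar : ∀ t, t <:+ bar (enc α) → |val t| ≤ M := fun t ht => by
      have := ih (bar t) (by rwa [← suffix_bar, bar_bar])
      rwa [val_bar, abs_neg] at this
    rcases suffix_append_cases ht with ht | ⟨v, hv, hvs, rfl⟩
    · exact hbar t ht
    · obtain ⟨c, hc, rfl⟩ := suffix_replicate hvs
      have hc0 : 0 < c := Nat.pos_of_ne_zero fun h => hv (by rw [h]; rfl)
      rw [abs_of_pos (val_replicate_append_pos hc0 _)]
      exact (val_replicate_mono hc).trans (h 0)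

lemma isLexical_iff (hα : IsSeq α) : IsLexical α ↔ WLex (enc α) := by
  constructor
  · intro h
    refine abs_val_le_of_drop hα hα.val_enc_nonneg fun i => ?_
    rcases Nat.eq_zero_or_pos i with rfl | hi
    · simp
    · by_cases hl : i < α.length
      · exact ((lt_iff (isSeq_drop hα i) hα).1 (h i hi hl)).le
      · rw [List.drop_eq_nil_of_le (by omega)]; exact hα.val_enc_nonneg
  · intro h i hi hl
    rw [lt_iff (isSeq_drop hα i) hα]
    have e := enc_append (α.take i) (α.drop i)
    rw [List.take_append_drop] at e
    have h1 : val (enc (α.drop i)) ≤ val (enc α) := by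
      by_cases hp : Even (α.take i).length
      · rw [if_pos hp] at e
        exact (le_abs_self _).trans (h _ ⟨_, e.symm⟩)
      · rw [if_neg hp] at e
        have := (neg_le_abs _).trans (h _ ⟨_, e.symm⟩)
        rwa [val_bar, neg_neg] at this
    refine lt_of_le_of_ne h1 fun e' => ?_
    have := congrArg List.length (enc_injective (isSeq_drop hα i) hα (val_inj e'))
    simp at this; omega

lemma mem_L_iff : α ∈ L n ↔ IsSeq α ∧ WLex (enc α) ∧ (enc α).length + 1 = n := by
  rw [length_enc, add_comm]
  exact ⟨fun ⟨h1, h2, h3⟩ => ⟨h1, (isLexical_iff h1).1 h2, h3⟩,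
    fun ⟨h1, h2, h3⟩ => ⟨h1, (isLexical_iff h1).2 h2, h3⟩⟩

lemma exists_mem_L (hw : WLex w) (hl : w.length + 1 = n) : ∃ α ∈ L n, enc α = w := by
  obtain ⟨α, h1, rfl⟩ := exists_enc hw.nonneg
  exact ⟨α, mem_L_iff.2 ⟨h1, hw, hl⟩, rfl⟩

lemma isLeastIn_iff (hα : IsSeq α) : IsLeastIn (L n) α ↔ WLeast n (enc α) := by
  constructor
  · rintro ⟨h1, h2⟩
    obtain ⟨-, h3, h4⟩ := mem_L_iff.1 h1
    refine ⟨h3, h4, fun y hy hl => ?_⟩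
    obtain ⟨β, hβ, rfl⟩ := exists_mem_L hy hl
    by_cases e : β = α
    · rw [e]
    · exact ((lt_iff hα (mem_L_iff.1 hβ).1).1 (h2 β hβ e)).le
  · intro h
    refine ⟨mem_L_iff.2 ⟨hα, h.lex, h.length⟩, fun β hβ hne => ?_⟩
    obtain ⟨h1, h2, h3⟩ := mem_L_iff.1 hβ
    rw [lt_iff hα h1]
    exact lt_of_le_of_ne (h.le _ h2 h3) fun e => hne (enc_injective h1 hα (val_inj e.symm))

lemma isAdjacentTo_iff (hα : IsSeq α) (hβ : IsSeq β) (hl : (enc β).length + 1 = n) :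
    IsAdjacentTo (L n) α β ↔ LexCovBy (enc α) (enc β) := by
  constructor
  · rintro ⟨h1, h2, h3, h4⟩
    obtain ⟨-, h5, h6⟩ := mem_L_iff.1 h1
    refine ⟨h5, (mem_L_iff.1 h2).2.1, by omega, (lt_iff hα hβ).1 h3, fun w hw hwL h7 h8 => h4 ?_⟩
    obtain ⟨γ, hγ, rfl⟩ := exists_mem_L hwL (by omega : w.length + 1 = n)
    have hγs := (mem_L_iff.1 hγ).1
    exact ⟨γ, hγ, (lt_iff hα hγs).2 h7, (lt_iff hγs hβ).2 h8⟩
  · intro h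
    refine ⟨mem_L_iff.2 ⟨hα, h.left, by rw [h.length, hl]⟩, mem_L_iff.2 ⟨hβ, h.right, hl⟩,
      (lt_iff hα hβ).2 h.lt, ?_⟩
    rintro ⟨γ, hγ, h1, h2⟩
    obtain ⟨hγs, h3, h4⟩ := mem_L_iff.1 hγ
    exact h.gap _ (by omega) h3 ((lt_iff hα hγs).1 h1) ((lt_iff hγs hβ).1 h2)

lemma isSeq_singleton (ha : 0 < a) : IsSeq [a] := isSeq_nil.cons ha

lemma incLast_concat (γ : List ℕ) (a : ℕ) : incLast (γ ++ [a]) = γ ++ [a + 1] := by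
  simp [incLast]

lemma isSeq_incLast (h : IsSeq α) : IsSeq (incLast α) := by
  rw [incLast, isSeq_append]
  exact ⟨fun a ha => h a (List.mem_of_mem_dropLast ha), isSeq_singleton (Nat.succ_pos _)⟩

lemma isSeq_evenExt (h : IsSeq α) : IsSeq (evenExt α) := by
  rw [evenExt]; split_ifs
  · exact isSeq_incLast h
  · exact isSeq_append.2 ⟨h, isSeq_singleton one_pos⟩

lemma isSeq_oddExt (h : IsSeq α) : IsSeq (oddExt α) := by
  rw [oddExt]; split_ifs
  · exact isSeq_append.2 ⟨h, isSeq_singleton one_pos⟩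
  · exact isSeq_incLast h

lemma enc_incLast (hτ : τ ≠ []) (ζ : List ℕ) : enc (incLast τ ++ ζ) =
    enc τ ++ if Even τ.length then false :: enc ζ else true :: bar (enc ζ) := by
  rcases List.eq_nil_or_concat τ with rfl | ⟨γ, a, rfl⟩
  · exact absurd rfl hτ
  · rw [List.concat_eq_append, incLast_concat, List.append_assoc, enc_append, enc_append γ]
    by_cases h : Even γ.length
    · simp [h, Nat.even_add_one, List.replicate_succ']
    · simp [h, Nat.even_add_one, List.replicate_succ']

/-- The empty word must be excluded: through the default `0` of `getLastD`, `evenExt []` is `[1]`,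
encoded by the letter 1 instead of 0. -/
lemma enc_evenExt (hτ : τ ≠ []) (ζ : List ℕ) :
    enc (evenExt τ ++ ζ) = enc τ ++ false :: enc ζ := by
  rw [evenExt]
  split_ifs with h
  · rw [enc_incLast hτ, if_pos h]
  · rw [List.append_assoc, enc_append, if_neg h]; simp

lemma enc_oddExt (τ ζ : List ℕ) : enc (oddExt τ ++ ζ) = enc τ ++ true :: bar (enc ζ) := by
  rw [oddExt]
  split_ifs with h
  · rw [List.append_assoc, enc_append, if_pos h]; simp
  · rw [enc_incLast (by rintro rfl; simp at h), if_neg h]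

lemma pow_succ (α : List ℕ) (k : ℕ) : pow α (k + 1) = α ++ pow α k := by
  simp [pow, List.replicate_succ]

lemma isSeq_pow (h : IsSeq α) (k : ℕ) : IsSeq (pow α k) := by
  induction k with
  | zero => exact isSeq_nil
  | succ k ih => rw [pow_succ, isSeq_append]; exact ⟨h, ih⟩

lemma enc_pow_evenExt (hτ : τ ≠ []) (ζ : List ℕ) (k : ℕ) :
    enc (pow (evenExt τ) k ++ ζ) = tower (enc τ) (enc ζ) k := by
  induction k with
  | zero => rfl
  | succ k ih => rw [pow_succ, List.append_assoc, enc_evenExt hτ, ih]; rfl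

lemma append_sub_replicate (u c : List Bool) (k : ℕ) :
    bar u ++ sub u (List.replicate k true ++ bar c) = bar (tower u (u ++ sub u c) k) := by
  induction k with
  | zero => simp [tower]
  | succ k ih =>
    rw [List.replicate_succ, List.cons_append, sub_cons, block_true, ih]
    simp [tower]

lemma enc_star (hβ : IsSeq β) : enc (star τ β) = enc τ ++ sub (enc τ) (enc β) := by
  rw [star]
  split_ifs with h
  · simp [h]
  · induction β with
    | nil => simp
    | cons b β ih =>
      obtain ⟨k, rfl⟩ : ∃ k, b = k + 1 := ⟨b - 1, by have := hβ.of_cons.1; omega⟩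
      rw [List.flatMap_cons, List.append_assoc, List.append_assoc, enc_oddExt, Nat.add_sub_cancel,
        enc_pow_evenExt h, ih hβ.of_cons.2, ← append_sub_replicate]
      rfl

lemma isSeq_star (hτ : IsSeq τ) (hβ : IsSeq β) : IsSeq (star τ β) := by
  rw [star]
  split_ifs with h
  · exact hβ
  · rw [isSeq_append]
    refine ⟨fun a ha => ?_, hτ⟩
    obtain ⟨b, -, hb⟩ := List.mem_flatMap.1 ha
    exact isSeq_append.2 ⟨isSeq_oddExt hτ, isSeq_pow (isSeq_evenExt hτ) _⟩ a hb

/-- Each harmonic is `w_o w` for the preceding harmonic `w`, encoded as `w 1 w̄`; so all harmonics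
are already first harmonics. -/
lemma isFundamental_iff (hα : IsSeq α) :
    IsFundamental α ↔ ∀ w, enc α ≠ w ++ true :: bar w := by
  have hs : ∀ τ j, IsSeq τ → IsSeq (harmonic j τ) := by
    intro τ j hτ
    induction j with
    | zero => exact hτ
    | succ j ih => exact isSeq_append.2 ⟨isSeq_oddExt ih, ih⟩
  constructor
  · intro h w e
    have hw : 0 ≤ val w := by
      have := hα.val_enc_nonneg
      rw [e] at this
      rcases w with _ | ⟨_ | _, w⟩
      · simp
      · exact absurd this (not_le.2 (val_false_neg _))
      · exact (val_true_pos _).le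
    obtain ⟨τ, hτ, rfl⟩ := exists_enc hw
    refine h ⟨τ, 1, hτ, le_rfl, enc_injective (hs _ _ hτ) hα ?_⟩
    rw [e]; exact enc_oddExt τ τ
  · rintro h ⟨τ, j, hτ, hj, rfl⟩
    obtain ⟨j, rfl⟩ : ∃ k, j = k + 1 := ⟨j - 1, by omega⟩
    exact h _ (enc_oddExt _ _)

lemma enc_wedge (hα : IsSeq α) (hβ : IsSeq β) : ∃ s t, enc α = enc (wedge α β) ++ s ∧
    enc β = enc (wedge α β) ++ t ∧ ∀ e s' t', ¬ (s = e :: s' ∧ t = e :: t') := by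
  have hbar : ∀ {δ : List ℕ}, IsSeq δ → ∀ t, bar (enc δ) ≠ true :: t := by
    intro δ hδ t e
    have := val_true_pos t
    rw [← e, val_bar] at this
    linarith [hδ.val_enc_nonneg]
  induction α generalizing β with
  | nil => exact ⟨[], enc β, by simp [wedge], by simp [wedge], by simp⟩
  | cons a α ih =>
    rcases β with _ | ⟨b, β⟩
    · exact ⟨enc (a :: α), [], by simp [wedge], by simp [wedge], by simp⟩
    obtain ⟨ha, hα⟩ := hα.of_cons
    obtain ⟨hb, hβs⟩ := hβ.of_cons
    rcases lt_trichotomy a b with h | rfl | h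
    · obtain ⟨k, rfl⟩ : ∃ k, b = a + (k + 1) := ⟨b - a - 1, by omega⟩
      refine ⟨bar (enc α), List.replicate (k + 1) true ++ bar (enc β), by simp [wedge], ?_, ?_⟩
      · simp only [wedge, if_neg h.ne, min_eq_left h.le, enc_cons, List.replicate_add]; simp
      · rintro e s t ⟨h1, h2⟩
        rw [List.replicate_succ, List.cons_append, List.cons.injEq] at h2
        rw [← h2.1] at h1
        exact hbar hα _ h1
    · obtain ⟨s, t, h1, h2, h3⟩ := ih hα hβs
      refine ⟨bar s, bar t, by simp [wedge, h1], by simp [wedge]; rw [← bar_append, ← h2], ?_⟩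
      rintro e s' t' ⟨h4, h5⟩
      exact h3 (!e) (bar s') (bar t') ⟨by rw [← bar_bar s, h4]; rfl, by rw [← bar_bar t, h5]; rfl⟩
    · obtain ⟨k, rfl⟩ : ∃ k, a = b + (k + 1) := ⟨a - b - 1, by omega⟩
      refine ⟨List.replicate (k + 1) true ++ bar (enc α), bar (enc β), ?_, by simp [wedge], ?_⟩
      · simp only [wedge, if_neg h.ne', min_eq_right h.le, enc_cons, List.replicate_add]; simp
      · rintro e s t ⟨h1, h2⟩
        rw [List.replicate_succ, List.cons_append, List.cons.injEq] at h1
        rw [← h1.1] at h2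
        exact hbar hβs _ h2

lemma enc_wedge_eq (hα : IsSeq α) (hβ : IsSeq β) (h₁ : enc α = u ++ false :: z)
    (h₂ : enc β = u ++ true :: x) : enc (wedge α β) = u := by
  obtain ⟨s, t, h3, h4, h5⟩ := enc_wedge hα hβ
  rw [h₁] at h3
  rw [h₂] at h4
  rcases List.append_eq_append_iff.1 h3 with ⟨p, h6, h7⟩ | ⟨p, h6, h7⟩
  · rw [h6, List.append_assoc] at h4
    have h4 := List.append_cancel_left h4
    rcases p with _ | ⟨b, p⟩
    · simp [h6]
    · simp at h4 h7
      exact absurd (h4.1.symm.trans h7.1) (by simp)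
  · rcases p with _ | ⟨b, p⟩
    · simp [h6]
    · rw [h6, List.append_assoc] at h4
      exact absurd ⟨h7, (List.append_cancel_left h4).symm⟩ (h5 _ _ _)

lemma isSeq_wedge (hα : IsSeq α) (hβ : IsSeq β) : IsSeq (wedge α β) := by
  induction α generalizing β with
  | nil => simp [wedge, isSeq_nil]
  | cons a α ih =>
    rcases β with _ | ⟨b, β⟩
    · simp [wedge, isSeq_nil]
    obtain ⟨ha, hα⟩ := hα.of_cons
    obtain ⟨hb, hβs⟩ := hβ.of_cons
    rw [wedge]
    split_ifs
    · exact (ih hα hβs).cons ha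
    · exact isSeq_singleton (lt_min ha hb)

/-! ### Elementary operations, companions and predecessors of sequences -/

variable {α β γ ρ τ ζ g gh : List ℕ} {a b m n i j k : ℕ} {u v w x z : List Bool}

/-- On an odd-numbered cell, splitting and merging both turn the last letter 1 of the cell into 0
and complement all that follows. The sum locates this letter, so longer left sequences alter later
letters. -/
lemma ElemOpAt.enc_eq (h : ElemOpAt i α β) (hi : Odd i) : ∃ u x, enc α = u ++ true :: x ∧
    enc β = u ++ false :: bar x ∧ u.length + 1 = (α.take i).sum ∧ i ≤ α.length := by
  cases h with
  | splitCell γ ρ a ha =>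
    have hγ : Even γ.length := by simpa [Nat.odd_add_one] using hi
    obtain ⟨k, rfl⟩ : ∃ k, a = k + 1 := ⟨a - 1, by omega⟩
    refine ⟨enc γ ++ List.replicate k true, bar (enc ρ), ?_, ?_, ?_, by simp⟩
    · simp [enc_append, hγ, List.replicate_succ']
    · simp [enc_append, hγ]
    · rw [List.take_append, List.take_of_length_le (by omega)]; simp; omega
  | conjCell γ ρ b =>
    have hγ : ¬ Even γ.length := by
      rw [Nat.not_even_iff_odd]
      simpa [Nat.odd_add] using hi
    refine ⟨enc γ ++ List.replicate b false, bar (enc ρ), ?_, ?_, ?_, by simp⟩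
    · simp [enc_append, hγ, bar]
    · simp [enc_append, hγ, bar, List.replicate_succ']
    · rw [List.take_append, List.take_of_length_le (by omega)]; simp; omega

lemma elemOpAt_oddExt (hτ : IsSeq τ) (h0 : τ ≠ []) (ρ : List ℕ) :
    ∃ i, Odd i ∧ ElemOpAt i (oddExt τ ++ ρ) (evenExt τ ++ ρ) := by
  rcases List.eq_nil_or_concat τ with rfl | ⟨γ, b, rfl⟩
  · exact absurd rfl h0
  rw [List.concat_eq_append] at *
  by_cases h : Even γ.length
  · have h' : ¬ Even (γ ++ [b]).length := by simpa [Nat.even_add_one] using h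
    refine ⟨γ.length + 1, h.add_one, ?_⟩
    rw [oddExt, evenExt, if_neg h', if_neg h', incLast_concat]
    have hb : 0 < b := hτ b (by simp)
    simpa using ElemOpAt.splitCell γ ρ (b + 1) (by omega)
  · have h' : Even (γ ++ [b]).length := by simpa [Nat.even_add_one] using h
    refine ⟨γ.length + 2, (Nat.not_even_iff_odd.1 h).add_even even_two, ?_⟩
    rw [oddExt, evenExt, if_pos h', if_pos h', incLast_concat]
    simpa using ElemOpAt.conjCell γ ρ b

lemma exists_elemOpAt (hα : IsSeq α) (h : enc α = u ++ true :: bar z) (hz : 0 ≤ val z)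
    (hu : 0 ≤ val (u ++ false :: z)) :
    ∃ i β, Odd i ∧ ElemOpAt i α β ∧ IsSeq β ∧ enc β = u ++ false :: z := by
  obtain ⟨ρ, hρ, rfl⟩ := exists_enc hz
  obtain ⟨τ, hτ, rfl⟩ := exists_enc (hu.trans (val_append_false_lt _ _).le)
  have h0 : τ ≠ [] := by
    rintro rfl
    exact absurd hu (not_le.2 (val_false_neg _))
  obtain ⟨i, hi, hop⟩ := elemOpAt_oddExt hτ h0 ρ
  have e : oddExt τ ++ ρ = α :=
    enc_injective (isSeq_append.2 ⟨isSeq_oddExt hτ, hρ⟩) hα (by rw [enc_oddExt, h])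
  exact ⟨i, _, hi, e ▸ hop, isSeq_append.2 ⟨isSeq_evenExt hτ, hρ⟩, enc_evenExt h0 ρ⟩

lemma sum_take_lt (hα : IsSeq α) (h : i < j) (hj : j ≤ α.length) :
    (α.take i).sum < (α.take j).sum := by
  induction α generalizing i j with
  | nil => simp at hj; omega
  | cons a α ih =>
    obtain ⟨j, rfl⟩ : ∃ k, j = k + 1 := ⟨j - 1, by omega⟩
    obtain ⟨ha, hα⟩ := hα.of_cons
    rcases i with _ | i
    · simp; omega
    · simpa using ih hα (by omega) (by simpa using hj)

lemma enc_replicate_one (k : ℕ) : enc (List.replicate (2 * k) 1) = alt k := by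
  induction k with
  | zero => rfl
  | succ k ih => simp [mul_add, List.replicate_succ, ih, alt]

lemma enc_two_replicate_one (k : ℕ) : enc (2 :: List.replicate (2 * k) 1) = odd k := by
  rw [enc_cons, enc_replicate_one]; rfl

lemma isSeq_replicate_one (k : ℕ) : IsSeq (List.replicate k 1) := fun a ha => by
  rw [List.eq_of_mem_replicate ha]; exact one_pos

lemma exists_isCompanion (hg : g ∈ L m) (hf : IsFundamental g) (h0 : g ≠ []) :
    ∃ gh, IsCompanion m g gh := by
  obtain ⟨hs, hw, hl⟩ := mem_L_iff.1 hg
  have hpos : 0 < (enc g).length := by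
    rw [List.length_pos_iff]
    exact fun h => h0 (enc_injective hs isSeq_nil h)
  rcases exists_companion hw hpos ((isFundamental_iff hs).1 hf) with
    ⟨t, k, ht, e⟩ | ⟨hn, u, z, hu, hz, hm, e, hc⟩
  · obtain ⟨τ, hτ, rfl⟩ := exists_mem_L ht rfl
    have hτs := (mem_L_iff.1 hτ).1
    refine ⟨_, Or.inl ⟨_, 2 * k + 3, τ, hτ, ?_, ⟨k + 1, by ring⟩, by omega, ?_, rfl⟩⟩
    · rw [← hl, e, length_append_sub, length_odd]
    · have hβ : IsSeq (2 :: List.replicate (2 * k) 1) := (isSeq_replicate_one _).cons two_pos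
      exact enc_injective hs (isSeq_star hτs hβ) (by
        rw [e, show 2 * k + 3 - 3 = 2 * k by omega, enc_star hβ, enc_two_replicate_one])
  · obtain ⟨τ, hτ, rfl⟩ := exists_mem_L hu rfl
    obtain ⟨ζ, hζ, rfl⟩ := exists_enc hz
    have hτs := (mem_L_iff.1 hτ).1
    have hτ0 : τ ≠ [] := by rintro rfl; simp at hm
    rw [hl] at hn hm
    have hes : IsSeq (evenExt τ ++ ζ) := isSeq_append.2 ⟨isSeq_evenExt hτs, hζ⟩
    refine ⟨evenExt τ ++ ζ, Or.inr ⟨by rwa [isLeastIn_iff hs],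
      (isAdjacentTo_iff hes hs hl).2 (by rwa [enc_evenExt hτ0]), _, τ, ζ, hτ, hm, hζ, ?_, rfl⟩⟩
    exact enc_injective hs (isSeq_append.2 ⟨isSeq_oddExt hτs, hζ⟩) (by rw [e, enc_oddExt])

lemma IsCompanion.mate (h : IsCompanion m g gh) (hg : g ∈ L m) (hf : IsFundamental g) :
    IsSeq gh ∧ Mate (enc g) (enc gh) := by
  obtain ⟨hs, hw, hl⟩ := mem_L_iff.1 hg
  have hne := (isFundamental_iff hs).1 hf
  rcases h with ⟨m₁, r, τ, hτ, -, hr, hr1, rfl, rfl⟩ | ⟨-, h, m₁, τ, ζ, hτ, hm, hζ, rfl, rfl⟩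
  · obtain ⟨k, rfl⟩ : ∃ k, r = 2 * k + 3 := by
      obtain ⟨k, hk⟩ := hr
      exact ⟨k - 1, by omega⟩
    obtain ⟨hτs, hτw, -⟩ := mem_L_iff.1 hτ
    have hβ : IsSeq (2 :: List.replicate (2 * k) 1) := (isSeq_replicate_one _).cons two_pos
    refine ⟨isSeq_star hτs (isSeq_replicate_one _), mate_odd hτw k ?_ ?_ hne⟩
    · rw [show 2 * k + 3 - 3 = 2 * k by omega, enc_star hβ, enc_two_replicate_one]
    · rw [enc_star (isSeq_replicate_one _), show 2 * k + 3 - 1 = 2 * (k + 1) by omega,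
        enc_replicate_one]
  · obtain ⟨hτs, hτw, hτl⟩ := mem_L_iff.1 hτ
    have hgs := (mem_L_iff.1 h.1).1
    have hτ0 : τ ≠ [] := by
      rintro rfl
      exact hm (by rw [← hτl]; simp)
    have hc := (isAdjacentTo_iff hgs hs hl).1 h
    rw [← hl, ← hτl] at hm
    rw [enc_evenExt hτ0, enc_oddExt] at hc
    rw [enc_oddExt] at hm hne
    exact ⟨hgs, by rw [enc_evenExt hτ0, enc_oddExt]; exact mate_of_lexCovBy hc hτw hm hne⟩

lemma isAdjacentTo_of_isStarOfLeast {d : ℕ} {lam : List ℕ} (h : IsStarOfLeast n m d g lam α)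
    (h0 : g ≠ []) (hgh : IsCompanion m g gh) :
    IsAdjacentTo (L n) (pow (evenExt g) (d - 1) ++ gh) α := by
  obtain ⟨rfl, hd, hg, hf, hlam, rfl⟩ := h
  obtain ⟨hs, M⟩ := hgh.mate hg hf
  obtain ⟨hgs, -, hl⟩ := mem_L_iff.1 hg
  have hls := (mem_L_iff.1 hlam.1).1
  have hlw := (isLeastIn_iff hls).1 hlam
  rw [isAdjacentTo_iff (isSeq_append.2 ⟨isSeq_pow (isSeq_evenExt hgs) _, hs⟩) (isSeq_star hgs hls),
    enc_star hls, enc_pow_evenExt h0]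
  · exact M.lexCovBy hd hlw
  · rw [enc_star hls, length_append_sub, hl, hlw.length]

/-- The predecessor of a word which is not obtained by substitution from a least word. -/
lemma exists_predecessor (hα : α ∈ L n) (hmin : ¬ IsLeastIn (L n) α)
    (h : ¬ ∃ (m d : ℕ) (g lam : List ℕ), IsStarOfLeast n m d g lam α) :
    ∃ u z, WLex u ∧ ¬ u.length + 1 ∣ n ∧ 0 ≤ val z ∧ enc α = u ++ true :: bar z ∧
      LexCovBy (u ++ false :: z) (u ++ true :: bar z) := by
  obtain ⟨hs, hw, hl⟩ := mem_L_iff.1 hα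
  rw [isLeastIn_iff hs, ← hl] at hmin
  obtain ⟨P, hP⟩ := exists_lexCovBy hw hmin
  obtain ⟨u, z, x, rfl, e, hu, -⟩ := hP.split
  rw [e] at hP hl
  have hm : ¬ u.length + 1 ∣ n := by
    rintro ⟨d, hd⟩
    rcases d with _ | d
    · omega
    obtain ⟨l, hlw⟩ := exists_wLeast d
    obtain ⟨h2, e'⟩ := hP.eq_append_sub hu (hl.trans hd) hlw
    obtain ⟨g, hg, rfl⟩ := exists_mem_L hu rfl
    obtain ⟨lam, hlam, rfl⟩ := exists_mem_L hlw.lex hlw.length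
    have hgs := (mem_L_iff.1 hg).1
    have hls := (mem_L_iff.1 hlam).1
    -- `g` is fundamental because the predecessor continues it with the letter 0.
    exact h ⟨_, _, g, lam, hd, h2, hg, (isFundamental_iff hgs).2 (ne_of_wLex hP.left),
      (isLeastIn_iff hls).2 hlw,
      enc_injective hs (isSeq_star hgs hls) (by rw [e, e', enc_star hls])⟩
  obtain ⟨rfl, hz, -⟩ := hP.eq_bar hu (by rwa [hl])
  exact ⟨u, z, hu, hm, hz, e, hP⟩

end AlphaSeq

/-! ### The theorem -/

open AlphaSeq

theorem mainTheorem2 (n : ℕ) (α' : List ℕ) (hα' : α' ∈ AlphaSeq.L n)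
    (hmin : ¬ AlphaSeq.IsLeastIn (AlphaSeq.L n) α') :
    (∀ (m d : ℕ) (g lam : List ℕ), AlphaSeq.IsStarOfLeast n m d g lam α' →
      (∃ gh, AlphaSeq.IsCompanion m g gh) ∧
      ∀ gh, AlphaSeq.IsCompanion m g gh →
        AlphaSeq.IsAdjacentTo (AlphaSeq.L n)
          (AlphaSeq.pow (AlphaSeq.evenExt g) (d - 1) ++ gh) α') ∧
    ((¬ ∃ (m d : ℕ) (g lam : List ℕ), AlphaSeq.IsStarOfLeast n m d g lam α') →
      (∃ α, AlphaSeq.IsLongestOddPreceding n α' α) ∧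
      ∀ α, AlphaSeq.IsLongestOddPreceding n α' α →
        AlphaSeq.IsAdjacentTo (AlphaSeq.L n) α α' ∧
        ∃ m d r : ℕ, AlphaSeq.wedge α α' ∈ AlphaSeq.L m ∧ n = m * d + r ∧ 0 < r ∧ r < m) := by
  obtain ⟨hs, hw, hl⟩ := mem_L_iff.1 hα'
  refine ⟨fun m d g lam h => ?_, fun h => ?_⟩
  -- For `g = []` the star product is `lam`, and `α'` would be least.
  · have h0 : g ≠ [] := by
      rintro rfl
      obtain ⟨hn, -, ⟨-, -, hm⟩, -, hlam, e⟩ := h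
      obtain rfl : m = 1 := by simpa using hm.symm
      rw [AlphaSeq.star, if_pos rfl] at e
      rw [one_mul] at hn
      subst e hn
      exact hmin hlam
    exact ⟨exists_isCompanion h.2.2.1 h.2.2.2.1 h0,
      fun gh hgh => isAdjacentTo_of_isStarOfLeast h h0 hgh⟩
  · obtain ⟨u, z, hu, hm, hz, e, hP⟩ := exists_predecessor hα' hmin h
    obtain ⟨i₀, β₀, hi₀, hop₀, hβ₀, e₀⟩ := exists_elemOpAt hs e hz hP.left.nonneg
    have hadj : IsAdjacentTo (L n) β₀ α' := by
      rw [isAdjacentTo_iff hβ₀ hs hl, e₀, e]; exact hP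
    have hpre : IsOddPreceding n i₀ α' β₀ := ⟨hi₀, hop₀, hadj.1, hadj.2.2.1⟩
    obtain ⟨u₀, x₀, h1, h2, h3, h4⟩ := hop₀.enc_eq hi₀
    -- A longer odd left sequence leaves the letter 1 after `u₀` intact, so its result would lie
    -- strictly between `β₀` and `α'`, against adjacency. Equal lengths alter the same letter, hence
    -- give the same result.
    have key : ∀ j β, IsOddPreceding n j α' β → j ≤ i₀ ∧ (j = i₀ → β = β₀) := by
      rintro j β ⟨hj, hop, hβ, hlt⟩
      have hβs := (mem_L_iff.1 hβ).1
      obtain ⟨v, y, h5, h6, h7, h8⟩ := hop.enc_eq hj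
      have hpq := h5.symm.trans h1
      refine ⟨?_, ?_⟩
      · by_contra hc
        have hlen := sum_take_lt hs (not_le.1 hc) h8
        rcases List.append_eq_append_iff.1 hpq with ⟨p, h9, -⟩ | ⟨p, rfl, h10⟩
        · have := congrArg List.length h9
          simp at this; omega
        · rcases p with _ | ⟨b, p⟩
          · simp at h7; omega
          · simp only [List.cons_append, List.cons.injEq] at h10
            refine hadj.2.2.2 ⟨β, hβ, (lt_iff hβ₀ hβs).2 ?_, hlt⟩
            rw [h2, h6, ← h10.1, List.append_assoc]
            exact val_append_false_lt_true _ _ _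
      · rintro rfl
        obtain ⟨rfl, h9⟩ := List.append_inj hpq (by omega)
        rw [List.cons.injEq] at h9
        exact enc_injective hβs hβ₀ (by rw [h6, h2, h9.2])
    refine ⟨⟨β₀, i₀, hpre, fun j β hβ => (key j β hβ).1⟩, ?_⟩
    rintro α ⟨i, hi, hmax⟩
    obtain rfl : α = β₀ := (key i α hi).2 (le_antisymm (key i α hi).1 (hmax i₀ β₀ hpre))
    refine ⟨hadj, u.length + 1, n / (u.length + 1), n % (u.length + 1), ?_,
      (Nat.div_add_mod n _).symm, Nat.pos_of_ne_zero fun h => hm (Nat.dvd_of_mod_eq_zero h),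
      Nat.mod_lt _ (Nat.succ_pos _)⟩
    have hew := enc_wedge_eq hβ₀ hs e₀ e
    exact mem_L_iff.2 ⟨isSeq_wedge hβ₀ hs, by rwa [hew], by rw [hew]⟩
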